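/- Let $(B_i,A_i)_{i\ge 1}$ be i.i.d. pairs of non-negative random variables (service times and inter-arrival times; $B_i$ and $A_i$ may be dependent), with generic pair $(B,A)$ and $\mathbb P(A=B)=0$. Put $h(s_1,s_2)=\mathbb E\,e^{-s_1B-s_2A}$ for $\operatorname{Re}s_1,\operatorname{Re}s_2\ge 0$, $b_n=\sum_{i\le n}B_i$, $S_n=\sum_{i\le n}(B_i-A_i)$, let $N=\inf\{n\ge1: S_n<0\}\in\{1,2,\dots\}\cup\{\infty\}$ and let $P=b_N$ be the busy period. $\mathbb E[z^Ne^{-sP}]$ is understood as $\mathbb E[z^Ne^{-sP};\,N<\infty]$. Assume that for all $s_2$ with $\operatorname{Re}s_2\ge0$ the function $h(\cdot,s_2)$ is rational, $$h(s_1,s_2)=\frac{h_1(s_1,s_2)}{h_2(s_1,s_2)},$$ where $h_1(\cdot,s_2)$ and $h_2(\cdot,s_2)\not\equiv0$ are polynomials whose coefficients are holomorphic in $s_2$ for $\operatorname{Re}s_2>0$. Assume also that for every $s$ with $\operatorname{Re}s\ge0$ the function $\xi\mapsto h_2(\xi,s-\xi)$ has finitely many zeros with $\operatorname{Re}\xi<0$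 (if $h_1(\xi,s-\xi)$ and $h_2(\xi,s-\xi)$ have no common zeros there, this says that $h(\xi,s-\xi)$ has finitely many poles in the left half-plane). Zeros are counted with multiplicity. For $\operatorname{Re}s\ge0$ let $\xi_1(s),\dots,\xi_n(s)$, $n=n(s)$, be the zeros of $h_2(\xi,s-\xi)$ with negative real part. 1. If $\operatorname{Re}s>0$ and $|z|<1$, then $h_2(\xi,s-\xi)-z\,h_1(\xi,s-\xi)$ also has exactly $n$ zeros $\xi_1(z,s),\dots,\xi_n(z,s)$ with negative real part, and $$\mathbb E[z^Ne^{-sP}]=1-[1-z\,h(s,0)]\,\frac{\prod_{i=1}^n[s-\xi_i(s)]}{\prod_{i=1}^n[s-\xi_i(z,s)]}.$$ 2. If $\mathbb E B<\mathbb E A$ (where $\mathbb E A=\infty$ is allowed), then $N<\infty$ almost surely, and for every $s$ with $\operatorname{Re}s\ge0$ the function $h_2(\xi,s-\xi)-h_1(\xi,s-\xi)$ has exactly $n$ zeros $\xi_1(1,s),\dots,\xi_n(1,s)$ with negative real part, and $$\mathbb E[e^{-sP}]=1-[1-h(s,0)]\,\frac{\prod_{i=1}^n[s-\xi_i(s)]}{\prod_{i=1}^n[s-\xi_i(1,s)]}.$$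 -/

import Mathlib

open MeasureTheory ProbabilityTheory Polynomial

noncomputable section

namespace BusyPeriod

/-- The joint Laplace-Stieltjes transform `h(s₁, s₂) = E[exp(-s₁ B - s₂ A)]`
of a pair of random variables. -/
def jointLST {Ω : Type*} [MeasurableSpace Ω] (μ : Measure Ω) (B A : Ω → ℝ) (s₁ s₂ : ℂ) : ℂ :=
  ∫ ω, Complex.exp (-s₁ * (B ω : ℂ) - s₂ * (A ω : ℂ)) ∂μ

/-- The partial sums `b_n = B_1 + ... + B_n` (the variables are indexed from `0` here). -/
def partialSum {Ω : Type*} (B : ℕ → Ω → ℝ) (n : ℕ) (ω : Ω) : ℝ :=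
  ∑ i ∈ Finset.range n, B i ω

/-- The random walk `S_n`, started at `S_0 = 0`, with increments `B_i - A_i`. -/
def walk {Ω : Type*} (B A : ℕ → Ω → ℝ) (n : ℕ) (ω : Ω) : ℝ :=
  ∑ i ∈ Finset.range n, (B i ω - A i ω)

/-- `N`, the first `n` with `S_n < 0`; it is `⊤` if the walk never becomes negative.
Since `S_0 = 0`, always `N ≥ 1`. -/
def firstNegative {Ω : Type*} (B A : ℕ → Ω → ℝ) (ω : Ω) : ℕ∞ :=
  ⨅ (n : ℕ) (_ : walk B A n ω < 0), (n : ℕ∞)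

open Classical in
/-- `E[z^N exp(-s P)]` with `P = b_N`; the event `N = ∞` contributes `0`. -/
def busyTransform {Ω : Type*} [MeasurableSpace Ω] (μ : Measure Ω) (B A : ℕ → Ω → ℝ)
    (z s : ℂ) : ℂ :=
  ∫ ω, (if firstNegative B A ω = ⊤ then 0 else
    z ^ (firstNegative B A ω).toNat *
      Complex.exp (-s * (partialSum B (firstNegative B A ω).toNat ω : ℂ))) ∂μ

/-- For a family `p(·, s₂)` of polynomials in the first variable, the function
`ξ ↦ p(ξ, s - ξ)`. -/
def antidiag (p : ℂ → ℂ[X]) (s ξ : ℂ) : ℂ := (p (s - ξ)).eval ξ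

/-- `ξ 0, ..., ξ (n-1)` are exactly the zeros of `f` with negative real part, each listed as
often as its multiplicity. -/
structure ListsLeftZeros (f : ℂ → ℂ) {n : ℕ} (ξ : Fin n → ℂ) : Prop where
  analytic : AnalyticOnNhd ℂ f {w : ℂ | w.re < 0}
  re_neg : ∀ i, (ξ i).re < 0
  count : ∀ w : ℂ, w.re < 0 → (Nat.card {i : Fin n // ξ i = w} : ℕ∞) = analyticOrderAt f w

/-- The function `h(s₁, s₂)`, for `Re s₁, Re s₂ ≥ 0`, is for each `s₂` the quotient
`h₁(s₁, s₂) / h₂(s₁, s₂)` of two polynomials in `s₁`, whose coefficients are holomorphic in `s₂`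
for `Re s₂ > 0`. The two polynomials may have common zeros. -/
structure IsRationalInFirst (h : ℂ → ℂ → ℂ) (h₁ h₂ : ℂ → ℂ[X]) : Prop where
  holo₁ : ∀ k : ℕ, DifferentiableOn ℂ (fun s₂ => (h₁ s₂).coeff k) {s₂ : ℂ | 0 < s₂.re}
  holo₂ : ∀ k : ℕ, DifferentiableOn ℂ (fun s₂ => (h₂ s₂).coeff k) {s₂ : ℂ | 0 < s₂.re}
  ne_zero : ∀ s₂ : ℂ, 0 ≤ s₂.re → h₂ s₂ ≠ 0
  eq_div : ∀ s₁ s₂ : ℂ, 0 ≤ s₁.re → 0 ≤ s₂.re → (h₂ s₂).eval s₁ ≠ 0 →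
    h s₁ s₂ = (h₁ s₂).eval s₁ / (h₂ s₂).eval s₁

end BusyPeriod

end

noncomputable section

namespace BusyPeriod


/-! ### Entire functions and growth -/

/-! The proof is a Wiener–Hopf factorization. Let `D` (`descFactor`) be one minus the transform of
the first passage of the walk below zero, holomorphic for `Re ξ < Re s`, and `U` (`ascFactor`) the
analogous factor for the first return to `[0, ∞)`, holomorphic for `Re ξ > 0`. Summing the one-step
recursion and applying Liouville's theorem gives `D U = 1 - z h(ξ, s - ξ)` on the strip between the
two boundaries (`IsModel.one_sub_leave_eq`, `IsModel.descSeries_mul_descFactor`). At `ξ = s` the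
exponent `-s a_N - ξ S_N` equals `-s b_N`, so `D` is there one minus the wanted transform, and it
remains to identify `U` at `ξ = s` as a quotient of products over zeros.

The difficulty is that `h₂(ξ, s - ξ)` is not a polynomial in `ξ`, so the rationality of `U` in `ξ`
is not evident. Split one step into its upward part (`B > A`) and its downward part (`B < A`). On
the strip the upward part is `h₁ / h₂` minus the downward part, which is holomorphic and bounded on
the left. Multiplied by a polynomial `q` that carries the left zeros of `h₂(ξ, s - ξ)`, the upward
part is therefore entire (`IsModel.exists_entire_extension`), but its growth on the left is unknown.
For fixed `τ = s - ξ`, however, `h₁` and `h₂` are polynomials of bounded degree with `|h₁| ≤ |h₂|`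
on the right, and the mean of `log⁺ |h₁ / h₂|` over `s ∈ [1, 2]` is `O(√(1 + |τ|))`
(`exists_lintegral_posLog_ratio_le`). By Fubini a weighted area integral is finite for almost every
`s`; the sub-mean value property of `log⁺` turns it into growth of order below one, and
Phragmén–Lindelöf into polynomial growth. So the upward part is rational for almost every `s ∈ [1,
2]`. Rationality of bounded degree is the vanishing of determinants holomorphic in `s`, hence it
spreads to all `Re s > 0` (`IsModel.exists_stepUp_rational`).

Another Liouville argument makes `w = q U` a polynomial, and compactness of normalized coefficient
vectors carries the identities to the boundary `|z| = 1`, `Re s = 0` (`IsModel.exists_isTriple`).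
After common roots are removed, `q` and `w` have the same degree and leading coefficient. The roots
of `q` lie on the left, and so do those of `w`, because `U` does not vanish on the right: its
inverse is bounded by `∑ |z|^n P(n < N)`, finite for `|z| < 1` and, by a Wald argument, under
negative drift for `z = 1`. On the left `q (h₂ - z h₁) = h₂ w D` with `D` free of zeros, so passing
from `h₂` to `h₂ - z h₁` exchanges the roots of `q` for those of `w`. This gives both the count of
zeros and the value of `U` at `s`. -/

/-- Two holomorphic functions on overlapping half-planes which agree on the common strip are
restrictions of one entire function. -/
theorem exists_entire_of_eqOn_strip {f g : ℂ → ℂ} {c : ℝ} (hc : 0 < c)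
    (hf : DifferentiableOn ℂ f {z | 0 < z.re}) (hg : DifferentiableOn ℂ g {z | z.re < c})
    (h : ∀ z : ℂ, 0 < z.re → z.re < c → f z = g z) :
    ∃ W : ℂ → ℂ, Differentiable ℂ W ∧ (∀ z : ℂ, 0 < z.re → W z = f z) ∧
      ∀ z : ℂ, z.re < c → W z = g z := by
  classical
  have ho1 : IsOpen {z : ℂ | 0 < z.re} := isOpen_lt continuous_const Complex.continuous_re
  have ho2 : IsOpen {z : ℂ | z.re < c} := isOpen_lt Complex.continuous_re continuous_const
  have hWf : ∀ z : ℂ, 0 < z.re → (if z.re < c then g z else f z) = f z := by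
    intro z hz
    split_ifs with h1
    · exact (h z hz h1).symm
    · rfl
  have hWg : ∀ z : ℂ, z.re < c → (if z.re < c then g z else f z) = g z := by
    intro z hz
    rw [if_pos hz]
  refine ⟨fun z => if z.re < c then g z else f z, fun z => ?_, hWf, hWg⟩
  by_cases hz : z.re < c
  · refine ((hg z hz).differentiableAt (ho2.mem_nhds hz)).congr_of_eventuallyEq ?_
    filter_upwards [ho2.mem_nhds hz] with w hw using hWg w hw
  · have hz' : 0 < z.re := by linarith
    refine ((hf z hz').differentiableAt (ho1.mem_nhds hz')).congr_of_eventuallyEq ?_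
    filter_upwards [ho1.mem_nhds hz'] with w hw using hWf w hw

/-- An entire function of polynomial growth is a polynomial. -/
theorem exists_polynomial_of_growth {W : ℂ → ℂ} (hW : Differentiable ℂ W) {C : ℝ} {m : ℕ}
    (h : ∀ z, ‖W z‖ ≤ C * (1 + ‖z‖) ^ m) :
    ∃ p : ℂ[X], p.natDegree ≤ m ∧ ∀ z, W z = p.eval z := by
  have hC : 0 ≤ C := by
    have := (norm_nonneg _).trans (h 0)
    simpa using this
  have hzero : ∀ k, m < k → iteratedDeriv k W 0 = 0 := by
    intro k hk
    -- Cauchy's estimate on the circle of radius `R` is `O(R ^ (m - k))`, and `k > m` leaves at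
    -- least one factor `R⁻¹`.
    have hb : ∀ R : ℝ, 1 ≤ R → ‖iteratedDeriv k W 0‖ ≤ (k.factorial * C * 2 ^ m) * R⁻¹ := by
      intro R hR
      have hR0 : 0 < R := by linarith
      have h1 := Complex.norm_iteratedDeriv_le_of_forall_mem_sphere_norm_le (n := k) (c := 0)
        (f := W) (C := C * (1 + R) ^ m) hR0 hW.diffContOnCl (by
          intro z hz
          have : ‖z‖ = R := by simpa using hz
          rw [← this]; exact h z)
      refine h1.trans ?_
      rw [div_le_iff₀ (by positivity)]
      have h2 : (1 + R) ^ m ≤ (2 * R) ^ m := by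
        apply pow_le_pow_left₀ (by linarith); linarith
      have h3 : R ^ m ≤ R⁻¹ * R ^ k := by
        rw [← div_eq_inv_mul, le_div_iff₀ hR0, ← pow_succ]
        exact pow_le_pow_right₀ hR hk
      calc (k.factorial : ℝ) * (C * (1 + R) ^ m) ≤ k.factorial * (C * (2 * R) ^ m) := by gcongr
        _ = k.factorial * C * 2 ^ m * R ^ m := by rw [mul_pow]; ring
        _ ≤ k.factorial * C * 2 ^ m * (R⁻¹ * R ^ k) := by gcongr
        _ = _ := by ring
    have hlim : Filter.Tendsto (fun R : ℝ => (k.factorial * C * 2 ^ m) * R⁻¹) Filter.atTop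
        (nhds 0) := by
      simpa using tendsto_inv_atTop_zero.const_mul ((k.factorial : ℝ) * C * 2 ^ m)
    have : ‖iteratedDeriv k W 0‖ ≤ 0 :=
      ge_of_tendsto hlim (Filter.eventually_atTop.2 ⟨1, fun R hR => hb R hR⟩)
    exact norm_le_zero_iff.1 this
  refine ⟨∑ k ∈ Finset.range (m + 1), Polynomial.monomial k ((k.factorial : ℂ)⁻¹ *
    iteratedDeriv k W 0), ?_, ?_⟩
  · refine Polynomial.natDegree_sum_le_of_forall_le _ _ ?_
    intro k hk
    exact (Polynomial.natDegree_monomial_le _).trans (by simpa [Nat.lt_succ_iff] using hk)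
  · intro z
    have h1 := Complex.taylorSeries_eq_of_entire' 0 z hW
    rw [← h1, tsum_eq_sum (s := Finset.range (m + 1))]
    · simp [Polynomial.eval_finsetSum]
    · intro k hk
      rw [hzero k (by simpa using hk)]
      simp

/-- The sub-mean value property of `log⁺ ‖W‖` on circles. -/
theorem posLog_norm_le_circleAverage {W : ℂ → ℂ} (hW : Differentiable ℂ W) (c : ℂ) {R : ℝ}
    (hR : 0 < R) :
    Real.posLog ‖W c‖ ≤ Real.circleAverage (fun z => Real.posLog ‖W z‖) c R := by
  have han : AnalyticOnNhd ℂ W (Metric.closedBall c |R|) := fun z _ => hW.analyticAt z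
  have hcont : Continuous fun z => Real.posLog ‖W z‖ :=
    Real.continuous_posLog.comp hW.continuous.norm
  have hnn : 0 ≤ Real.circleAverage (fun z => Real.posLog ‖W z‖) c R :=
    Real.circleAverage_nonneg_of_nonneg fun z _ => Real.posLog_nonneg
  by_cases hc : W c = 0
  · simpa [hc] using hnn
  have hJ := han.circleAverage_log_norm hR.ne' hc
  -- In Jensen's formula the zeros in the disc contribute with a sign: the divisor of an entire
  -- function is effective and `‖c - u‖ ≤ R`.
  have hsum : 0 ≤ ∑ᶠ u, (MeromorphicOn.divisor W (Metric.closedBall c |R|) u : ℝ) *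
      Real.log (R * ‖c - u‖⁻¹) := by
    refine finsum_nonneg fun u => ?_
    by_cases hu : u ∈ Metric.closedBall c |R|
    · refine mul_nonneg ?_ ?_
      · have := MeromorphicOn.AnalyticOnNhd.divisor_nonneg han
        exact_mod_cast this u
      · by_cases hcu : c = u
        · simp [hcu]
        · have h1 : 0 < ‖c - u‖ := norm_pos_iff.2 (sub_ne_zero.2 hcu)
          apply Real.log_nonneg
          rw [← div_eq_mul_inv, one_le_div h1]
          simpa [abs_of_pos hR, dist_comm, dist_eq_norm] using hu
    · rw [Function.locallyFinsuppWithin.apply_eq_zero_of_notMem _ hu]; simp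
  have hmono : Real.circleAverage (fun z => Real.log ‖W z‖) c R ≤
      Real.circleAverage (fun z => Real.posLog ‖W z‖) c R := by
    refine Real.circleAverage_mono ?_ hcont.continuousOn.circleIntegrable'
      fun z _ => le_max_right _ _
    exact MeromorphicOn.circleIntegrable_log_norm (fun z hz => (hW.analyticAt z).meromorphicAt)
  exact max_le hnn (by linarith)

/-- The sub-mean value property of `log⁺ ‖W‖` on discs. -/
theorem posLog_norm_le_lintegral_ball {W : ℂ → ℂ} (hW : Differentiable ℂ W) (c : ℂ) {R : ℝ}
    (hR : 0 < R) :
    ENNReal.ofReal (Real.pi * R ^ 2 * Real.posLog ‖W c‖) ≤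
      ∫⁻ z in Metric.ball c R, ENNReal.ofReal (Real.posLog ‖W z‖) := by
  set u : ℂ → ℝ := fun z => Real.posLog ‖W z‖ with hu
  have hcont : Continuous u := Real.continuous_posLog.comp hW.continuous.norm
  have hu0 : ∀ z, 0 ≤ u z := fun z => Real.posLog_nonneg
  have hshift : ∫⁻ z in Metric.ball c R, ENNReal.ofReal (u z) =
      ∫⁻ z, (Metric.ball (0 : ℂ) R).indicator (fun z => ENNReal.ofReal (u (z + c))) z := by
    rw [← lintegral_indicator Metric.isOpen_ball.measurableSet,
      ← lintegral_add_right_eq_self _ c]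
    refine lintegral_congr fun z => ?_
    simp only [Set.indicator, Metric.mem_ball, dist_eq_norm, add_sub_cancel_right, sub_zero]
  rw [hshift, ← Complex.lintegral_comp_polarCoord_symm, polarCoord_target,
    Measure.volume_eq_prod, setLIntegral_prod]
  swap
  · refine Measurable.aemeasurable ?_
    have hm : Measurable fun z : ℂ => (Metric.ball (0 : ℂ) R).indicator
        (fun z => ENNReal.ofReal (u (z + c))) z :=
      (ENNReal.measurable_ofReal.comp
        (hcont.comp (continuous_id.add continuous_const)).measurable).indicator
        Metric.isOpen_ball.measurableSet
    have hp : Measurable fun p : ℝ × ℝ => Complex.polarCoord.symm p := by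
      simp only [Complex.polarCoord_symm_apply]
      fun_prop
    exact (ENNReal.measurable_ofReal.comp measurable_fst).smul (hm.comp hp)
  -- In polar coordinates the circle mean is applied for each radius; integrating `2 π r` over `(0,
  -- R)` then yields the area `π R²`.
  have hinner : ∀ r ∈ Set.Ioo (0 : ℝ) R, ENNReal.ofReal (2 * Real.pi * u c * r) ≤
      ∫⁻ θ in Set.Ioo (-Real.pi) Real.pi, ENNReal.ofReal r •
        (Metric.ball (0 : ℂ) R).indicator (fun z => ENNReal.ofReal (u (z + c)))
          (Complex.polarCoord.symm (r, θ)) := by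
    intro r hr
    have h1 : ∀ θ : ℝ, ENNReal.ofReal r •
        (Metric.ball (0 : ℂ) R).indicator (fun z => ENNReal.ofReal (u (z + c)))
          (Complex.polarCoord.symm (r, θ)) =
        ENNReal.ofReal (r * u (circleMap c r θ)) := by
      intro θ
      have h2 : Complex.polarCoord.symm (r, θ) + c = circleMap c r θ := by
        rw [Complex.polarCoord_symm_apply, circleMap, Complex.exp_mul_I, add_comm]
        simp
      have h3 : Complex.polarCoord.symm (r, θ) ∈ Metric.ball (0 : ℂ) R := by
        rw [mem_ball_zero_iff, Complex.norm_polarCoord_symm]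
        simpa [abs_of_pos hr.1] using hr.2
      rw [Set.indicator_of_mem h3, h2, smul_eq_mul, ENNReal.ofReal_mul hr.1.le]
    simp_rw [h1]
    have hc2 : Continuous fun θ : ℝ => r * u (circleMap c r θ) :=
      continuous_const.mul (hcont.comp (continuous_circleMap c r))
    rw [← ofReal_integral_eq_lintegral_ofReal]
    · apply ENNReal.ofReal_le_ofReal
      have h4 := posLog_norm_le_circleAverage hW c hr.1
      rw [Real.circleAverage_eq_integral_add (-Real.pi),
        intervalIntegral.integral_comp_add_right
          (fun θ => Real.posLog ‖W (circleMap c r θ)‖) (-Real.pi)] at h4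
      rw [← integral_Ioc_eq_integral_Ioo, ← intervalIntegral.integral_of_le
        (by linarith [Real.pi_pos]), intervalIntegral.integral_const_mul]
      have h5 : (0 : ℝ) + -Real.pi = -Real.pi := by ring
      have h6 : 2 * Real.pi + -Real.pi = Real.pi := by ring
      rw [h5, h6, smul_eq_mul, ← div_eq_inv_mul, le_div_iff₀ (by positivity)] at h4
      have h7 := mul_le_mul_of_nonneg_left h4 hr.1.le
      have h8 : 2 * Real.pi * u c * r = r * (Real.posLog ‖W c‖ * (2 * Real.pi)) := by
        rw [hu]; ring
      rw [h8]
      exact h7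
    · exact (hc2.continuousOn.integrableOn_Icc (a := -Real.pi) (b := Real.pi)).mono_set
        Set.Ioo_subset_Icc_self
    · exact Filter.Eventually.of_forall fun θ => mul_nonneg hr.1.le (hu0 _)
  calc ENNReal.ofReal (Real.pi * R ^ 2 * Real.posLog ‖W c‖)
      = ∫⁻ r in Set.Ioo (0 : ℝ) R, ENNReal.ofReal (2 * Real.pi * u c * r) := by
        rw [← ofReal_integral_eq_lintegral_ofReal]
        · rw [← integral_Ioc_eq_integral_Ioo, ← intervalIntegral.integral_of_le hR.le,
            intervalIntegral.integral_const_mul, integral_id]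
          congr 1
          rw [hu]; ring
        · exact ((continuous_const.mul continuous_id).continuousOn.integrableOn_Icc
            (a := 0) (b := R)).mono_set Set.Ioo_subset_Icc_self
        · filter_upwards [ae_restrict_mem measurableSet_Ioo] with r hr
          have := hu0 c
          have := hr.1
          positivity
    _ ≤ _ := setLIntegral_mono_ae' measurableSet_Ioo (Filter.Eventually.of_forall hinner)
    _ ≤ _ := lintegral_mono_set Set.Ioo_subset_Ioi_self

/-- A weighted area integral of `log⁺ ‖W‖` bounds the growth of the entire function `W`. -/
theorem exists_posLog_growth {W : ℂ → ℂ} (hW : Differentiable ℂ W) {b : ℝ} (hb : 0 ≤ b)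
    (h : ∫⁻ z, ENNReal.ofReal (Real.posLog ‖W z‖ * (1 + ‖z‖) ^ (-b)) ≠ ⊤) :
    ∃ C : ℝ, 0 ≤ C ∧ ∀ z, Real.posLog ‖W z‖ ≤ C * (1 + ‖z‖) ^ (b - 2) := by
  set I := (∫⁻ z, ENNReal.ofReal (Real.posLog ‖W z‖ * (1 + ‖z‖) ^ (-b))).toReal with hI
  have hI0 : 0 ≤ I := ENNReal.toReal_nonneg
  refine ⟨2 ^ b * I / Real.pi, by positivity, fun c => ?_⟩
  -- With this radius `1 + ‖z‖ ≤ 2 R` on the disc, so the weight costs only `(2 R) ^ b`, while the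
  -- area returns `R ^ 2`.
  set R := 1 + ‖c‖ with hRdef
  have hR : 0 < R := by positivity
  have h1 := posLog_norm_le_lintegral_ball hW c hR
  have h2 : ∫⁻ z in Metric.ball c R, ENNReal.ofReal (Real.posLog ‖W z‖) ≤
      ENNReal.ofReal ((2 * R) ^ b * I) := by
    calc ∫⁻ z in Metric.ball c R, ENNReal.ofReal (Real.posLog ‖W z‖)
        ≤ ∫⁻ z in Metric.ball c R, ENNReal.ofReal ((2 * R) ^ b) *
            ENNReal.ofReal (Real.posLog ‖W z‖ * (1 + ‖z‖) ^ (-b)) := by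
          refine setLIntegral_mono_ae' Metric.isOpen_ball.measurableSet
            (Filter.Eventually.of_forall fun z hz => ?_)
          rw [← ENNReal.ofReal_mul (by positivity)]
          apply ENNReal.ofReal_le_ofReal
          have hz1 : 1 + ‖z‖ ≤ 2 * R := by
            have h3 : ‖z - c‖ < R := by simpa [dist_eq_norm] using hz
            have h4 : ‖z‖ ≤ ‖z - c‖ + ‖c‖ := by simpa using norm_add_le (z - c) c
            linarith
          have h5 : 1 ≤ (2 * R) ^ b * (1 + ‖z‖) ^ (-b) := by
            rw [Real.rpow_neg (by positivity), ← div_eq_mul_inv, one_le_div (by positivity)]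
            exact Real.rpow_le_rpow (by positivity) hz1 hb
          calc Real.posLog ‖W z‖ = Real.posLog ‖W z‖ * 1 := by ring
            _ ≤ Real.posLog ‖W z‖ * ((2 * R) ^ b * (1 + ‖z‖) ^ (-b)) :=
              mul_le_mul_of_nonneg_left h5 Real.posLog_nonneg
            _ = _ := by ring
      _ = ENNReal.ofReal ((2 * R) ^ b) * ∫⁻ z in Metric.ball c R,
            ENNReal.ofReal (Real.posLog ‖W z‖ * (1 + ‖z‖) ^ (-b)) :=
          lintegral_const_mul' _ _ ENNReal.ofReal_ne_top
      _ ≤ ENNReal.ofReal ((2 * R) ^ b) * ∫⁻ z,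
            ENNReal.ofReal (Real.posLog ‖W z‖ * (1 + ‖z‖) ^ (-b)) :=
          mul_le_mul_right (setLIntegral_le_lintegral _ _) _
      _ = _ := by
          rw [ENNReal.ofReal_mul (by positivity), hI, ENNReal.ofReal_toReal h]
  have h3 := (ENNReal.ofReal_le_ofReal_iff (by positivity)).1 (h1.trans h2)
  rw [Real.rpow_sub hR, Real.rpow_two]
  rw [Real.mul_rpow (by norm_num) hR.le] at h3
  rw [div_mul_div_comm, le_div_iff₀ (by positivity)]
  calc _ = Real.pi * R ^ 2 * Real.posLog ‖W c‖ := by ring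
    _ ≤ _ := h3
    _ = _ := by ring

/-- A Phragmén–Lindelöf principle: an entire function of order less than one which grows at most
polynomially on the right half-plane does so everywhere. -/
theorem exists_growth_of_posLog_growth {W : ℂ → ℂ} (hW : Differentiable ℂ W) {m : ℕ} {C C' b : ℝ}
    (hb : b < 1) (hC' : 0 ≤ C')
    (hright : ∀ z : ℂ, 0 ≤ z.re → ‖W z‖ ≤ C * (1 + ‖z‖) ^ m)
    (hgrow : ∀ z, Real.posLog ‖W z‖ ≤ C' * (1 + ‖z‖) ^ b) :
    ∃ C'' : ℝ, ∀ z, ‖W z‖ ≤ C'' * (1 + ‖z‖) ^ m := by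
  have hC : 0 ≤ C := by
    have := (norm_nonneg _).trans (hright 0 le_rfl)
    simpa using this
  have hexp : ∀ z, ‖W z‖ ≤ Real.exp (C' * (1 + ‖z‖) ^ b) := by
    intro z
    refine le_trans ?_ (Real.exp_le_exp.2 (hgrow z))
    rcases eq_or_ne (W z) 0 with h0 | h0
    · rw [h0, norm_zero]; positivity
    · calc ‖W z‖ = Real.exp (Real.log ‖W z‖) := (Real.exp_log (norm_pos_iff.2 h0)).symm
        _ ≤ _ := Real.exp_le_exp.2 (le_max_right _ _)
  have hne : ∀ ζ : ℂ, 0 ≤ ζ.re → 1 ≤ ‖1 + ζ‖ := by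
    intro ζ hζ
    calc (1 : ℝ) ≤ (1 + ζ).re := by simpa using hζ
      _ ≤ _ := Complex.re_le_norm _
  have hle : ∀ ζ : ℂ, 0 ≤ ζ.re → 1 + ‖ζ‖ ≤ 3 * ‖1 + ζ‖ := by
    intro ζ hζ
    have h1 := hne ζ hζ
    have h2 : ‖ζ‖ ≤ ‖1 + ζ‖ + 1 := by
      have := norm_sub_le (1 + ζ) 1
      simpa using this
    linarith
  -- The factor `exp(-ε ζ)` beats `exp(C' (1 + x) ^ b)` on the positive real axis since `b < 1`, and
  -- has modulus one on the imaginary axis. The resulting bound does not depend on `ε`, so `ε → 0`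
  -- is possible afterwards.
  have key : ∀ ε : ℝ, 0 < ε → ∀ ζ : ℂ, 0 ≤ ζ.re →
      ‖Complex.exp (-(ε : ℂ) * ζ) * (W (-ζ) / (1 + ζ) ^ m)‖ ≤ C * 3 ^ m := by
    intro ε hε ζ hζ
    have hbound : ∀ w : ℂ, 0 ≤ w.re → ‖Complex.exp (-(ε : ℂ) * w) * (W (-w) / (1 + w) ^ m)‖ ≤
        Real.exp (-ε * w.re) * Real.exp (C' * (1 + ‖w‖) ^ b) := by
      intro w hw
      rw [norm_mul, Complex.norm_exp, norm_div, norm_pow]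
      have h1 : (-(ε : ℂ) * w).re = -ε * w.re := by simp
      rw [h1]
      refine mul_le_mul_of_nonneg_left ?_ (Real.exp_pos _).le
      refine (div_le_self (norm_nonneg _) (one_le_pow₀ (hne w hw))).trans ?_
      simpa using hexp (-w)
    refine PhragmenLindelof.right_half_plane_of_bounded_on_real
      (f := fun ζ : ℂ => Complex.exp (-(ε : ℂ) * ζ) * (W (-ζ) / (1 + ζ) ^ m)) ?_ ?_ ?_ ?_ hζ
    · refine DifferentiableOn.diffContOnCl ?_
      intro w hw
      have hw' : 0 ≤ w.re := by
        have h1 : {z : ℂ | 0 < z.re} ⊆ {z : ℂ | 0 ≤ z.re} := fun z (hz : 0 < z.re) => hz.le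
        exact closure_minimal h1 (isClosed_le continuous_const Complex.continuous_re) hw
      have h0 : (1 + w) ^ m ≠ 0 := by
        refine pow_ne_zero _ (norm_pos_iff.1 ?_)
        linarith [hne w hw']
      refine DifferentiableAt.differentiableWithinAt ?_
      have hWn : DifferentiableAt ℂ (fun ζ => W (-ζ)) w :=
        DifferentiableAt.comp w (hW.differentiableAt) (by fun_prop)
      refine DifferentiableAt.mul (by fun_prop) (hWn.div (by fun_prop) h0)
    -- In a half-plane any exponent below two is admissible; `b < 1` allows the exponent one.
    · refine ⟨1, by norm_num, 2 * C', ?_⟩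
      refine Asymptotics.IsBigO.of_bound 1 ?_
      have h1 : ∀ᶠ w : ℂ in Bornology.cobounded ℂ ⊓ Filter.principal {z | 0 < z.re},
          1 ≤ ‖w‖ := by
        refine Filter.Eventually.filter_mono inf_le_left ?_
        exact tendsto_norm_cobounded_atTop.eventually_ge_atTop 1
      have h2 : ∀ᶠ w : ℂ in Bornology.cobounded ℂ ⊓ Filter.principal {z | 0 < z.re},
          0 < w.re := Filter.Eventually.filter_mono inf_le_right (Filter.mem_principal_self _)
      filter_upwards [h1, h2] with w hw1 hw2
      refine (hbound w hw2.le).trans ?_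
      rw [Real.rpow_one, one_mul, Real.norm_eq_abs, abs_of_pos (Real.exp_pos _), ← Real.exp_add]
      apply Real.exp_le_exp.2
      have h3 : (1 + ‖w‖) ^ b ≤ 1 + ‖w‖ := by
        calc (1 + ‖w‖) ^ b ≤ (1 + ‖w‖) ^ (1 : ℝ) :=
              Real.rpow_le_rpow_of_exponent_le (by linarith) hb.le
          _ = _ := Real.rpow_one _
      have h4 := mul_le_mul_of_nonneg_left h3 hC'
      nlinarith [mul_nonneg hε.le hw2.le]
    · have hlim : Filter.Tendsto (fun x : ℝ => -ε * x + C' * (1 + x) ^ b) Filter.atTop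
          Filter.atBot := by
        have h1 : (fun x : ℝ => (1 + x) ^ b) =o[Filter.atTop] fun x : ℝ => x := by
          have h2 : (fun x : ℝ => x ^ b) =o[Filter.atTop] fun x : ℝ => x ^ (1 : ℝ) := by
            refine Asymptotics.isLittleO_of_tendsto' ?_ ?_
            · filter_upwards [Filter.eventually_gt_atTop (0 : ℝ)] with x hx h0
              exact absurd h0 (Real.rpow_pos_of_pos hx _).ne'
            · refine (tendsto_rpow_neg_atTop (sub_pos.2 hb)).congr' ?_
              filter_upwards [Filter.eventually_gt_atTop (0 : ℝ)] with x hx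
              rw [← Real.rpow_sub hx]
              congr 1; ring
          have h3 := h2.comp_tendsto (Filter.tendsto_atTop_add_const_left Filter.atTop (1 : ℝ)
            Filter.tendsto_id)
          refine h3.trans_isBigO ?_
          refine Asymptotics.IsBigO.of_bound 2 ?_
          filter_upwards [Filter.eventually_ge_atTop (1 : ℝ)] with x hx
          simp only [Function.comp, Real.rpow_one, Real.norm_eq_abs, id]
          rw [abs_of_pos (by linarith), abs_of_pos (by linarith)]
          linarith
        have h4 : ∀ᶠ x : ℝ in Filter.atTop, -ε * x + C' * (1 + x) ^ b ≤ -(ε / 2) * x := by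
          have h5 := (h1.const_mul_left C').def (half_pos hε)
          filter_upwards [h5, Filter.eventually_ge_atTop (0 : ℝ)] with x hx hx0
          have h6 := (le_abs_self _).trans hx
          rw [Real.norm_eq_abs, abs_of_nonneg hx0] at h6
          linarith
        refine Filter.tendsto_atBot_mono' _ h4 ?_
        exact Filter.tendsto_id.const_mul_atTop_of_neg (by linarith)
      have h7 := (Real.tendsto_exp_atBot.comp hlim)
      refine Filter.isBoundedUnder_of_eventually_le (a := 1) ?_
      filter_upwards [h7.eventually (ge_mem_nhds (zero_lt_one)),
        Filter.eventually_ge_atTop (0 : ℝ)] with x hx hx0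
      refine (hbound (x : ℂ) (by simpa using hx0)).trans ?_
      rw [← Real.exp_add]
      simpa [abs_of_nonneg hx0] using hx
    · intro y
      have hre : ((y : ℂ) * Complex.I).re = 0 := by simp
      rw [norm_mul, Complex.norm_exp]
      have h1 : (-(ε : ℂ) * (y * Complex.I)).re = 0 := by simp
      rw [h1, Real.exp_zero, one_mul, norm_div, norm_pow]
      have h2 := hne (y * Complex.I) hre.ge
      rw [div_le_iff₀ (by positivity)]
      refine (hright _ (by simp)).trans ?_
      rw [norm_neg, mul_assoc, ← mul_pow]
      gcongr
      exact hle _ hre.ge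
  refine ⟨C * 3 ^ m, fun z => ?_⟩
  rcases le_total 0 z.re with hz | hz
  · refine (hright z hz).trans ?_
    gcongr
    exact le_mul_of_one_le_right hC (one_le_pow₀ (by norm_num))
  · have hz' : 0 ≤ (-z).re := by simpa using hz
    have hlim : Filter.Tendsto (fun ε : ℝ => ‖Complex.exp (-(ε : ℂ) * (-z)) *
        (W (-(-z)) / (1 + -z) ^ m)‖) (nhdsWithin 0 (Set.Ioi 0))
        (nhds ‖W z / (1 + -z) ^ m‖) := by
      have hc : Continuous fun ε : ℝ => ‖Complex.exp (-(ε : ℂ) * (-z)) *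
        (W (-(-z)) / (1 + -z) ^ m)‖ := by fun_prop
      have := (hc.tendsto 0).mono_left (nhdsWithin_le_nhds (s := Set.Ioi 0))
      simpa using this
    have h1 : ‖W z / (1 + -z) ^ m‖ ≤ C * 3 ^ m :=
      le_of_tendsto hlim (by
        filter_upwards [self_mem_nhdsWithin] with ε hε using key ε hε _ hz')
    have h2 := hne _ hz'
    rw [norm_div, norm_pow, div_le_iff₀ (by positivity)] at h1
    refine h1.trans ?_
    have h3 : ‖1 + -z‖ ≤ 1 + ‖z‖ := by simpa using norm_add_le 1 (-z)
    gcongr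


/-! ### Orders of vanishing, division and linear dependence -/

/-- A domination on a half-line issuing from a point compares orders of vanishing there. -/
theorem analyticOrderAt_le_of_norm_le {F G : ℂ → ℂ} {z₀ : ℂ} (hF : AnalyticAt ℂ F z₀)
    (hG : AnalyticAt ℂ G z₀)
    (h : ∀ᶠ ε : ℝ in nhdsWithin 0 (Set.Ioi 0), ‖F (z₀ + ε)‖ ≤ ‖G (z₀ + ε)‖) :
    analyticOrderAt G z₀ ≤ analyticOrderAt F z₀ := by
  by_contra! hlt
  obtain ⟨a, ha⟩ := ENat.ne_top_iff_exists.1 (ne_top_of_lt hlt)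
  obtain ⟨f, hf, hf0, hfF⟩ := hF.analyticOrderAt_eq_natCast.1 ha.symm
  have hG1 : ((a + 1 : ℕ) : ℕ∞) ≤ analyticOrderAt G z₀ := by
    rw [← ha] at hlt
    push_cast
    exact Order.add_one_le_of_lt hlt
  obtain ⟨g, hg, hgG⟩ := (natCast_le_analyticOrderAt hG).1 hG1
  have hpath : Filter.Tendsto (fun ε : ℝ => z₀ + (ε : ℂ)) (nhdsWithin 0 (Set.Ioi 0)) (nhds z₀) := by
    have hc : Continuous fun ε : ℝ => z₀ + (ε : ℂ) := by fun_prop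
    simpa using (hc.tendsto 0).mono_left nhdsWithin_le_nhds
  -- Once `ε ^ a` is cancelled, `G` keeps at least one factor `ε`, which forces the leading
  -- coefficient of `F` to vanish.
  have hle : ∀ᶠ ε : ℝ in nhdsWithin 0 (Set.Ioi 0), ‖f (z₀ + ε)‖ ≤ ε * ‖g (z₀ + ε)‖ := by
    filter_upwards [h, hpath.eventually hfF, hpath.eventually hgG, self_mem_nhdsWithin]
      with ε h1 h2 h3 h4
    have hε : 0 < ε := h4
    rw [h2, h3] at h1
    simp only [add_sub_cancel_left, norm_smul, norm_pow, Complex.norm_real, Real.norm_eq_abs,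
      abs_of_pos hε] at h1
    rw [pow_succ, mul_assoc] at h1
    exact le_of_mul_le_mul_left h1 (by positivity)
  have hl1 : Filter.Tendsto (fun ε : ℝ => ‖f (z₀ + ε)‖) (nhdsWithin 0 (Set.Ioi 0))
      (nhds ‖f z₀‖) := (hf.continuousAt.tendsto.comp hpath).norm
  have hl2 : Filter.Tendsto (fun ε : ℝ => ε * ‖g (z₀ + ε)‖) (nhdsWithin 0 (Set.Ioi 0))
      (nhds (0 * ‖g z₀‖)) :=
    (Filter.tendsto_id.mono_left nhdsWithin_le_nhds).mul
      ((hg.continuousAt.tendsto.comp hpath).norm)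
  have := le_of_tendsto_of_tendsto hl1 hl2 hle
  rw [zero_mul] at this
  exact hf0 (norm_le_zero_iff.1 this)

/-- Division of analytic functions. -/
theorem exists_analytic_quotient {F G : ℂ → ℂ} {U : Set ℂ} (hF : AnalyticOnNhd ℂ F U)
    (hG : AnalyticOnNhd ℂ G U) (hG0 : ∀ z ∈ U, analyticOrderAt G z ≠ ⊤)
    (h : ∀ z ∈ U, analyticOrderAt G z ≤ analyticOrderAt F z) :
    ∃ L : ℂ → ℂ, AnalyticOnNhd ℂ L U ∧ ∀ z ∈ U, L z * G z = F z := by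
  -- The punctured limit gives one global formula for the quotient; it agrees near each point with
  -- the local quotient of the cofactors.
  set L : ℂ → ℂ := fun z => Filter.limUnder (nhdsWithin z {z}ᶜ) (fun w => F w / G w) with hL
  have key : ∀ z ∈ U, ∃ l : ℂ → ℂ, AnalyticAt ℂ l z ∧ (∀ᶠ w in nhds z, l w * G w = F w) ∧
      L =ᶠ[nhds z] l := by
    intro z hz
    obtain ⟨n, hn⟩ := ENat.ne_top_iff_exists.1 (hG0 z hz)
    obtain ⟨g, hg, hg0, hgG⟩ := (hG z hz).analyticOrderAt_eq_natCast.1 hn.symm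
    have h1 := h z hz
    rw [← hn] at h1
    obtain ⟨f, hf, hfF⟩ := (natCast_le_analyticOrderAt (hF z hz)).1 h1
    have hgne : ∀ᶠ w in nhds z, g w ≠ 0 := hg.continuousAt.eventually_ne hg0
    have hl : AnalyticAt ℂ (fun w => f w / g w) z := hf.div hg hg0
    have hmul : ∀ᶠ w in nhds z, f w / g w * G w = F w := by
      filter_upwards [hgG, hfF, hgne] with w h2 h3 h4
      rw [h2, h3, smul_eq_mul, smul_eq_mul]
      field_simp
    have hGne : ∀ᶠ w in nhds z, w ≠ z → G w ≠ 0 := by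
      filter_upwards [hgG, hgne] with w h2 h3 h4
      rw [h2, smul_eq_mul]
      exact mul_ne_zero (pow_ne_zero _ (sub_ne_zero.2 h4)) h3
    refine ⟨fun w => f w / g w, hl, hmul, ?_⟩
    filter_upwards [hmul.eventually_nhds, hGne.eventually_nhds, hl.eventually_analyticAt]
      with w h2 h3 h4
    refine Filter.Tendsto.limUnder_eq ?_
    have h5 : ∀ᶠ v in nhdsWithin w {w}ᶜ, v ≠ z := by
      by_cases hwz : w = z
      · subst hwz; exact self_mem_nhdsWithin
      · exact nhdsWithin_le_nhds (isOpen_ne.mem_nhds hwz)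
    refine (h4.continuousAt.tendsto.mono_left nhdsWithin_le_nhds).congr' ?_
    filter_upwards [nhdsWithin_le_nhds h2, nhdsWithin_le_nhds h3, h5] with v h6 h7 h8
    rw [eq_div_iff (h7 h8)]
    exact h6
  refine ⟨L, fun z hz => ?_, fun z hz => ?_⟩
  · obtain ⟨l, h1, -, h3⟩ := key z hz
    exact h1.congr h3.symm
  · obtain ⟨l, h1, h2, h3⟩ := key z hz
    rw [h3.self_of_nhds]
    exact h2.self_of_nhds

/-- Vectors in `ℂ^ι` all of whose square minors vanish lie in a hyperplane. -/
theorem exists_ne_zero_of_det_eq_zero {ι S : Type*} [Fintype ι] [DecidableEq ι]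
    (φ : S → ι → ℂ) (h : ∀ t : ι → S, Matrix.det (fun i j => φ (t i) j) = 0) :
    ∃ c : ι → ℂ, c ≠ 0 ∧ ∀ x, ∑ j, φ x j * c j = 0 := by
  by_cases htop : Submodule.span ℂ (Set.range φ) = ⊤
  · exfalso
    -- If the vectors spanned, a basis could be chosen among them, and its square minor would be
    -- nonzero.
    obtain ⟨b, hb1, hb2, hb3⟩ := exists_linearIndependent ℂ (Set.range φ)
    rw [htop] at hb2
    have hB : LinearIndependent ℂ ((↑) : b → ι → ℂ) := hb3
    let Bs := Module.Basis.mk hB (by rw [Subtype.range_coe, hb2])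
    have hfin : Finite b := Module.Finite.finite_basis Bs
    have : Fintype b := Fintype.ofFinite b
    have hcard : Fintype.card b = Fintype.card ι := by
      rw [← Module.finrank_eq_card_basis Bs, Module.finrank_pi]
    let e : ι ≃ b := (Fintype.equivOfCardEq hcard).symm
    choose t ht using fun i : ι => hb1 (e i).2
    have hli : LinearIndependent ℂ (fun i : ι => φ (t i)) := by
      have : (fun i : ι => φ (t i)) = (fun x : b => (x : ι → ℂ)) ∘ e := by
        funext i; exact ht i
      rw [this]
      exact hB.comp _ e.injective
    have hdet := h t
    have hM : LinearIndependent ℂ (Matrix.row (Matrix.of fun i j => φ (t i) j)) := hli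
    rw [Matrix.linearIndependent_rows_iff_isUnit, Matrix.isUnit_iff_isUnit_det] at hM
    exact hM.ne_zero hdet
  · obtain ⟨f, hf0, hf⟩ := Submodule.exists_le_ker_of_lt_top _ (lt_top_iff_ne_top.2 htop)
    refine ⟨fun j => f (Pi.single j 1), ?_, ?_⟩
    · intro h0
      apply hf0
      refine LinearMap.pi_ext' fun j => ?_
      ext
      simpa using congrFun h0 j
    · intro x
      have h1 : f (φ x) = 0 := hf (Submodule.subset_span ⟨x, rfl⟩)
      rw [← h1]
      conv_rhs => rw [pi_eq_sum_univ (φ x)]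
      rw [map_sum]
      refine Finset.sum_congr rfl fun j _ => ?_
      rw [map_smul, smul_eq_mul]
      have h2 : (Pi.single j 1 : ι → ℂ) = fun i => if j = i then 1 else 0 := by
        funext i
        simp [Pi.single_apply, eq_comm]
      change φ x j * f (Pi.single j 1) = _
      rw [h2]

/-- Together with its converse above, this translates the existence of a linear relation into
equations holomorphic in a parameter, to which the identity theorem applies. -/
theorem det_eq_zero_of_exists {ι S : Type*} [Fintype ι] [DecidableEq ι]
    (φ : S → ι → ℂ) (h : ∃ c : ι → ℂ, c ≠ 0 ∧ ∀ x, ∑ j, φ x j * c j = 0) (t : ι → S) :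
    Matrix.det (fun i j => φ (t i) j) = 0 := by
  obtain ⟨c, hc, h⟩ := h
  exact Matrix.exists_mulVec_eq_zero_iff.1 ⟨c, hc, by ext i; exact h (t i)⟩

/-- If almost every point of `[1, 2]` belongs to one of countably many sets, then one of these
sets determines holomorphic functions on the right half-plane. -/
theorem exists_determining_set (T : ℕ → Set ℝ)
    (h : ∀ᵐ x ∂(volume.restrict (Set.Icc (1 : ℝ) 2)), ∃ m, x ∈ T m) :
    ∃ m, ∀ g : ℂ → ℂ, DifferentiableOn ℂ g {s | 0 < s.re} →
      (∀ x ∈ T m, x ∈ Set.Icc (1 : ℝ) 2 → g x = 0) → ∀ s : ℂ, 0 < s.re → g s = 0 := by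
  -- Countably many finite sets form a null set and cannot cover almost all of `[1, 2]`.
  have hinf : ∃ m, (T m ∩ Set.Icc 1 2).Infinite := by
    by_contra! hcon
    have hcount : (⋃ m, T m ∩ Set.Icc (1 : ℝ) 2).Countable :=
      Set.countable_iUnion fun m => (hcon m).countable
    have h0 : volume (⋃ m, T m ∩ Set.Icc (1 : ℝ) 2) = 0 := hcount.measure_zero _
    have h1 : volume (Set.Icc (1 : ℝ) 2) ≤ 0 := by
      rw [← h0]
      refine measure_mono_ae ?_
      rw [ae_restrict_iff' measurableSet_Icc] at h
      filter_upwards [h] with x hx hx2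
      obtain ⟨m, hm⟩ := hx hx2
      exact Set.mem_iUnion.2 ⟨m, hm, hx2⟩
    rw [Real.volume_Icc] at h1
    norm_num at h1
  obtain ⟨m, hm⟩ := hinf
  -- The accumulation point lies in `[1, 2]`, hence inside the half-plane, as the identity theorem
  -- requires.
  obtain ⟨x₀, hx₀, hacc⟩ := hm.exists_accPt_of_subset_isCompact isCompact_Icc
    Set.inter_subset_right
  refine ⟨m, fun g hg hgT s hs => ?_⟩
  have ho : IsOpen {s : ℂ | 0 < s.re} := isOpen_lt continuous_const Complex.continuous_re
  have hpre : IsPreconnected {s : ℂ | 0 < s.re} :=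
    (convex_halfSpace_re_gt 0).isPreconnected
  have hx0 : ((x₀ : ℝ) : ℂ) ∈ {s : ℂ | 0 < s.re} := by
    have := hx₀.1
    simp only [Set.mem_ofPred_eq, Complex.ofReal_re]; linarith
  refine (hg.analyticOnNhd ho).eqOn_zero_of_preconnected_of_frequently_eq_zero hpre hx0 ?_ hs
  have hfr : ∃ᶠ x : ℝ in nhdsWithin x₀ {x₀}ᶜ, x ∈ T m ∩ Set.Icc 1 2 :=
    accPt_iff_frequently_nhdsNE.1 hacc
  have htend : Filter.Tendsto (fun x : ℝ => (x : ℂ)) (nhdsWithin x₀ {x₀}ᶜ)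
      (nhdsWithin (x₀ : ℂ) {(x₀ : ℂ)}ᶜ) := by
    refine tendsto_nhdsWithin_iff.2 ⟨?_, ?_⟩
    · exact (Complex.continuous_ofReal.tendsto x₀).mono_left nhdsWithin_le_nhds
    · filter_upwards [self_mem_nhdsWithin] with x hx
      simpa using hx
  exact htend.frequently (hfr.mono fun x hx => hgT x hx.1 hx.2)


/-! ### Averages of the logarithm of a quotient of polynomials -/

/-- Serves to replace a logarithmic singularity by the singularity `|x - a| ^ (-1/2)`, whose
integral is easy to bound, at the price of a factor `√T`. -/
theorem log_one_add_le_two_mul_sqrt {y : ℝ} (hy : 0 ≤ y) : Real.log (1 + y) ≤ 2 * √y := by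
  have h1 : 1 + y ≤ (1 + √y) ^ 2 := by
    nlinarith [Real.sq_sqrt hy, Real.sqrt_nonneg y]
  have h2 : Real.log (1 + y) ≤ Real.log ((1 + √y) ^ 2) := Real.log_le_log (by positivity) h1
  rw [Real.log_pow] at h2
  have h3 : Real.log (1 + √y) ≤ √y := by
    have := Real.log_le_sub_one_of_pos (show 0 < 1 + √y by positivity)
    linarith
  push_cast at h2
  linarith

/-- The exponent exceeds `-1`, so the singularity is integrable; farther than one from `a` the
integrand is at most one. The bound is uniform in `a` because roots of polynomials may lie anywhere.
-/
theorem exists_lintegral_abs_sub_rpow_le : ∃ H : ℝ, 0 ≤ H ∧ ∀ a : ℝ,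
    ∫⁻ x in Set.Icc (1 : ℝ) 2, ENNReal.ofReal (|x - a| ^ (-(1 / 2) : ℝ)) ≤ ENNReal.ofReal H := by
  set h : ℝ → ENNReal := (Set.Ioc (0 : ℝ) 1).indicator
    (fun x => ENNReal.ofReal (x ^ (-(1 / 2) : ℝ))) with hh
  have hmeas : Measurable h := by
    refine Measurable.indicator ?_ measurableSet_Ioc
    fun_prop
  have hfin : ∫⁻ x, h x ≠ ⊤ := by
    rw [hh, lintegral_indicator measurableSet_Ioc]
    have h1 : IntervalIntegrable (fun x : ℝ => x ^ (-(1 / 2) : ℝ)) volume 0 1 :=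
      intervalIntegral.intervalIntegrable_rpow' (by norm_num)
    rw [intervalIntegrable_iff_integrableOn_Ioc_of_le zero_le_one] at h1
    exact (Integrable.lintegral_lt_top h1).ne
  refine ⟨1 + 2 * (∫⁻ x, h x).toReal, by positivity, fun a => ?_⟩
  have hle : ∀ x : ℝ, ENNReal.ofReal (|x - a| ^ (-(1 / 2) : ℝ)) ≤
      1 + (h (x - a) + h (-(x - a))) := by
    intro x
    rcases le_or_gt |x - a| 1 with h1 | h1
    · rcases lt_trichotomy (x - a) 0 with h2 | h2 | h2
      · refine le_trans ?_ (le_add_left (le_add_left le_rfl))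
        rw [hh, Set.indicator_of_mem, abs_of_neg h2]
        rw [abs_of_neg h2] at h1
        exact ⟨by linarith, h1⟩
      · rw [h2, abs_zero, Real.zero_rpow (by norm_num)]
        simp
      · refine le_trans ?_ (le_add_left (le_add_right le_rfl))
        rw [hh, Set.indicator_of_mem, abs_of_pos h2]
        rw [abs_of_pos h2] at h1
        exact ⟨h2, h1⟩
    · refine le_trans ?_ (le_add_right le_rfl)
      rw [← ENNReal.ofReal_one]
      apply ENNReal.ofReal_le_ofReal
      exact Real.rpow_le_one_of_one_le_of_nonpos h1.le (by norm_num)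
  calc ∫⁻ x in Set.Icc (1 : ℝ) 2, ENNReal.ofReal (|x - a| ^ (-(1 / 2) : ℝ))
      ≤ ∫⁻ x in Set.Icc (1 : ℝ) 2, (1 + (h (x - a) + h (-(x - a)))) := lintegral_mono hle
    _ = (∫⁻ _ in Set.Icc (1 : ℝ) 2, 1) +
          ∫⁻ x in Set.Icc (1 : ℝ) 2, (h (x - a) + h (-(x - a))) :=
        lintegral_add_left measurable_const _
    _ ≤ 1 + ∫⁻ x, (h (x - a) + h (-(x - a))) := by
        refine add_le_add ?_ (setLIntegral_le_lintegral _ _)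
        simp; norm_num
    _ = 1 + ((∫⁻ x, h x) + ∫⁻ x, h x) := by
        rw [lintegral_add_left (f := fun x => h (x - a)) (by fun_prop),
          lintegral_sub_right_eq_self (fun x => h x) a,
          lintegral_sub_right_eq_self (fun x => h (-x)) a, lintegral_neg_eq_self h]
    _ = _ := by
        rw [ENNReal.ofReal_add zero_le_one (by positivity), ENNReal.ofReal_one,
          ENNReal.ofReal_mul (by norm_num), ENNReal.ofReal_toReal hfin, ENNReal.ofReal_ofNat,
          two_mul]

/-- Bounding a polynomial by its values at `0, ..., d`. -/
theorem norm_eval_le_sum_nodes {P : ℂ[X]} {d : ℕ} (hP : P.natDegree ≤ d) {T : ℝ}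
    {ξ : ℂ} (hξ : ‖ξ‖ + d ≤ T) :
    ‖P.eval ξ‖ ≤ ∑ k ∈ Finset.range (d + 1), ‖P.eval (k : ℂ)‖ * T ^ d := by
  have hinj : Set.InjOn (fun k : ℕ => (k : ℂ)) (Finset.range (d + 1)) :=
    fun a _ b _ hab => Nat.cast_injective hab
  have hdeg : P.degree < (Finset.range (d + 1)).card := by
    rw [Finset.card_range]
    exact Polynomial.degree_lt_iff_coeff_zero _ _ |>.2 fun m hm =>
      Polynomial.coeff_eq_zero_of_natDegree_lt (by omega)
  have hP' := Lagrange.eq_interpolate hinj hdeg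
  conv_lhs => rw [hP', Lagrange.interpolate_apply, Polynomial.eval_finsetSum]
  refine (norm_sum_le _ _).trans (Finset.sum_le_sum fun k hk => ?_)
  rw [Polynomial.eval_mul, Polynomial.eval_C, norm_mul]
  refine mul_le_mul_of_nonneg_left ?_ (norm_nonneg _)
  rw [Lagrange.basis, Polynomial.eval_prod, norm_prod]
  have hcard : ((Finset.range (d + 1)).erase k).card = d := by
    rw [Finset.card_erase_of_mem hk, Finset.card_range]; rfl
  calc _ ≤ ∏ j ∈ (Finset.range (d + 1)).erase k, T := by
        refine Finset.prod_le_prod (fun j _ => norm_nonneg _) fun j hj => ?_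
        rw [Lagrange.basisDivisor, Polynomial.eval_mul, Polynomial.eval_C, norm_mul, norm_inv]
        have hjk : j ≠ k := (Finset.mem_erase.1 hj).1
        have hj2 : (j : ℝ) ≤ d := by
          have := Finset.mem_range.1 (Finset.mem_erase.1 hj).2
          exact_mod_cast Nat.lt_succ_iff.1 this
        -- Integer nodes are at distance at least one, so the denominators of the Lagrange basis may
        -- be dropped.
        have h1 : 1 ≤ ‖(k : ℂ) - (j : ℂ)‖ := by
          have h4 : (k : ℤ) - (j : ℤ) ≠ 0 := by omega
          have h2 : (1 : ℝ) ≤ |((k : ℤ) - (j : ℤ) : ℤ)| := by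
            exact_mod_cast Int.one_le_abs h4
          have h3 : (k : ℂ) - (j : ℂ) = (((k : ℤ) - (j : ℤ) : ℤ) : ℂ) := by push_cast; rfl
          rw [h3, Complex.norm_intCast]
          exact_mod_cast h2
        have h2 : ‖Polynomial.eval ξ (X - C (j : ℂ))‖ ≤ T := by
          simp only [Polynomial.eval_sub, Polynomial.eval_X, Polynomial.eval_C]
          refine (norm_sub_le _ _).trans ?_
          rw [Complex.norm_natCast]
          linarith
        calc _ ≤ 1 * T := mul_le_mul (inv_le_one_of_one_le₀ h1) h2 (norm_nonneg _) zero_le_one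
          _ = T := one_mul T
    _ = T ^ d := by rw [Finset.prod_const, hcard]

/-- Comparing a polynomial at two points. -/
theorem norm_eval_le_mul_prod {P : ℂ[X]} {k ξ : ℂ} {T : ℝ} (hT : ‖k - ξ‖ ≤ T)
    (h0 : P.eval ξ ≠ 0) :
    ‖P.eval k‖ ≤ ‖P.eval ξ‖ * (P.roots.map fun α => 1 + T / ‖ξ - α‖).prod := by
  have hP0 : P ≠ 0 := by rintro rfl; simp at h0
  have hs := (IsAlgClosed.splits P).eq_prod_roots
  have hev : ∀ z, ‖P.eval z‖ = ‖P.leadingCoeff‖ * (P.roots.map fun α => ‖z - α‖).prod := by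
    intro z
    conv_lhs => rw [hs]
    rw [Polynomial.eval_mul, Polynomial.eval_C, norm_mul, Polynomial.eval_multiset_prod,
      Multiset.map_map]
    congr 1
    refine (map_multiset_prod (normHom : ℂ →*₀ ℝ) _).trans ?_
    rw [Multiset.map_map]
    simp [Function.comp_def]
  rw [hev, hev, mul_assoc, ← Multiset.prod_map_mul]
  refine mul_le_mul_of_nonneg_left ?_ (norm_nonneg _)
  refine Multiset.prod_map_le_prod_map₀ _ _ (fun α _ => norm_nonneg _) fun α hα => ?_
  have h1 : 0 < ‖ξ - α‖ := by
    refine norm_pos_iff.2 (sub_ne_zero.2 ?_)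
    rintro rfl
    exact h0 (Polynomial.isRoot_of_mem_roots hα)
  rw [mul_add, mul_one, mul_div_cancel₀ _ h1.ne']
  calc ‖k - α‖ = ‖(ξ - α) + (k - ξ)‖ := by congr 1; ring
    _ ≤ ‖ξ - α‖ + ‖k - ξ‖ := norm_add_le _ _
    _ ≤ _ := by linarith

/-- Interpolation bounds `|P₁(ξ)|` by its values at the nodes, these are at most those of `|P₂|`,
and `norm_eval_le_mul_prod` carries `P₂` back from the nodes to `ξ`. The size of the coefficients
drops out, which makes the estimate uniform. Where `P₂` vanishes the quotient is zero by convention.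
-/
theorem posLog_ratio_le {P₁ P₂ : ℂ[X]} {d : ℕ} (h₁ : P₁.natDegree ≤ d)
    (hle : ∀ k : ℕ, k ≤ d → ‖P₁.eval (k : ℂ)‖ ≤ ‖P₂.eval (k : ℂ)‖) {T : ℝ} (hT : 1 ≤ T)
    {ξ : ℂ} (hξ : ‖ξ‖ + d ≤ T) :
    Real.posLog ‖P₁.eval ξ / P₂.eval ξ‖ ≤
      Real.log (d + 1) + d * Real.log T +
        (P₂.roots.map fun α => Real.log (1 + T / ‖ξ - α‖)).sum := by
  have hterm : ∀ α : ℂ, 1 ≤ 1 + T / ‖ξ - α‖ := fun α => by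
    have : 0 ≤ T / ‖ξ - α‖ := by positivity
    linarith
  have hlogT : 0 ≤ Real.log T := Real.log_nonneg hT
  have hrhs : 0 ≤ Real.log (d + 1) + d * Real.log T +
        (P₂.roots.map fun α => Real.log (1 + T / ‖ξ - α‖)).sum := by
    have h1 : 0 ≤ Real.log ((d : ℝ) + 1) := Real.log_nonneg (by linarith [Nat.cast_nonneg (α := ℝ) d])
    have h2 : 0 ≤ (P₂.roots.map fun α => Real.log (1 + T / ‖ξ - α‖)).sum := by
      refine Multiset.sum_nonneg fun x hx => ?_
      obtain ⟨α, -, rfl⟩ := Multiset.mem_map.1 hx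
      exact Real.log_nonneg (hterm α)
    positivity
  by_cases h0 : P₂.eval ξ = 0
  · simpa [h0] using hrhs
  refine max_le hrhs ?_
  rcases eq_or_ne (P₁.eval ξ) 0 with h10 | h10
  · simpa [h10] using hrhs
  set Q := (P₂.roots.map fun α => 1 + T / ‖ξ - α‖).prod with hQ
  have hQ0 : 0 < Q := by
    refine Multiset.prod_pos fun x hx => ?_
    obtain ⟨α, -, rfl⟩ := Multiset.mem_map.1 hx
    linarith [hterm α]
  have hlogQ : Real.log Q = (P₂.roots.map fun α => Real.log (1 + T / ‖ξ - α‖)).sum := by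
    rw [hQ]
    induction P₂.roots using Multiset.induction_on with
    | empty => simp
    | cons a s ih =>
      rw [Multiset.map_cons, Multiset.prod_cons, Multiset.map_cons, Multiset.sum_cons,
        Real.log_mul, ih]
      · linarith [hterm a]
      · refine (Multiset.prod_pos fun x hx => ?_).ne'
        obtain ⟨α, -, rfl⟩ := Multiset.mem_map.1 hx
        linarith [hterm α]
  have hbound : ‖P₁.eval ξ / P₂.eval ξ‖ ≤ (d + 1) * T ^ d * Q := by
    rw [norm_div, div_le_iff₀ (norm_pos_iff.2 h0)]
    refine (norm_eval_le_sum_nodes h₁ hξ).trans ?_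
    calc ∑ k ∈ Finset.range (d + 1), ‖P₁.eval (k : ℂ)‖ * T ^ d
        ≤ ∑ k ∈ Finset.range (d + 1), (‖P₂.eval ξ‖ * Q) * T ^ d := by
          refine Finset.sum_le_sum fun k hk => ?_
          have hk' : k ≤ d := Nat.lt_succ_iff.1 (Finset.mem_range.1 hk)
          refine mul_le_mul_of_nonneg_right ((hle k hk').trans ?_) (by positivity)
          refine norm_eval_le_mul_prod ?_ h0
          refine (norm_sub_le _ _).trans ?_
          rw [Complex.norm_natCast]
          have : (k : ℝ) ≤ d := by exact_mod_cast hk'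
          linarith
      _ = _ := by
          rw [Finset.sum_const, Finset.card_range, nsmul_eq_mul]
          push_cast
          ring
  have hpos : 0 < ‖P₁.eval ξ / P₂.eval ξ‖ := norm_pos_iff.2 (div_ne_zero h10 h0)
  refine (Real.log_le_log hpos hbound).trans ?_
  have hT0 : 0 < T := by linarith
  rw [Real.log_mul (by positivity) hQ0.ne', Real.log_mul (by positivity) (by positivity),
    Real.log_pow, hlogQ]

theorem lintegral_multiset_sum_le {α : Type*} [MeasurableSpace α] {ν : Measure α} {ι : Type*}
    (s : Multiset ι) (g : ι → α → ℝ) (hg : ∀ i, Measurable (g i)) (hg0 : ∀ i x, 0 ≤ g i x)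
    {M : ℝ} (hM : 0 ≤ M) (h : ∀ i, ∫⁻ x, ENNReal.ofReal (g i x) ∂ν ≤ ENNReal.ofReal M) :
    ∫⁻ x, ENNReal.ofReal ((s.map fun i => g i x).sum) ∂ν ≤ ENNReal.ofReal (s.card * M) := by
  induction s using Multiset.induction_on with
  | empty => simp
  | cons a s ih =>
    have h0 : ∀ x, 0 ≤ (s.map fun i => g i x).sum := fun x =>
      Multiset.sum_nonneg fun y hy => by
        obtain ⟨i, -, rfl⟩ := Multiset.mem_map.1 hy
        exact hg0 i x
    simp only [Multiset.map_cons, Multiset.sum_cons, Multiset.card_cons]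
    calc _ = ∫⁻ x, (ENNReal.ofReal (g a x) + ENNReal.ofReal ((s.map fun i => g i x).sum)) ∂ν :=
          lintegral_congr fun x => ENNReal.ofReal_add (hg0 a x) (h0 x)
      _ = ∫⁻ x, ENNReal.ofReal (g a x) ∂ν + _ :=
          lintegral_add_left (hg a).ennreal_ofReal _
      _ ≤ ENNReal.ofReal M + ENNReal.ofReal (s.card * M) := add_le_add (h a) ih
      _ = _ := by
          rw [← ENNReal.ofReal_add hM (by positivity)]
          congr 1
          push_cast
          ring

/-- The average over parallel lines of `log⁺ |P₁ / P₂|`, for polynomials with `|P₁| ≤ |P₂|` on the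
right half-plane, grows slowly. -/
theorem exists_lintegral_posLog_ratio_le (d : ℕ) : ∃ C : ℝ, 0 ≤ C ∧ ∀ P₁ P₂ : ℂ[X],
    P₁.natDegree ≤ d → P₂.natDegree ≤ d →
    (∀ k : ℕ, k ≤ d → ‖P₁.eval (k : ℂ)‖ ≤ ‖P₂.eval (k : ℂ)‖) → ∀ τ : ℂ,
    ∫⁻ x in Set.Icc (1 : ℝ) 2,
        ENNReal.ofReal (Real.posLog ‖P₁.eval ((x : ℂ) - τ) / P₂.eval ((x : ℂ) - τ)‖) ≤
      ENNReal.ofReal (C * √(1 + ‖τ‖)) := by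
  obtain ⟨H, hH0, hH⟩ := exists_lintegral_abs_sub_rpow_le
  refine ⟨(d + 1 : ℝ) + d * (2 * √(d + 3)) + d * (2 * √(d + 3) * H), by positivity, ?_⟩
  intro P₁ P₂ h₁ h₂ hle τ
  set T : ℝ := d + 2 + ‖τ‖ + 1 with hTdef
  have hd0 : (0 : ℝ) ≤ d := Nat.cast_nonneg d
  have hτ0 := norm_nonneg τ
  have hT : 1 ≤ T := by linarith
  have hTs : √T ≤ √(d + 3) * √(1 + ‖τ‖) := by
    rw [← Real.sqrt_mul (by positivity)]
    apply Real.sqrt_le_sqrt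
    nlinarith
  have h1s : 1 ≤ √(1 + ‖τ‖) := by
    rw [Real.one_le_sqrt]; linarith
  set A : ℝ := Real.log (d + 1) + d * Real.log T with hA
  have hlogd : 0 ≤ Real.log ((d : ℝ) + 1) := Real.log_nonneg (by linarith)
  have hlogT : 0 ≤ Real.log T := Real.log_nonneg hT
  have hA0 : 0 ≤ A := by positivity
  have hAle : A ≤ ((d + 1 : ℝ) + d * (2 * √(d + 3))) * √(1 + ‖τ‖) := by
    have e1 : Real.log ((d : ℝ) + 1) ≤ d + 1 := by
      have := Real.log_le_sub_one_of_pos (show (0 : ℝ) < d + 1 by positivity)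
      linarith
    have e2 : Real.log T ≤ 2 * (√(d + 3) * √(1 + ‖τ‖)) := by
      have e3 := log_one_add_le_two_mul_sqrt (y := T - 1) (by linarith)
      have e4 : √(T - 1) ≤ √T := Real.sqrt_le_sqrt (by linarith)
      rw [add_sub_cancel] at e3
      linarith
    have e5 : (d : ℝ) * Real.log T ≤ d * (2 * (√(d + 3) * √(1 + ‖τ‖))) :=
      mul_le_mul_of_nonneg_left e2 hd0
    have e6 : (d + 1 : ℝ) ≤ (d + 1) * √(1 + ‖τ‖) :=
      le_mul_of_one_le_right (by positivity) h1s
    rw [hA, add_mul]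
    nlinarith
  have hg : ∀ α : ℂ, ∫⁻ x in Set.Icc (1 : ℝ) 2,
      ENNReal.ofReal (Real.log (1 + T / ‖(x : ℂ) - τ - α‖)) ≤ ENNReal.ofReal (2 * √T * H) := by
    intro α
    calc _ ≤ ∫⁻ x in Set.Icc (1 : ℝ) 2, ENNReal.ofReal (2 * √T) *
            ENNReal.ofReal (|x - (τ + α).re| ^ (-(1 / 2) : ℝ)) := by
          refine lintegral_mono_ae ?_
          have hne : ∀ᵐ x : ℝ ∂(volume.restrict (Set.Icc (1 : ℝ) 2)), x ≠ (τ + α).re :=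
            ae_restrict_of_ae (Measure.ae_ne volume _)
          filter_upwards [hne] with x hx
          rw [← ENNReal.ofReal_mul (by positivity)]
          apply ENNReal.ofReal_le_ofReal
          have hpos : 0 < |x - (τ + α).re| := abs_pos.2 (sub_ne_zero.2 hx)
          -- Only the real part of the distance to the root is kept; it depends on `x` as `|x - a|`
          -- with `a` real.
          have hle2 : |x - (τ + α).re| ≤ ‖(x : ℂ) - τ - α‖ := by
            have := Complex.abs_re_le_norm ((x : ℂ) - τ - α)
            simpa [sub_sub] using this
          have hmono : Real.log (1 + T / ‖(x : ℂ) - τ - α‖) ≤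
              Real.log (1 + T / |x - (τ + α).re|) := by
            apply Real.log_le_log (by positivity)
            gcongr
          refine hmono.trans ((log_one_add_le_two_mul_sqrt (by positivity)).trans ?_)
          rw [Real.sqrt_div (by linarith), Real.rpow_neg hpos.le, ← Real.sqrt_eq_rpow,
            mul_assoc, div_eq_mul_inv]
      _ = ENNReal.ofReal (2 * √T) * _ := lintegral_const_mul' _ _ ENNReal.ofReal_ne_top
      _ ≤ ENNReal.ofReal (2 * √T) * ENNReal.ofReal H := mul_le_mul_right (hH _) _
      _ = _ := (ENNReal.ofReal_mul (by positivity)).symm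
  have hsum := lintegral_multiset_sum_le (ν := volume.restrict (Set.Icc (1 : ℝ) 2)) P₂.roots
    (fun (α : ℂ) (x : ℝ) => Real.log (1 + T / ‖(x : ℂ) - τ - α‖)) (fun α => by fun_prop)
    (fun α x => Real.log_nonneg (by
      have : 0 ≤ T / ‖(x : ℂ) - τ - α‖ := by positivity
      linarith)) (M := 2 * √T * H) (by positivity) hg
  calc _ ≤ ∫⁻ x in Set.Icc (1 : ℝ) 2, (ENNReal.ofReal A + ENNReal.ofReal
          ((P₂.roots.map fun α => Real.log (1 + T / ‖(x : ℂ) - τ - α‖)).sum)) := by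
        refine setLIntegral_mono_ae' measurableSet_Icc (Filter.Eventually.of_forall fun x hx => ?_)
        rw [← ENNReal.ofReal_add hA0]
        · apply ENNReal.ofReal_le_ofReal
          refine posLog_ratio_le h₁ hle hT ?_
          have h3 : ‖(x : ℂ) - τ‖ ≤ 2 + ‖τ‖ := by
            refine (norm_sub_le _ _).trans ?_
            rw [Complex.norm_real, Real.norm_eq_abs, abs_of_nonneg (by linarith [hx.1])]
            linarith [hx.2]
          linarith
        · refine Multiset.sum_nonneg fun y hy => ?_
          obtain ⟨α, -, rfl⟩ := Multiset.mem_map.1 hy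
          refine Real.log_nonneg ?_
          have : 0 ≤ T / ‖(x : ℂ) - τ - α‖ := by positivity
          linarith
    _ = ENNReal.ofReal A + _ := by
        rw [lintegral_add_left measurable_const]
        congr 1
        rw [lintegral_const, Measure.restrict_apply_univ, Real.volume_Icc]
        norm_num
    _ ≤ ENNReal.ofReal A + ENNReal.ofReal (P₂.roots.card * (2 * √T * H)) :=
        add_le_add le_rfl hsum
    _ ≤ _ := by
        rw [← ENNReal.ofReal_add hA0 (by positivity)]
        apply ENNReal.ofReal_le_ofReal
        have hcard : (P₂.roots.card : ℝ) ≤ d := by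
          exact_mod_cast (Polynomial.card_roots' P₂).trans h₂
        have h5 : (P₂.roots.card : ℝ) * (2 * √T * H) ≤
            d * (2 * (√(d + 3) * √(1 + ‖τ‖)) * H) := by
          gcongr
        rw [add_mul]
        nlinarith


/-! ### Exponential functionals of the walk -/

/-- The standing assumptions on the sequence of service and inter-arrival times. -/
structure IsModel {Ω : Type*} [MeasurableSpace Ω] (μ : Measure Ω) (B A : ℕ → Ω → ℝ) : Prop where
  measB : ∀ i, Measurable (B i)
  measA : ∀ i, Measurable (A i)
  indep : iIndepFun (fun (i : ℕ) (ω : Ω) => (B i ω, A i ω)) μ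
  ident : ∀ i, IdentDistrib (fun ω => (B i ω, A i ω)) (fun ω => (B 0 ω, A 0 ω)) μ μ
  nonnegB : ∀ᵐ ω ∂μ, 0 ≤ B 0 ω
  nonnegA : ∀ᵐ ω ∂μ, 0 ≤ A 0 ω
  ne : ∀ᵐ ω ∂μ, B 0 ω ≠ A 0 ω

/-- `exp(-s a_n - ξ S_n)`, which is `exp(-ξ b_n - (s - ξ) a_n)`. -/
def expo {Ω : Type*} (B A : ℕ → Ω → ℝ) (n : ℕ) (s ξ : ℂ) (ω : Ω) : ℂ :=
  Complex.exp (-s * (partialSum A n ω : ℂ) - ξ * (walk B A n ω : ℂ))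

/-- `E[exp(-s a_n - ξ S_n); E]`. -/
def expoInt {Ω : Type*} [MeasurableSpace Ω] (μ : Measure Ω) (B A : ℕ → Ω → ℝ) (n : ℕ) (E : Set Ω)
    (s ξ : ℂ) : ℂ := ∫ ω in E, expo B A n s ξ ω ∂μ

/-- `∑ z^n E[exp(-s a_n - ξ S_n); E_n]`. -/
def expoSeries {Ω : Type*} [MeasurableSpace Ω] (μ : Measure Ω) (B A : ℕ → Ω → ℝ)
    (E : ℕ → Set Ω) (z s ξ : ℂ) : ℂ := ∑' n, z ^ n * expoInt μ B A n (E n) s ξ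

section

variable {Ω : Type*} {B A : ℕ → Ω → ℝ}

theorem walk_eq (n : ℕ) (ω : Ω) : walk B A n ω = partialSum B n ω - partialSum A n ω := by
  simp [walk, partialSum, Finset.sum_sub_distrib]

theorem walk_succ (n : ℕ) (ω : Ω) : walk B A (n + 1) ω = walk B A n ω + (B n ω - A n ω) := by
  simp only [walk, Finset.sum_range_succ]

theorem partialSum_succ (X : ℕ → Ω → ℝ) (n : ℕ) (ω : Ω) :
    partialSum X (n + 1) ω = partialSum X n ω + X n ω := by
  simp [partialSum, Finset.sum_range_succ]

theorem norm_expo (n : ℕ) (s ξ : ℂ) (ω : Ω) :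
    ‖expo B A n s ξ ω‖ = Real.exp (-s.re * partialSum A n ω - ξ.re * walk B A n ω) := by
  rw [expo, Complex.norm_exp]
  simp

end

section

variable {Ω : Type*} [MeasurableSpace Ω] {μ : Measure Ω} {B A : ℕ → Ω → ℝ}

/-- The bound by one at the two real shifts `w₀ ± 2ε` forces exponential decay in `|a|` between
them, and this absorbs the factor `a` produced by differentiation. No moment of `a` is needed. -/
theorem differentiableOn_setIntegral_exp [IsFiniteMeasure μ] {E : Set Ω} {a : Ω → ℝ} {c : Ω → ℂ}
    (ha : Measurable a) (hc : Measurable c) {U : Set ℂ} (hU : IsOpen U)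
    (h : ∀ w ∈ U, ∀ᵐ ω ∂(μ.restrict E), ‖Complex.exp (c ω - w * (a ω : ℂ))‖ ≤ 1) :
    DifferentiableOn ℂ (fun w => ∫ ω in E, Complex.exp (c ω - w * (a ω : ℂ)) ∂μ) U := by
  intro w₀ hw₀
  obtain ⟨δ, hδ, hball⟩ := Metric.isOpen_iff.1 hU w₀ hw₀
  -- The shifts by `2ε` then stay inside the ball of radius `δ`, and a margin of `ε` remains for `w`
  -- near `w₀`.
  set ε : ℝ := δ / 3 with hε
  have hε0 : 0 < ε := by positivity
  have hmem : ∀ t : ℝ, |t| ≤ 2 * ε → w₀ + (t : ℂ) ∈ U := by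
    intro t ht
    apply hball
    rw [Metric.mem_ball, dist_eq_norm, add_sub_cancel_left, Complex.norm_real, Real.norm_eq_abs]
    linarith
  have hre : ∀ w : ℂ, ∀ ω, ‖Complex.exp (c ω - w * (a ω : ℂ))‖ =
      Real.exp ((c ω).re - w.re * a ω) := by
    intro w ω
    rw [Complex.norm_exp]
    simp
  have hm : ∀ w : ℂ, Measurable fun ω => Complex.exp (c ω - w * (a ω : ℂ)) := by
    intro w; fun_prop
  have h1 := h _ (hmem (2 * ε) (by rw [abs_of_pos (by positivity)]))
  have h2 := h _ (hmem (-(2 * ε)) (by rw [abs_neg, abs_of_pos (by positivity)]))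
  have key : ∀ᵐ ω ∂(μ.restrict E), ∀ w ∈ Metric.ball w₀ ε,
      ‖Complex.exp (c ω - w * (a ω : ℂ)) * (-(a ω : ℂ))‖ ≤ ε⁻¹ := by
    filter_upwards [h1, h2] with ω h1 h2 w hw
    rw [hre, Real.exp_le_one_iff] at h1 h2
    rw [norm_mul, hre, norm_neg, Complex.norm_real, Real.norm_eq_abs]
    have hw' : |w.re - w₀.re| ≤ ε := by
      have := Complex.abs_re_le_norm (w - w₀)
      rw [Metric.mem_ball, dist_eq_norm] at hw
      simp only [Complex.sub_re] at this
      linarith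
    have h3 : (c ω).re - w.re * a ω ≤ -(ε * |a ω|) := by
      have h4 : (c ω).re - w₀.re * a ω ≤ -(2 * ε) * |a ω| := by
        simp only [Complex.add_re, Complex.ofReal_re] at h1 h2
        rcases abs_cases (a ω) with h5 | h5 <;> rw [h5.1] <;> linarith
      have h6 : (w₀.re - w.re) * a ω ≤ ε * |a ω| := by
        calc (w₀.re - w.re) * a ω ≤ |(w₀.re - w.re) * a ω| := le_abs_self _
          _ = |w.re - w₀.re| * |a ω| := by rw [abs_mul, abs_sub_comm]
          _ ≤ _ := by gcongr
      linarith
    have h7 : ε * |a ω| ≤ Real.exp (ε * |a ω|) := by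
      linarith [Real.add_one_le_exp (ε * |a ω|)]
    calc Real.exp ((c ω).re - w.re * a ω) * |a ω| ≤ Real.exp (-(ε * |a ω|)) * |a ω| := by
          gcongr
      _ ≤ ε⁻¹ := by
          rw [Real.exp_neg, ← div_eq_inv_mul, div_le_iff₀ (Real.exp_pos _), ← div_eq_inv_mul,
            le_div_iff₀ hε0]
          linarith
  have hint : Integrable (fun ω => Complex.exp (c ω - w₀ * (a ω : ℂ))) (μ.restrict E) := by
    refine Integrable.of_bound (hm w₀).aestronglyMeasurable 1 (h w₀ hw₀)
  have hD := hasDerivAt_integral_of_dominated_loc_of_deriv_le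
    (F := fun w ω => Complex.exp (c ω - w * (a ω : ℂ)))
    (F' := fun w ω => Complex.exp (c ω - w * (a ω : ℂ)) * (-(a ω : ℂ)))
    (bound := fun _ => ε⁻¹) (Metric.ball_mem_nhds w₀ hε0)
    (Filter.Eventually.of_forall fun w => (hm w).aestronglyMeasurable) hint
    (by fun_prop) key (integrable_const _)
    (Filter.Eventually.of_forall fun ω w _ => by
      have h8 : HasDerivAt (fun w : ℂ => c ω - w * (a ω : ℂ)) (-(a ω : ℂ)) w := by
        simpa using ((hasDerivAt_id w).mul_const (a ω : ℂ)).const_sub (c ω)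
      exact h8.cexp)
  exact hD.2.differentiableAt.differentiableWithinAt

theorem measurable_partialSum {X : ℕ → Ω → ℝ} (hX : ∀ i, Measurable (X i)) (n : ℕ) :
    Measurable (partialSum X n) := by
  unfold partialSum
  fun_prop

theorem IsModel.measurable_walk (hM : IsModel μ B A) (n : ℕ) : Measurable (walk B A n) := by
  have h1 := hM.measB
  have h2 := hM.measA
  unfold walk
  fun_prop

theorem IsModel.measurable_expo (hM : IsModel μ B A) (n : ℕ) (s ξ : ℂ) :
    Measurable (expo B A n s ξ) := by
  have h1 := hM.measurable_walk n
  have h2 := measurable_partialSum hM.measA n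
  unfold expo
  fun_prop

theorem IsModel.ae_nonneg (hM : IsModel μ B A) :
    ∀ᵐ ω ∂μ, ∀ i, 0 ≤ B i ω ∧ 0 ≤ A i ω := by
  rw [ae_all_iff]
  intro i
  have h0 : ∀ᵐ p ∂(μ.map fun ω => (B 0 ω, A 0 ω)), 0 ≤ p.1 ∧ 0 ≤ p.2 := by
    have hset : MeasurableSet {p : ℝ × ℝ | 0 ≤ p.1 ∧ 0 ≤ p.2} :=
      (measurableSet_le measurable_const measurable_fst).inter
        (measurableSet_le measurable_const measurable_snd)
    rw [ae_map_iff ((hM.measB 0).prodMk (hM.measA 0)).aemeasurable hset]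
    filter_upwards [hM.nonnegB, hM.nonnegA] with ω h1 h2 using ⟨h1, h2⟩
  rw [← (hM.ident i).map_eq] at h0
  exact ae_of_ae_map ((hM.measB i).prodMk (hM.measA i)).aemeasurable h0

theorem IsModel.ae_partialSum_nonneg (hM : IsModel μ B A) :
    ∀ᵐ ω ∂μ, ∀ n, 0 ≤ partialSum B n ω ∧ 0 ≤ partialSum A n ω := by
  filter_upwards [hM.ae_nonneg] with ω h n
  exact ⟨Finset.sum_nonneg fun i _ => (h i).1, Finset.sum_nonneg fun i _ => (h i).2⟩

/-- `exp(-s a_n - ξ S_n)` is bounded by `1` on the set `E`. -/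
def IsBddOn (μ : Measure Ω) (B A : ℕ → Ω → ℝ) (n : ℕ) (E : Set Ω) (s ξ : ℂ) : Prop :=
  ∀ᵐ ω ∂μ, ω ∈ E → ‖expo B A n s ξ ω‖ ≤ 1

theorem IsModel.isBddOn_right (hM : IsModel μ B A) {n : ℕ} {E : Set Ω}
    (hE : ∀ ω ∈ E, 0 ≤ walk B A n ω) {s ξ : ℂ} (hs : 0 ≤ s.re) (hξ : 0 ≤ ξ.re) :
    IsBddOn μ B A n E s ξ := by
  filter_upwards [hM.ae_partialSum_nonneg] with ω h hω
  rw [norm_expo, Real.exp_le_one_iff]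
  have := mul_nonneg hs (h n).2
  have := mul_nonneg hξ (hE ω hω)
  linarith

/-- With `a_n = b_n - S_n` the exponent becomes `-s b_n + (s - ξ) S_n`, whose real part is not
positive. Combined with the right-hand case, the closed strip `0 ≤ Re ξ ≤ Re s` needs no restriction
on the sign of `S_n`. -/
theorem IsModel.isBddOn_left (hM : IsModel μ B A) {n : ℕ} {E : Set Ω}
    (hE : ∀ ω ∈ E, walk B A n ω ≤ 0) {s ξ : ℂ} (hs : 0 ≤ s.re) (hξ : ξ.re ≤ s.re) :
    IsBddOn μ B A n E s ξ := by
  filter_upwards [hM.ae_partialSum_nonneg] with ω h hω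
  rw [norm_expo, Real.exp_le_one_iff]
  have h1 := mul_nonneg hs (h n).1
  have h2 := mul_nonneg (sub_nonneg.2 hξ) (neg_nonneg.2 (hE ω hω))
  have h3 := walk_eq (B := B) (A := A) n ω
  have h4 : partialSum A n ω = partialSum B n ω - walk B A n ω := by linarith
  rw [h4]
  nlinarith

theorem IsModel.isBddOn_strip (hM : IsModel μ B A) {n : ℕ} {E : Set Ω}
    {s ξ : ℂ} (h0 : 0 ≤ ξ.re) (hξ : ξ.re ≤ s.re) : IsBddOn μ B A n E s ξ := by
  have h1 := hM.isBddOn_left (n := n) (E := {ω | walk B A n ω ≤ 0}) (fun _ h => h)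
    (h0.trans hξ) hξ
  have h2 := hM.isBddOn_right (n := n) (E := {ω | 0 ≤ walk B A n ω}) (fun _ h => h)
    (h0.trans hξ) h0
  filter_upwards [h1, h2] with ω h1 h2 _
  rcases le_total (walk B A n ω) 0 with h | h
  · exact h1 h
  · exact h2 h

variable [IsProbabilityMeasure μ]

theorem IsBddOn.integrableOn (hM : IsModel μ B A) {n : ℕ} {E : Set Ω} (hE : MeasurableSet E)
    {s ξ : ℂ} (h : IsBddOn μ B A n E s ξ) : IntegrableOn (expo B A n s ξ) E μ :=
  Integrable.of_bound (hM.measurable_expo n s ξ).aestronglyMeasurable 1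
    ((ae_restrict_iff' hE).2 h)

theorem IsBddOn.norm_expoInt_le {n : ℕ} {E : Set Ω}
    {s ξ : ℂ} (h : IsBddOn μ B A n E s ξ) : ‖expoInt μ B A n E s ξ‖ ≤ μ.real E := by
  have := norm_setIntegral_le_of_norm_le_const_ae' (measure_lt_top μ E) (C := 1) h
  rw [one_mul] at this
  exact this

theorem IsModel.differentiableOn_expoInt (hM : IsModel μ B A) {n : ℕ} {E : Set Ω}
    (hE : MeasurableSet E) {s : ℂ} {U : Set ℂ} (hU : IsOpen U)
    (h : ∀ ξ ∈ U, IsBddOn μ B A n E s ξ) :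
    DifferentiableOn ℂ (expoInt μ B A n E s) U := by
  have h2 := measurable_partialSum hM.measA n
  exact differentiableOn_setIntegral_exp (E := E) (hM.measurable_walk n)
    (c := fun ω => -s * (partialSum A n ω : ℂ)) (by fun_prop) hU
    fun ξ hξ => (ae_restrict_iff' hE).2 (h ξ hξ)

theorem IsModel.differentiableOn_expoInt_param (hM : IsModel μ B A) {n : ℕ} {E : Set Ω}
    (hE : MeasurableSet E) {ξ : ℂ} {U : Set ℂ} (hU : IsOpen U)
    (h : ∀ s ∈ U, IsBddOn μ B A n E s ξ) :
    DifferentiableOn ℂ (fun s => expoInt μ B A n E s ξ) U := by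
  have h2 := hM.measurable_walk n
  have h3 : ∀ s ω, Complex.exp (-ξ * (walk B A n ω : ℂ) - s * (partialSum A n ω : ℂ)) =
      expo B A n s ξ ω := by
    intro s ω
    rw [expo]; congr 1; ring
  have := differentiableOn_setIntegral_exp (μ := μ) (E := E) (measurable_partialSum hM.measA n)
    (c := fun ω => -ξ * (walk B A n ω : ℂ)) (by fun_prop) hU
    fun s hs => (ae_restrict_iff' hE).2 (by simp only [h3]; exact h s hs)
  simp only [h3] at this
  exact this

theorem IsModel.tendsto_expoInt (hM : IsModel μ B A) {n : ℕ} {E : Set Ω} (hE : MeasurableSet E)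
    {ι : Type*} {l : Filter ι} [l.IsCountablyGenerated] {s ξ : ι → ℂ} {g : Ω → ℂ}
    (h : ∀ᶠ i in l, IsBddOn μ B A n E (s i) (ξ i))
    (hlim : ∀ᵐ ω ∂μ, ω ∈ E → Filter.Tendsto (fun i => expo B A n (s i) (ξ i) ω) l (nhds (g ω))) :
    Filter.Tendsto (fun i => expoInt μ B A n E (s i) (ξ i)) l (nhds (∫ ω in E, g ω ∂μ)) := by
  refine tendsto_integral_filter_of_dominated_convergence (fun _ => 1)
    (Filter.Eventually.of_forall fun i => (hM.measurable_expo n _ _).aestronglyMeasurable)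
    ?_ (integrable_const _) ((ae_restrict_iff' hE).2 hlim)
  filter_upwards [h] with i hi using (ae_restrict_iff' hE).2 hi

theorem IsModel.tendsto_expoInt_of_tendsto (hM : IsModel μ B A) {n : ℕ} {E : Set Ω}
    (hE : MeasurableSet E) {ι : Type*} {l : Filter ι} [l.IsCountablyGenerated] {s ξ : ι → ℂ}
    {s₀ ξ₀ : ℂ} (h : ∀ᶠ i in l, IsBddOn μ B A n E (s i) (ξ i))
    (hs : Filter.Tendsto s l (nhds s₀)) (hξ : Filter.Tendsto ξ l (nhds ξ₀)) :
    Filter.Tendsto (fun i => expoInt μ B A n E (s i) (ξ i)) l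
      (nhds (expoInt μ B A n E s₀ ξ₀)) := by
  refine hM.tendsto_expoInt hE h (Filter.Eventually.of_forall fun ω _ => ?_)
  exact (Complex.continuous_exp.tendsto _).comp
    ((hs.neg.mul_const _).sub (hξ.mul_const _))

/-- The integral vanishes in the limit if the exponent tends to `-∞`. -/
theorem IsModel.tendsto_expoInt_zero (hM : IsModel μ B A) {n : ℕ} {E : Set Ω}
    (hE : MeasurableSet E) {ι : Type*} {l : Filter ι} [l.IsCountablyGenerated] {s : ℂ} {ξ : ι → ℂ}
    (h : ∀ᶠ i in l, IsBddOn μ B A n E s (ξ i))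
    (hlim : ∀ᵐ ω ∂μ, ω ∈ E → Filter.Tendsto (fun i => (ξ i).re * walk B A n ω) l Filter.atTop) :
    Filter.Tendsto (fun i => expoInt μ B A n E s (ξ i)) l (nhds 0) := by
  have := hM.tendsto_expoInt hE (s := fun _ => s) (g := fun _ => 0) h (by
    filter_upwards [hlim] with ω hω hωE
    rw [tendsto_zero_iff_norm_tendsto_zero]
    simp only [norm_expo]
    refine Real.tendsto_exp_atBot.comp ?_
    exact Filter.tendsto_atBot_add_const_left _ _ (Filter.tendsto_neg_atTop_atBot.comp (hω hωE)))
  simpa using this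

end


/-! ### First exits of the walk from a set, and independence of the next step -/

/-- The walk stays in `C` at the times `1, ..., n`. -/
def stay {Ω : Type*} (B A : ℕ → Ω → ℝ) (C : Set ℝ) (n : ℕ) : Set Ω :=
  {ω | ∀ j, 1 ≤ j → j ≤ n → walk B A j ω ∈ C}

/-- The walk leaves `C` for the first time (after time `0`) at time `n`. -/
def leave {Ω : Type*} (B A : ℕ → Ω → ℝ) (C : Set ℝ) : ℕ → Set Ω
  | 0 => ∅
  | n + 1 => stay B A C n ∩ {ω | walk B A (n + 1) ω ∉ C}

/-- The σ-algebra generated by the first `n` pairs. -/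
@[reducible] def past {Ω : Type*} (B A : ℕ → Ω → ℝ) (n : ℕ) : MeasurableSpace Ω :=
  MeasurableSpace.comap (fun ω (i : Finset.range n) => (B i ω, A i ω)) MeasurableSpace.pi

section

variable {Ω : Type*} {B A : ℕ → Ω → ℝ}

theorem stay_zero (C : Set ℝ) : stay B A C 0 = Set.univ := by
  ext ω
  simp only [stay, Set.mem_ofPred_eq, Set.mem_univ, iff_true]
  intro j h1 h2
  omega

theorem stay_succ (C : Set ℝ) (n : ℕ) :
    stay B A C (n + 1) = stay B A C n ∩ {ω | walk B A (n + 1) ω ∈ C} := by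
  ext ω
  simp only [stay, Set.mem_ofPred_eq, Set.mem_inter_iff]
  constructor
  · intro h
    exact ⟨fun j h1 h2 => h j h1 (by omega), h _ (by omega) le_rfl⟩
  · rintro ⟨h, h'⟩ j h1 h2
    rcases Nat.lt_or_ge n j with h3 | h3
    · have : j = n + 1 := by omega
      rw [this]; exact h'
    · exact h j h1 h3

theorem stay_union_leave (C : Set ℝ) (n : ℕ) :
    stay B A C (n + 1) ∪ leave B A C (n + 1) = stay B A C n := by
  rw [stay_succ, leave, ← Set.inter_union_distrib_left]
  have : {ω | walk B A (n + 1) ω ∈ C} ∪ {ω | walk B A (n + 1) ω ∉ C} = Set.univ :=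
    Set.union_compl_self _
  rw [this, Set.inter_univ]

theorem disjoint_stay_leave (C : Set ℝ) (n : ℕ) :
    Disjoint (stay B A C (n + 1)) (leave B A C (n + 1)) := by
  rw [stay_succ, leave, Set.disjoint_left]
  rintro ω ⟨-, h⟩ ⟨-, h'⟩
  exact h' h

theorem walk_zero (ω : Ω) : walk B A 0 ω = 0 := by simp [walk]

theorem walk_mem_of_stay {C : Set ℝ} (h0 : (0 : ℝ) ∈ C) {n : ℕ} {ω : Ω}
    (h : ω ∈ stay B A C n) : walk B A n ω ∈ C := by
  rcases Nat.eq_zero_or_pos n with rfl | hn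
  · rwa [walk_zero]
  · exact h n hn le_rfl

theorem walk_notMem_of_leave {C : Set ℝ} {n : ℕ} {ω : Ω} (h : ω ∈ leave B A C n) :
    walk B A n ω ∉ C := by
  cases n with
  | zero => exact absurd h (Set.notMem_empty ω)
  | succ n => exact h.2

/-- On the diagonal `ξ = s` the inter-arrival times cancel; hence the transform of `P = b_N` is read
off from the factorization at `ξ = s`. -/
theorem expo_self (n : ℕ) (s : ℂ) (ω : Ω) :
    expo B A n s s ω = Complex.exp (-s * (partialSum B n ω : ℂ)) := by
  rw [expo, walk_eq]
  congr 1
  push_cast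
  ring

/-- Connects the infimum defining `N` with the recursively built exit events. At `n = 0` both sides
are false, because `S_0 = 0`. -/
theorem firstNegative_eq_iff (n : ℕ) (ω : Ω) :
    firstNegative B A ω = n ↔ ω ∈ leave B A (Set.Ici 0) n := by
  have hle : ∀ m : ℕ, walk B A m ω < 0 → firstNegative B A ω ≤ m := fun m hm =>
    iInf₂_le (f := fun (n : ℕ) (_ : walk B A n ω < 0) => (n : ℕ∞)) m hm
  constructor
  · intro h
    have hall : ∀ m : ℕ, m < n → 0 ≤ walk B A m ω := by
      intro m hm
      by_contra! hneg
      have h2 := hle m hneg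
      rw [h] at h2
      have : n ≤ m := by exact_mod_cast h2
      omega
    have hn : walk B A n ω < 0 := by
      by_contra! hpos
      have : ((n + 1 : ℕ) : ℕ∞) ≤ firstNegative B A ω := by
        refine le_iInf₂ fun m hm => ?_
        have : n + 1 ≤ m := by
          by_contra! hlt
          rcases Nat.lt_or_ge m n with h3 | h3
          · linarith [hall m h3]
          · have : m = n := by omega
            subst this
            linarith
        exact_mod_cast this
      rw [h] at this
      have : n + 1 ≤ n := by exact_mod_cast this
      omega
    cases n with
    | zero => rw [walk_zero] at hn; exact absurd hn (lt_irrefl _)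
    | succ n =>
      refine ⟨fun j _ h2 => hall j (by omega), ?_⟩
      simpa using hn
  · intro h
    cases n with
    | zero => exact absurd h (Set.notMem_empty ω)
    | succ n =>
      have h2 : walk B A (n + 1) ω < 0 := by simpa using h.2
      refine le_antisymm (hle _ h2) (le_iInf₂ fun m hm => ?_)
      have : n + 1 ≤ m := by
        by_contra! hlt
        have h3 : 0 ≤ walk B A m ω := by
          rcases Nat.eq_zero_or_pos m with rfl | hm0
          · rw [walk_zero]
          · exact h.1 m hm0 (by omega)
        linarith
      exact_mod_cast this

theorem mem_stay_of_firstNegative_eq_top {ω : Ω} (h : firstNegative B A ω = ⊤) (n : ℕ) :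
    ω ∈ stay B A (Set.Ici 0) n := by
  intro j _ _
  by_contra hneg
  have h1 : walk B A j ω < 0 := by simpa using hneg
  have h2 : firstNegative B A ω ≤ j :=
    iInf₂_le (f := fun (n : ℕ) (_ : walk B A n ω < 0) => (n : ℕ∞)) j h1
  rw [h] at h2
  exact absurd h2 (by simp)

theorem measurable_past_walk {n j : ℕ} (hj : j ≤ n) : Measurable[past B A n] (walk B A j) := by
  have h : walk B A j = (fun v : Finset.range n → ℝ × ℝ =>
      ∑ i : Finset.range j, ((v ⟨i, Finset.mem_range.2 ((Finset.mem_range.1 i.2).trans_le hj)⟩).1 -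
        (v ⟨i, Finset.mem_range.2 ((Finset.mem_range.1 i.2).trans_le hj)⟩).2)) ∘
      (fun ω (i : Finset.range n) => (B i ω, A i ω)) := by
    funext ω
    simp only [walk, Function.comp]
    exact (Finset.sum_coe_sort (Finset.range j) fun i => B i ω - A i ω).symm
  rw [h]
  exact Measurable.comp (by fun_prop) (comap_measurable _)

theorem measurable_past_partialSum {n j : ℕ} (hj : j ≤ n) :
    Measurable[past B A n] (partialSum A j) := by
  have h : partialSum A j = (fun v : Finset.range n → ℝ × ℝ =>
      ∑ i : Finset.range j, (v ⟨i, Finset.mem_range.2 ((Finset.mem_range.1 i.2).trans_le hj)⟩).2) ∘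
      (fun ω (i : Finset.range n) => (B i ω, A i ω)) := by
    funext ω
    simp only [partialSum, Function.comp]
    exact (Finset.sum_coe_sort (Finset.range j) fun i => A i ω).symm
  rw [h]
  exact Measurable.comp (by fun_prop) (comap_measurable _)

theorem measurableSet_past_stay {C : Set ℝ} (hC : MeasurableSet C) (n : ℕ) :
    MeasurableSet[past B A n] (stay B A C n) := by
  have : stay B A C n = ⋂ j ∈ Finset.Icc 1 n, walk B A j ⁻¹' C := by
    ext ω
    simp [stay]
  rw [this]
  refine Finset.measurableSet_biInter _ fun j hj => ?_
  exact measurable_past_walk (Finset.mem_Icc.1 hj).2 hC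

end

section

variable {Ω : Type*} [MeasurableSpace Ω] {μ : Measure Ω} {B A : ℕ → Ω → ℝ}

theorem IsModel.past_le (hM : IsModel μ B A) (n : ℕ) : past B A n ≤ ‹MeasurableSpace Ω› := by
  have h : Measurable (fun ω (i : Finset.range n) => (B i ω, A i ω)) :=
    measurable_pi_lambda _ fun i => (hM.measB i).prodMk (hM.measA i)
  exact h.comap_le

theorem IsModel.measurableSet_stay (hM : IsModel μ B A) {C : Set ℝ} (hC : MeasurableSet C)
    (n : ℕ) : MeasurableSet (stay B A C n) :=
  hM.past_le n _ (measurableSet_past_stay hC n)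

theorem IsModel.measurableSet_leave (hM : IsModel μ B A) {C : Set ℝ} (hC : MeasurableSet C)
    (n : ℕ) : MeasurableSet (leave B A C n) := by
  cases n with
  | zero => exact MeasurableSet.empty
  | succ n => exact (hM.measurableSet_stay hC n).inter (hM.measurable_walk _ hC.compl)

/-- The σ-algebra `past B A n` involves only indices below `n`, so the pair with index `n` is
independent of it; equality in law then replaces that pair by the pair with index `0`. -/
theorem IsModel.integral_mul_next {𝕜 : Type*} [RCLike 𝕜] (hM : IsModel μ B A) (n : ℕ) {Y : Ω → 𝕜}
    (hY : Measurable[past B A n] Y) {g : ℝ × ℝ → 𝕜} (hg : Measurable g) :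
    ∫ ω, Y ω * g (B n ω, A n ω) ∂μ = (∫ ω, Y ω ∂μ) * ∫ ω, g (B 0 ω, A 0 ω) ∂μ := by
  have hmp : ∀ i, Measurable fun ω => (B i ω, A i ω) := fun i => (hM.measB i).prodMk (hM.measA i)
  have hind := hM.indep.indepFun_finset (Finset.range n) {n} (by simp) hmp
  rw [IndepFun_iff_Indep] at hind
  have hXY : IndepFun Y (fun ω => g (B n ω, A n ω)) μ := by
    rw [IndepFun_iff_Indep]
    refine indep_of_indep_of_le_left (indep_of_indep_of_le_right hind ?_) hY.comap_le
    have h1 : (fun ω => g (B n ω, A n ω)) =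
        (fun v : ({n} : Finset ℕ) → ℝ × ℝ => g (v ⟨n, Finset.mem_singleton_self n⟩)) ∘
          (fun ω (i : ({n} : Finset ℕ)) => (B i ω, A i ω)) := rfl
    rw [h1]
    refine Measurable.comap_le ?_
    refine Measurable.comp (hg.comp (measurable_pi_apply _)) (comap_measurable _)
  have hYm : Measurable Y := hY.mono (hM.past_le n) le_rfl
  have h2 := hXY.integral_fun_mul_eq_mul_integral hYm.aestronglyMeasurable
    (hg.comp (hmp n)).aestronglyMeasurable
  rw [h2]
  congr 1
  exact ((hM.ident n).comp hg).integral_eq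

/-- Whether the walk stays in `C` up to time `n` is decided before the next pair is drawn, so one
more step contributes exactly a factor `h(ξ, s - ξ)`. -/
theorem IsModel.expoInt_succ_stay (hM : IsModel μ B A) {C : Set ℝ} (hC : MeasurableSet C) (n : ℕ)
    (s ξ : ℂ) : expoInt μ B A (n + 1) (stay B A C n) s ξ =
      expoInt μ B A n (stay B A C n) s ξ * jointLST μ (B 0) (A 0) ξ (s - ξ) := by
  have hS := measurableSet_past_stay (B := B) (A := A) hC n
  have hY : Measurable[past B A n] ((stay B A C n).indicator (expo B A n s ξ)) := by
    refine Measurable.indicator ?_ hS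
    have h1 := measurable_past_walk (B := B) (A := A) (le_refl n)
    have h2 := measurable_past_partialSum (B := B) (A := A) (le_refl n)
    unfold expo
    exact Complex.measurable_exp.comp (((Complex.measurable_ofReal.comp h2).const_mul _).sub
      ((Complex.measurable_ofReal.comp h1).const_mul _))
  have h := hM.integral_mul_next n hY
    (g := fun p => Complex.exp (-ξ * (p.1 : ℂ) - (s - ξ) * (p.2 : ℂ))) (by fun_prop)
  rw [integral_indicator (hM.past_le n _ hS)] at h
  rw [expoInt, expoInt, jointLST, ← h, ← integral_indicator (hM.past_le n _ hS)]
  refine integral_congr_ae (Filter.Eventually.of_forall fun ω => ?_)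
  by_cases hω : ω ∈ stay B A C n
  · simp only [Set.indicator_of_mem hω]
    rw [expo, expo, ← Complex.exp_add, walk_succ, partialSum_succ]
    congr 1
    push_cast
    ring
  · simp only [Set.indicator_of_notMem hω, zero_mul]

variable [IsProbabilityMeasure μ]

/-! ### Series -/

theorem summable_expoSeries {E : ℕ → Set Ω} {z s ξ : ℂ}
    (hsum : Summable fun n => ‖z‖ ^ n * μ.real (E n)) (hb : ∀ n, IsBddOn μ B A n (E n) s ξ) :
    Summable fun n => z ^ n * expoInt μ B A n (E n) s ξ :=
  Summable.of_norm_bounded hsum fun n => by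
    rw [norm_mul, norm_pow]
    exact mul_le_mul_of_nonneg_left (hb n).norm_expoInt_le (by positivity)

theorem norm_expoSeries_le {E : ℕ → Set Ω} {z s ξ : ℂ}
    (hsum : Summable fun n => ‖z‖ ^ n * μ.real (E n)) (hb : ∀ n, IsBddOn μ B A n (E n) s ξ) :
    ‖expoSeries μ B A E z s ξ‖ ≤ ∑' n, ‖z‖ ^ n * μ.real (E n) :=
  tsum_of_norm_bounded hsum.hasSum fun n => by
    rw [norm_mul, norm_pow]
    exact mul_le_mul_of_nonneg_left (hb n).norm_expoInt_le (by positivity)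

theorem IsModel.differentiableOn_expoSeries (hM : IsModel μ B A) {E : ℕ → Set Ω} {z s : ℂ}
    {U : Set ℂ} (hE : ∀ n, MeasurableSet (E n)) (hU : IsOpen U)
    (hsum : Summable fun n => ‖z‖ ^ n * μ.real (E n))
    (hb : ∀ ξ ∈ U, ∀ n, IsBddOn μ B A n (E n) s ξ) :
    DifferentiableOn ℂ (expoSeries μ B A E z s) U := by
  refine Complex.differentiableOn_tsum_of_summable_norm hsum (fun n => ?_) hU fun n ξ hξ => ?_
  · exact (hM.differentiableOn_expoInt (hE n) hU fun ξ hξ => hb ξ hξ n).const_mul _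
  · rw [norm_mul, norm_pow]
    exact mul_le_mul_of_nonneg_left (hb ξ hξ n).norm_expoInt_le (by positivity)

/-- The limit coefficients are left arbitrary, so that `ξ → -∞` is covered as well as convergent
parameters. For exit events `ρ = 1` is allowed, since their probabilities sum to at most one. -/
theorem tendsto_expoSeries {E : ℕ → Set Ω} {ι : Type*} {l : Filter ι} {z s ξ : ι → ℂ} {z₀ : ℂ}
    {ρ : ℝ} {c : ℕ → ℂ} (hz : Filter.Tendsto z l (nhds z₀)) (hzρ : ∀ᶠ i in l, ‖z i‖ ≤ ρ)
    (hsum : Summable fun n => ρ ^ n * μ.real (E n))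
    (hb : ∀ᶠ i in l, ∀ n, IsBddOn μ B A n (E n) (s i) (ξ i))
    (hlim : ∀ n, Filter.Tendsto (fun i => expoInt μ B A n (E n) (s i) (ξ i)) l (nhds (c n))) :
    Filter.Tendsto (fun i => expoSeries μ B A E (z i) (s i) (ξ i)) l
      (nhds (∑' n, z₀ ^ n * c n)) := by
  refine tendsto_tsum_of_dominated_convergence hsum (fun n => (hz.pow n).mul (hlim n)) ?_
  filter_upwards [hzρ, hb] with i h1 h2 n
  rw [norm_mul, norm_pow]
  exact mul_le_mul (pow_le_pow_left₀ (norm_nonneg _) h1 n) (h2 n).norm_expoInt_le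
    (norm_nonneg _) (pow_nonneg ((norm_nonneg _).trans h1) n)

theorem IsModel.tendsto_expoSeries_of_tendsto (hM : IsModel μ B A) {E : ℕ → Set Ω}
    (hE : ∀ n, MeasurableSet (E n)) {ι : Type*} {l : Filter ι} [l.IsCountablyGenerated]
    {z s ξ : ι → ℂ} {z₀ s₀ ξ₀ : ℂ} {ρ : ℝ}
    (hz : Filter.Tendsto z l (nhds z₀)) (hzρ : ∀ᶠ i in l, ‖z i‖ ≤ ρ)
    (hs : Filter.Tendsto s l (nhds s₀)) (hξ : Filter.Tendsto ξ l (nhds ξ₀))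
    (hsum : Summable fun n => ρ ^ n * μ.real (E n))
    (hb : ∀ᶠ i in l, ∀ n, IsBddOn μ B A n (E n) (s i) (ξ i)) :
    Filter.Tendsto (fun i => expoSeries μ B A E (z i) (s i) (ξ i)) l
      (nhds (expoSeries μ B A E z₀ s₀ ξ₀)) :=
  tendsto_expoSeries hz hzρ hsum hb fun n =>
    hM.tendsto_expoInt_of_tendsto (hE n) (hb.mono fun _ h => h n) hs hξ

theorem summable_stay (C : Set ℝ) {z : ℂ} (hz : ‖z‖ < 1) :
    Summable fun n => ‖z‖ ^ n * μ.real (stay B A C n) :=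
  Summable.of_nonneg_of_le (fun n => by positivity)
    (fun n => mul_le_of_le_one_right (by positivity) measureReal_le_one)
    (summable_geometric_of_lt_one (norm_nonneg z) hz)

theorem IsModel.sum_leave (hM : IsModel μ B A) {C : Set ℝ} (hC : MeasurableSet C) (n : ℕ) :
    ∑ k ∈ Finset.range (n + 1), μ.real (leave B A C k) = 1 - μ.real (stay B A C n) := by
  induction n with
  | zero => simp [leave, stay_zero]
  | succ n ih =>
    rw [Finset.sum_range_succ, ih, ← stay_union_leave C n,
      measureReal_union (disjoint_stay_leave C n) (hM.measurableSet_leave hC _)]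
    ring

theorem IsModel.summable_leave (hM : IsModel μ B A) {C : Set ℝ} (hC : MeasurableSet C) :
    Summable (fun n => μ.real (leave B A C n)) ∧ ∑' n, μ.real (leave B A C n) ≤ 1 := by
  have h : ∀ n, ∑ k ∈ Finset.range n, μ.real (leave B A C k) ≤ 1 := by
    intro n
    cases n with
    | zero => simp
    | succ n =>
      rw [hM.sum_leave hC n]
      linarith [measureReal_nonneg (μ := μ) (s := stay B A C n)]
  have hs := summable_of_sum_range_le (fun n => measureReal_nonneg) h
  exact ⟨hs, hs.tsum_le_of_sum_range_le h⟩

theorem IsModel.summable_pow_leave (hM : IsModel μ B A) {C : Set ℝ} (hC : MeasurableSet C) {ρ : ℝ}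
    (h0 : 0 ≤ ρ) (hρ : ρ ≤ 1) : Summable fun n => ρ ^ n * μ.real (leave B A C n) :=
  Summable.of_nonneg_of_le (fun n => by positivity)
    (fun n => mul_le_of_le_one_left measureReal_nonneg (pow_le_one₀ h0 hρ))
    (hM.summable_leave hC).1

/-- The Wiener–Hopf recursion, summed. -/
theorem IsModel.one_sub_leave_eq (hM : IsModel μ B A) {C : Set ℝ} (hC : MeasurableSet C)
    {z s ξ : ℂ} (hz : ‖z‖ < 1) (h0 : 0 ≤ ξ.re) (hξ : ξ.re ≤ s.re) :
    1 - expoSeries μ B A (leave B A C) z s ξ =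
      expoSeries μ B A (stay B A C) z s ξ * (1 - z * jointLST μ (B 0) (A 0) ξ (s - ξ)) := by
  set r := jointLST μ (B 0) (A 0) ξ (s - ξ) with hr
  have hb : ∀ n (E : Set Ω), IsBddOn μ B A n E s ξ := fun n E => hM.isBddOn_strip h0 hξ
  have hk := summable_expoSeries (E := stay B A C) (summable_stay C hz)
    (fun n => hb n (stay B A C n))
  have hg := summable_expoSeries (E := leave B A C)
    (hM.summable_pow_leave hC (norm_nonneg z) hz.le) (fun n => hb n (leave B A C n))
  have hrec : ∀ n, expoInt μ B A (n + 1) (stay B A C (n + 1)) s ξ +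
      expoInt μ B A (n + 1) (leave B A C (n + 1)) s ξ =
      expoInt μ B A n (stay B A C n) s ξ * r := by
    intro n
    rw [hr, ← hM.expoInt_succ_stay hC n s ξ, ← stay_union_leave C n]
    exact (setIntegral_union (disjoint_stay_leave C n) (hM.measurableSet_leave hC _)
      ((hb _ _).integrableOn hM (hM.measurableSet_stay hC _))
      ((hb _ _).integrableOn hM (hM.measurableSet_leave hC _))).symm
  have hk0 : expoInt μ B A 0 (stay B A C 0) s ξ = 1 := by
    simp [expoInt, stay_zero, expo, partialSum, walk]
  have hg0 : expoInt μ B A 0 (leave B A C 0) s ξ = 0 := by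
    simp [expoInt, leave]
  have e1 : expoSeries μ B A (stay B A C) z s ξ = 1 +
      ∑' n, z ^ (n + 1) * expoInt μ B A (n + 1) (stay B A C (n + 1)) s ξ := by
    rw [expoSeries, hk.tsum_eq_zero_add, hk0]; simp
  have e2 : expoSeries μ B A (leave B A C) z s ξ =
      ∑' n, z ^ (n + 1) * expoInt μ B A (n + 1) (leave B A C (n + 1)) s ξ := by
    rw [expoSeries, hg.tsum_eq_zero_add, hg0]; simp
  have e3 : (∑' n, z ^ (n + 1) * expoInt μ B A (n + 1) (stay B A C (n + 1)) s ξ) +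
      ∑' n, z ^ (n + 1) * expoInt μ B A (n + 1) (leave B A C (n + 1)) s ξ =
      expoSeries μ B A (stay B A C) z s ξ * (z * r) := by
    rw [← Summable.tsum_add ((summable_nat_add_iff 1).2 hk) ((summable_nat_add_iff 1).2 hg),
      expoSeries, ← tsum_mul_right]
    refine tsum_congr fun n => ?_
    rw [← mul_add, hrec, pow_succ]
    ring
  rw [mul_sub, mul_one, ← e3, e1, e2]
  ring

/-! ### The busy period -/

/-- Splits the integral over the disjoint events `N = n`; the interchange is justified even for `|z|
= 1` because `∑ P(N = n) ≤ 1`. -/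
theorem IsModel.busyTransform_eq (hM : IsModel μ B A) {z s : ℂ} (hz : ‖z‖ ≤ 1) (hs : 0 ≤ s.re) :
    busyTransform μ B A z s = expoSeries μ B A (leave B A (Set.Ici 0)) z s s := by
  classical
  have hC : MeasurableSet (Set.Ici (0 : ℝ)) := measurableSet_Ici
  set E := leave B A (Set.Ici 0) with hEdef
  have hE : ∀ n, MeasurableSet (E n) := fun n => hM.measurableSet_leave hC n
  have hb : ∀ n, IsBddOn μ B A n (E n) s s := fun n => hM.isBddOn_strip hs le_rfl
  have hint : ∀ n, Integrable ((E n).indicator fun ω => z ^ n * expo B A n s s ω) μ := fun n =>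
    (integrable_indicator_iff (hE n)).2 (((hb n).integrableOn hM (hE n)).const_mul _)
  have hsum : Summable fun n =>
      ∫ ω, ‖(E n).indicator (fun ω => z ^ n * expo B A n s s ω) ω‖ ∂μ := by
    refine Summable.of_nonneg_of_le (fun n => integral_nonneg fun _ => norm_nonneg _)
      (fun n => ?_) (hM.summable_pow_leave hC (norm_nonneg z) hz)
    have h1 : ∀ᵐ ω ∂μ, ‖(E n).indicator (fun ω => z ^ n * expo B A n s s ω) ω‖ ≤
        (E n).indicator (fun _ => ‖z‖ ^ n) ω := by
      filter_upwards [hb n] with ω hω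
      by_cases hωE : ω ∈ E n
      · rw [Set.indicator_of_mem hωE, Set.indicator_of_mem hωE, norm_mul, norm_pow]
        exact mul_le_of_le_one_right (by positivity) (hω hωE)
      · rw [Set.indicator_of_notMem hωE, Set.indicator_of_notMem hωE, norm_zero]
    refine (integral_mono_ae (hint n).norm ((integrable_const _).indicator (hE n)) h1).trans ?_
    rw [integral_indicator (hE n), setIntegral_const, smul_eq_mul, mul_comm]
  have h := integral_tsum_of_summable_integral_norm hint hsum
  rw [expoSeries, busyTransform]
  have hl : ∀ n, ∫ ω, (E n).indicator (fun ω => z ^ n * expo B A n s s ω) ω ∂μ =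
      z ^ n * expoInt μ B A n (E n) s s := by
    intro n
    rw [integral_indicator (hE n), integral_const_mul, expoInt]
  rw [tsum_congr fun n => (hl n).symm, h]
  refine integral_congr_ae (Filter.Eventually.of_forall fun ω => ?_)
  simp only
  split_ifs with htop
  · rw [eq_comm, ← tsum_zero (β := ℕ)]
    refine tsum_congr fun n => Set.indicator_of_notMem ?_ _
    rw [hEdef, ← firstNegative_eq_iff, htop]
    simp
  · obtain ⟨N, hN⟩ := ENat.ne_top_iff_exists.1 htop
    have hN' : firstNegative B A ω = N := hN.symm
    rw [hN', ENat.toNat_natCast, tsum_eq_single N]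
    · rw [Set.indicator_of_mem ((firstNegative_eq_iff N ω).1 hN'), expo_self]
    · intro n hn
      refine Set.indicator_of_notMem ?_ _
      rw [hEdef, ← firstNegative_eq_iff, hN']
      exact_mod_cast hn.symm

/-- Under negative drift, the expected length of the busy cycle is finite. -/
theorem IsModel.summable_stay_of_drift (hM : IsModel μ B A)
    (hdrift : ∫⁻ ω, ENNReal.ofReal (B 0 ω) ∂μ < ∫⁻ ω, ENNReal.ofReal (A 0 ω) ∂μ) :
    Summable fun n => μ.real (stay B A (Set.Ici 0) n) := by
  have hBm := hM.measB 0
  have hAm := hM.measA 0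
  -- `A` may have infinite mean. Truncation at a large `c` keeps the drift negative and bounds the
  -- last downward jump.
  obtain ⟨c, hc⟩ : ∃ c : ℕ, ∫⁻ ω, ENNReal.ofReal (B 0 ω) ∂μ <
      ∫⁻ ω, ENNReal.ofReal (min (A 0 ω) c) ∂μ := by
    have htend : Filter.Tendsto (fun c : ℕ => ∫⁻ ω, ENNReal.ofReal (min (A 0 ω) c) ∂μ) Filter.atTop
        (nhds (∫⁻ ω, ENNReal.ofReal (A 0 ω) ∂μ)) := by
      refine lintegral_tendsto_of_tendsto_of_monotone (fun c => by fun_prop) ?_ ?_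
      · refine Filter.Eventually.of_forall fun ω c c' hcc' => ENNReal.ofReal_le_ofReal ?_
        exact min_le_min le_rfl (by exact_mod_cast hcc')
      · refine Filter.Eventually.of_forall fun ω => ?_
        refine tendsto_const_nhds.congr' ?_
        obtain ⟨k, hk⟩ := exists_nat_ge (A 0 ω)
        filter_upwards [Filter.eventually_ge_atTop k] with c hkc
        rw [min_eq_left (hk.trans (by exact_mod_cast hkc))]
    exact (htend.eventually_const_lt hdrift).exists
  have hBint : Integrable (B 0) μ := by
    refine ⟨hBm.aestronglyMeasurable, ?_⟩
    rw [hasFiniteIntegral_iff_ofReal hM.nonnegB]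
    exact hdrift.trans_le le_top
  have hAint : Integrable (fun ω => min (A 0 ω) c) μ := by
    refine Integrable.of_bound (by fun_prop) c ?_
    filter_upwards [hM.nonnegA] with ω hω
    rw [Real.norm_eq_abs, abs_of_nonneg (le_min hω (Nat.cast_nonneg c))]
    exact min_le_right _ _
  set m : ℝ := ∫ ω, (B 0 ω - min (A 0 ω) c) ∂μ with hm
  have hm0 : m < 0 := by
    rw [hm, integral_sub hBint hAint, sub_neg,
      integral_eq_lintegral_of_nonneg_ae hM.nonnegB hBm.aestronglyMeasurable,
      integral_eq_lintegral_of_nonneg_ae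
        (by filter_upwards [hM.nonnegA] with ω hω using le_min hω (Nat.cast_nonneg c))
        (by fun_prop)]
    refine (ENNReal.toReal_lt_toReal (hdrift.trans_le le_top).ne ?_).2 hc
    exact (Integrable.lintegral_lt_top hAint).ne
  set g : ℝ × ℝ → ℝ := fun p => p.1 - min p.2 c with hg
  have hgm : Measurable g := by fun_prop
  have hXint : ∀ k, Integrable (fun ω => g (B k ω, A k ω)) μ := fun k =>
    ((hM.ident k).comp hgm).integrable_iff.2 (hBint.sub hAint)
  set St : ℕ → Set Ω := stay B A (Set.Ici 0) with hSt
  have hStm : ∀ k, MeasurableSet (St k) := fun k => hM.measurableSet_stay measurableSet_Ici k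
  -- `Z n` is the walk with truncated inter-arrival times, stopped at `N`. Its mean is the truncated
  -- drift times the expected number of steps taken, which is Wald's identity.
  set Z : ℕ → Ω → ℝ := fun n ω => ∑ k ∈ Finset.range n,
    (St k).indicator (fun ω => g (B k ω, A k ω)) ω with hZ
  have hZmean : ∀ n, ∫ ω, Z n ω ∂μ = (∑ k ∈ Finset.range n, μ.real (St k)) * m := by
    intro n
    rw [hZ, integral_finsetSum _ fun k _ => (hXint k).indicator (hStm k), Finset.sum_mul]
    refine Finset.sum_congr rfl fun k _ => ?_
    have h1 := hM.integral_mul_next k (Y := (St k).indicator fun _ => (1 : ℝ))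
      (measurable_const.indicator (measurableSet_past_stay measurableSet_Ici k)) hgm
    have h2 : ∫ ω, (St k).indicator (fun _ => (1 : ℝ)) ω ∂μ = μ.real (St k) := by
      rw [integral_indicator (hStm k)]; simp
    rw [h2] at h1
    refine Eq.trans ?_ h1
    refine integral_congr_ae (Filter.Eventually.of_forall fun ω => ?_)
    by_cases hω : ω ∈ St k
    · simp [Set.indicator_of_mem hω]
    · simp [Set.indicator_of_notMem hω]
  have hZint : ∀ n, Integrable (Z n) μ := fun n =>
    integrable_finsetSum _ fun k _ => (hXint k).indicator (hStm k)
  -- Until the walk turns negative, `Z` dominates it and is nonnegative; the step that ends the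
  -- excursion lowers `Z` by at most `c`.
  have hZlow : ∀ᵐ ω ∂μ, ∀ n, -(c : ℝ) ≤ Z n ω ∧ (ω ∈ St n → walk B A n ω ≤ Z n ω) := by
    filter_upwards [hM.ae_nonneg] with ω hω n
    induction n with
    | zero => simp [hZ, walk_zero]
    | succ n ih =>
      have hsucc : Z (n + 1) ω = Z n ω + (St n).indicator (fun ω => g (B n ω, A n ω)) ω := by
        simp [hZ, Finset.sum_range_succ]
      rw [hsucc]
      by_cases hn : ω ∈ St n
      · rw [Set.indicator_of_mem hn]
        have h1 := ih.2 hn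
        have h2 : 0 ≤ walk B A n ω := walk_mem_of_stay (C := Set.Ici 0) Set.self_mem_Ici hn
        have h3 : B n ω - A n ω ≤ g (B n ω, A n ω) := by
          simp only [hg]
          linarith [min_le_left (A n ω) (c : ℝ)]
        have h4 : -(c : ℝ) ≤ g (B n ω, A n ω) := by
          simp only [hg]
          linarith [min_le_right (A n ω) (c : ℝ), (hω n).1]
        refine ⟨by linarith, fun _ => ?_⟩
        rw [walk_succ]
        linarith
      · rw [Set.indicator_of_notMem hn, add_zero]
        refine ⟨ih.1, fun h => absurd ?_ hn⟩
        rw [hSt, stay_succ] at h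
        exact h.1
  refine summable_of_sum_range_le (c := c / (-m)) (fun n => measureReal_nonneg) fun n => ?_
  rw [le_div_iff₀ (by linarith)]
  have h1 : -(c : ℝ) ≤ ∫ ω, Z n ω ∂μ := by
    have h2 := integral_mono_ae (integrable_const (-(c : ℝ))) (hZint n)
      (by filter_upwards [hZlow] with ω hω using (hω n).1)
    simpa using h2
  rw [hZmean] at h1
  linarith

/-- The event `N = ∞` lies in every survival event, and the probabilities of these tend to zero. -/
theorem ae_firstNegative_ne_top
    (hsum : Summable fun n => μ.real (stay B A (Set.Ici 0) n)) :
    ∀ᵐ ω ∂μ, firstNegative B A ω ≠ ⊤ := by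
  rw [ae_iff]
  have hsub : ∀ n, {ω | ¬firstNegative B A ω ≠ ⊤} ⊆ stay B A (Set.Ici 0) n := fun n ω hω =>
    mem_stay_of_firstNegative_eq_top (not_not.1 hω) n
  have h0 : μ.real {ω | ¬firstNegative B A ω ≠ ⊤} ≤ 0 :=
    ge_of_tendsto' hsum.tendsto_atTop_zero fun n => measureReal_mono (hsub n)
  have h1 := le_antisymm h0 measureReal_nonneg
  exact (measureReal_eq_zero_iff (measure_ne_top _ _)).1 h1

end


/-! ### Zeros of analytic functions and of polynomials -/

theorem analyticOrderAt_eval {p : ℂ[X]} (hp : p ≠ 0) (w : ℂ) :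
    analyticOrderAt (fun z => p.eval z) w = p.rootMultiplicity w := by
  obtain ⟨q, hq, hdvd⟩ := Polynomial.exists_eq_pow_rootMultiplicity_mul_and_not_dvd p hp w
  have han : AnalyticAt ℂ (fun z => p.eval z) w :=
    p.differentiable.analyticAt w
  rw [han.analyticOrderAt_eq_natCast]
  refine ⟨fun z => q.eval z, q.differentiable.analyticAt w, ?_, ?_⟩
  · intro h0
    exact hdvd (Polynomial.dvd_iff_isRoot.2 h0)
  · refine Filter.Eventually.of_forall fun z => ?_
    conv_lhs => rw [hq]
    simp

theorem exists_norm_eval_le (p : ℂ[X]) :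
    ∃ C : ℝ, 0 ≤ C ∧ ∀ z, ‖p.eval z‖ ≤ C * (1 + ‖z‖) ^ p.natDegree := by
  refine ⟨∑ k ∈ Finset.range (p.natDegree + 1), ‖p.coeff k‖,
    Finset.sum_nonneg fun _ _ => norm_nonneg _, fun z => ?_⟩
  rw [Polynomial.eval_eq_sum_range, Finset.sum_mul]
  refine (norm_sum_le _ _).trans (Finset.sum_le_sum fun k hk => ?_)
  rw [norm_mul, norm_pow]
  refine mul_le_mul_of_nonneg_left ?_ (norm_nonneg _)
  calc ‖z‖ ^ k ≤ (1 + ‖z‖) ^ k := by gcongr; linarith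
    _ ≤ _ := pow_le_pow_right₀ (by linarith [norm_nonneg z])
      (Nat.lt_succ_iff.1 (Finset.mem_range.1 hk))

/-- Cancellation of an analytic factor which does not vanish identically. -/
theorem eq_zero_of_mul_eq_zero {F G : ℂ → ℂ} {U : Set ℂ} (hU : IsOpen U) (hF : ContinuousOn F U)
    (hG : AnalyticOnNhd ℂ G U) (hG0 : ∀ z ∈ U, analyticOrderAt G z ≠ ⊤)
    (h : ∀ z ∈ U, F z * G z = 0) : ∀ z ∈ U, F z = 0 := by
  intro z hz
  have h1 : ∀ᶠ w in nhdsWithin z {z}ᶜ, G w ≠ 0 := by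
    rcases (hG z hz).eventually_eq_zero_or_eventually_ne_zero with h2 | h2
    · exact absurd (analyticOrderAt_eq_top.2 h2) (hG0 z hz)
    · exact h2
  have h3 : ∀ᶠ w in nhdsWithin z {z}ᶜ, F w = 0 := by
    filter_upwards [h1, nhdsWithin_le_nhds (hU.mem_nhds hz)] with w hw hwU
    exact (mul_eq_zero.1 (h w hwU)).resolve_right hw
  have h4 : Filter.Tendsto F (nhdsWithin z {z}ᶜ) (nhds (F z)) :=
    ((hF z hz).continuousAt (hU.mem_nhds hz)).tendsto.mono_left nhdsWithin_le_nhds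
  have h5 : Filter.Tendsto F (nhdsWithin z {z}ᶜ) (nhds 0) :=
    tendsto_const_nhds.congr' (h3.mono fun w hw => hw.symm)
  exact tendsto_nhds_unique h4 h5

/-- An infinite order at one point would make `f` vanish on the whole half-plane, which contains the
infinitely many points `-1, -2, …`. -/
theorem order_ne_top_of_finite_zeros {f : ℂ → ℂ} {c : ℝ} (hc : 0 ≤ c)
    (hf : AnalyticOnNhd ℂ f {w : ℂ | w.re < c}) (hfin : {w : ℂ | w.re < 0 ∧ f w = 0}.Finite) :
    ∀ z ∈ {w : ℂ | w.re < c}, analyticOrderAt f z ≠ ⊤ := by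
  intro z hz htop
  rw [analyticOrderAt_eq_top] at htop
  have hpre : IsPreconnected {w : ℂ | w.re < c} := (convex_halfSpace_re_lt c).isPreconnected
  have h0 := hf.eqOn_zero_of_preconnected_of_eventuallyEq_zero hpre hz htop
  have hinj : Function.Injective fun k : ℕ => (-(k : ℂ) - 1) := by
    intro a b hab
    simpa using hab
  refine Set.infinite_of_injective_forall_mem hinj (s := {w : ℂ | w.re < 0 ∧ f w = 0}) ?_ hfin
  intro k
  have h1 : (-(k : ℂ) - 1).re < 0 := by
    simp only [Complex.sub_re, Complex.neg_re, Complex.natCast_re, Complex.one_re]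
    linarith [Nat.cast_nonneg (α := ℝ) k]
  exact ⟨h1, h0 (show (-(k : ℂ) - 1).re < c by linarith)⟩

theorem exists_zero_multiset {f : ℂ → ℂ} (hf : AnalyticOnNhd ℂ f {w : ℂ | w.re < 0})
    (hfin : {w : ℂ | w.re < 0 ∧ f w = 0}.Finite) :
    ∃ m : Multiset ℂ, (∀ w ∈ m, w.re < 0) ∧
      ∀ w : ℂ, w.re < 0 → (m.count w : ℕ∞) = analyticOrderAt f w := by
  classical
  refine ⟨∑ w ∈ hfin.toFinset, Multiset.replicate (analyticOrderNatAt f w) w, ?_, ?_⟩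
  · intro w hw
    obtain ⟨v, hv, hwv⟩ := Multiset.mem_sum.1 hw
    rw [Multiset.eq_of_mem_replicate hwv]
    exact ((Set.Finite.mem_toFinset _).1 hv).1
  · intro w hw
    have hne := order_ne_top_of_finite_zeros le_rfl hf hfin w hw
    rw [Multiset.count_sum']
    simp only [Multiset.count_replicate]
    rw [Finset.sum_ite_eq']
    split_ifs with h
    · exact Nat.cast_analyticOrderNatAt hne
    · have : f w ≠ 0 := fun h0 => h ((Set.Finite.mem_toFinset _).2 ⟨hw, h0⟩)
      rw [(hf w hw).analyticOrderAt_eq_zero.2 this]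
      rfl

/-! ### The upward and the downward part of one step -/

/-- `E[exp(-s A - ξ (B - A)); B > A]`. -/
def stepUp {Ω : Type*} [MeasurableSpace Ω] (μ : Measure Ω) (B A : ℕ → Ω → ℝ) (s ξ : ℂ) : ℂ :=
  expoInt μ B A 1 {ω | 0 < walk B A 1 ω} s ξ

/-- `E[exp(-s A - ξ (B - A)); B < A]`. -/
def stepDown {Ω : Type*} [MeasurableSpace Ω] (μ : Measure Ω) (B A : ℕ → Ω → ℝ) (s ξ : ℂ) : ℂ :=
  expoInt μ B A 1 {ω | walk B A 1 ω < 0} s ξ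

section

variable {Ω : Type*} [MeasurableSpace Ω] {μ : Measure Ω} {B A : ℕ → Ω → ℝ}

theorem jointLST_eq_expoInt (s ξ : ℂ) :
    jointLST μ (B 0) (A 0) ξ (s - ξ) = expoInt μ B A 1 Set.univ s ξ := by
  rw [expoInt, jointLST, setIntegral_univ]
  refine integral_congr_ae (Filter.Eventually.of_forall fun ω => ?_)
  simp only [expo, partialSum, walk, Finset.sum_range_one]
  congr 1
  push_cast
  ring

theorem IsModel.measurableSet_up (hM : IsModel μ B A) (n : ℕ) :
    MeasurableSet {ω | 0 < walk B A n ω} := measurableSet_lt measurable_const (hM.measurable_walk n)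

theorem IsModel.measurableSet_down (hM : IsModel μ B A) (n : ℕ) :
    MeasurableSet {ω | walk B A n ω < 0} := measurableSet_lt (hM.measurable_walk n) measurable_const

theorem IsModel.isBddOn_up (hM : IsModel μ B A) {s ξ : ℂ} (hs : 0 ≤ s.re) (hξ : 0 ≤ ξ.re) :
    IsBddOn μ B A 1 {ω | 0 < walk B A 1 ω} s ξ := hM.isBddOn_right (fun _ h => le_of_lt h) hs hξ

theorem IsModel.isBddOn_down (hM : IsModel μ B A) {s ξ : ℂ} (hs : 0 ≤ s.re) (hξ : ξ.re ≤ s.re) :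
    IsBddOn μ B A 1 {ω | walk B A 1 ω < 0} s ξ := hM.isBddOn_left (fun _ h => le_of_lt h) hs hξ

variable [IsProbabilityMeasure μ]

theorem IsModel.norm_stepUp_le (hM : IsModel μ B A) {s ξ : ℂ} (hs : 0 ≤ s.re) (hξ : 0 ≤ ξ.re) :
    ‖stepUp μ B A s ξ‖ ≤ 1 :=
  (hM.isBddOn_up hs hξ).norm_expoInt_le.trans measureReal_le_one

theorem IsModel.norm_stepDown_le (hM : IsModel μ B A) {s ξ : ℂ} (hs : 0 ≤ s.re)
    (hξ : ξ.re ≤ s.re) : ‖stepDown μ B A s ξ‖ ≤ 1 :=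
  (hM.isBddOn_down hs hξ).norm_expoInt_le.trans measureReal_le_one

theorem IsModel.differentiableOn_stepUp (hM : IsModel μ B A) {s : ℂ} (hs : 0 ≤ s.re) :
    DifferentiableOn ℂ (stepUp μ B A s) {ξ | 0 < ξ.re} :=
  hM.differentiableOn_expoInt (hM.measurableSet_up 1)
    (isOpen_lt continuous_const Complex.continuous_re)
    fun _ hξ => hM.isBddOn_up hs (le_of_lt hξ)

theorem IsModel.differentiableOn_stepDown (hM : IsModel μ B A) {s : ℂ} (hs : 0 ≤ s.re) :
    DifferentiableOn ℂ (stepDown μ B A s) {ξ | ξ.re < s.re} :=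
  hM.differentiableOn_expoInt (hM.measurableSet_down 1)
    (isOpen_lt Complex.continuous_re continuous_const)
    fun _ hξ => hM.isBddOn_down hs (le_of_lt hξ)

/-- Here `P(A = B) = 0` enters: a zero step belongs to neither part. -/
theorem IsModel.jointLST_eq_add (hM : IsModel μ B A) {s ξ : ℂ} (h0 : 0 ≤ ξ.re)
    (hξ : ξ.re ≤ s.re) :
    jointLST μ (B 0) (A 0) ξ (s - ξ) = stepUp μ B A s ξ + stepDown μ B A s ξ := by
  have hb : ∀ E : Set Ω, IsBddOn μ B A 1 E s ξ := fun E => hM.isBddOn_strip h0 hξ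
  rw [jointLST_eq_expoInt, stepUp, stepDown, expoInt, expoInt, expoInt,
    ← setIntegral_union _ (hM.measurableSet_down 1)
      ((hb _).integrableOn hM (hM.measurableSet_up 1))
      ((hb _).integrableOn hM (hM.measurableSet_down 1))]
  · refine setIntegral_congr_set ?_
    filter_upwards [hM.ne] with ω hω
    have : walk B A 1 ω ≠ 0 := by
      simp only [walk, Finset.sum_range_one]
      exact sub_ne_zero.2 hω
    apply propext
    change True ↔ (0 < walk B A 1 ω ∨ walk B A 1 ω < 0)
    exact ⟨fun _ => this.symm.lt_or_gt, fun _ => trivial⟩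
  · rw [Set.disjoint_left]
    intro ω (h1 : 0 < walk B A 1 ω) (h2 : walk B A 1 ω < 0)
    exact lt_asymm h1 h2

theorem IsModel.norm_jointLST_le (hM : IsModel μ B A) {s₁ s₂ : ℂ} (h1 : 0 ≤ s₁.re)
    (h2 : 0 ≤ s₂.re) : ‖jointLST μ (B 0) (A 0) s₁ s₂‖ ≤ 1 := by
  have h := jointLST_eq_expoInt (μ := μ) (B := B) (A := A) (s₁ + s₂) s₁
  rw [add_sub_cancel_left] at h
  rw [h]
  exact (hM.isBddOn_strip h1 (by simpa using h2)).norm_expoInt_le.trans measureReal_le_one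

variable {h₁ h₂ : ℂ → ℂ[X]}

/-- At a zero of `h₂` the rational formula says nothing. As `h₂(·, s₂)` is not the zero polynomial,
`s₁` can be approached from the right through points where it does not vanish, and `h` is continuous
along this path. -/
theorem IsModel.eval_eq_mul_jointLST (hM : IsModel μ B A)
    (hrat : IsRationalInFirst (jointLST μ (B 0) (A 0)) h₁ h₂) {s₁ s₂ : ℂ} (hs₁ : 0 ≤ s₁.re)
    (hs₂ : 0 ≤ s₂.re) :
    (h₁ s₂).eval s₁ = (h₂ s₂).eval s₁ * jointLST μ (B 0) (A 0) s₁ s₂ := by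
  have hpath : Filter.Tendsto (fun ε : ℝ => s₁ + (ε : ℂ)) (nhdsWithin 0 (Set.Ioi 0))
      (nhds s₁) := by
    have hc : Continuous fun ε : ℝ => s₁ + (ε : ℂ) := by fun_prop
    simpa using (hc.tendsto 0).mono_left nhdsWithin_le_nhds
  have hJ : ∀ w, jointLST μ (B 0) (A 0) w s₂ = expoInt μ B A 1 Set.univ (w + s₂) w := by
    intro w
    rw [← jointLST_eq_expoInt, add_sub_cancel_left]
  have hlimJ : Filter.Tendsto (fun ε : ℝ => jointLST μ (B 0) (A 0) (s₁ + ε) s₂)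
      (nhdsWithin 0 (Set.Ioi 0)) (nhds (jointLST μ (B 0) (A 0) s₁ s₂)) := by
    simp only [hJ]
    refine hM.tendsto_expoInt_of_tendsto MeasurableSet.univ ?_ (hpath.add_const s₂) hpath
    filter_upwards [self_mem_nhdsWithin] with ε hε
    have hε' : (0 : ℝ) < ε := hε
    refine hM.isBddOn_strip ?_ ?_ <;> simp <;> linarith
  have hne : ∀ᶠ ε : ℝ in nhdsWithin 0 (Set.Ioi 0), (h₂ s₂).eval (s₁ + ε) ≠ 0 := by
    have hev : ∀ᶠ w in nhdsWithin s₁ {s₁}ᶜ, (h₂ s₂).eval w ≠ 0 := by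
      rcases ((h₂ s₂).differentiable.analyticAt s₁).eventually_eq_zero_or_eventually_ne_zero
        with h | h
      · have h2 := analyticOrderAt_eq_top.2 h
        rw [analyticOrderAt_eval (hrat.ne_zero s₂ hs₂)] at h2
        exact absurd h2 (ENat.natCast_ne_top _)
      · exact h
    have htd : Filter.Tendsto (fun ε : ℝ => s₁ + (ε : ℂ)) (nhdsWithin 0 (Set.Ioi 0))
        (nhdsWithin s₁ {s₁}ᶜ) := by
      refine tendsto_nhdsWithin_iff.2 ⟨hpath, ?_⟩
      filter_upwards [self_mem_nhdsWithin] with ε hε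
      have hε' : (0 : ℝ) < ε := hε
      simp [hε'.ne']
    exact htd.eventually hev
  have hl1 : Filter.Tendsto (fun ε : ℝ => (h₁ s₂).eval (s₁ + ε)) (nhdsWithin 0 (Set.Ioi 0))
      (nhds ((h₁ s₂).eval s₁)) := ((h₁ s₂).continuous.tendsto _).comp hpath
  have hl2 : Filter.Tendsto (fun ε : ℝ => (h₂ s₂).eval (s₁ + ε)) (nhdsWithin 0 (Set.Ioi 0))
      (nhds ((h₂ s₂).eval s₁)) := ((h₂ s₂).continuous.tendsto _).comp hpath
  refine tendsto_nhds_unique_of_eventuallyEq hl1 (hl2.mul hlimJ) ?_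
  filter_upwards [hne, self_mem_nhdsWithin] with ε hε hε0
  have hε' : (0 : ℝ) < ε := hε0
  rw [hrat.eq_div _ _ (by simp; linarith) hs₂ hε, mul_div_cancel₀ _ hε]

/-- Follows from `|h| ≤ 1`. It bounds `h₁` by `h₂` at the interpolation nodes, and it also makes
zeros of `h₂` in the right half-plane harmless, since `h₁` vanishes there to at least the same
order. -/
theorem IsModel.norm_eval_le (hM : IsModel μ B A)
    (hrat : IsRationalInFirst (jointLST μ (B 0) (A 0)) h₁ h₂) {s₁ s₂ : ℂ} (hs₁ : 0 ≤ s₁.re)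
    (hs₂ : 0 ≤ s₂.re) : ‖(h₁ s₂).eval s₁‖ ≤ ‖(h₂ s₂).eval s₁‖ := by
  rw [hM.eval_eq_mul_jointLST hrat hs₁ hs₂, norm_mul]
  exact mul_le_of_le_one_right (norm_nonneg _) (hM.norm_jointLST_le hs₁ hs₂)

end

/-! ### Uniform degree bounds -/

/-- Each real `τ` in `[1, 2]` has some degree bound, so a single bound `d` holds on a determining
set; every coefficient beyond `d` is holomorphic in `τ` and vanishes on that set. -/
theorem exists_degree_bound {h : ℂ → ℂ → ℂ} {h₁ h₂ : ℂ → ℂ[X]} (hrat : IsRationalInFirst h h₁ h₂) :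
    ∃ d : ℕ, ∀ τ : ℂ, 0 < τ.re → (h₁ τ).natDegree ≤ d ∧ (h₂ τ).natDegree ≤ d := by
  obtain ⟨d, hd⟩ := exists_determining_set
    (fun m => {x : ℝ | (h₁ x).natDegree ≤ m ∧ (h₂ x).natDegree ≤ m})
    (Filter.Eventually.of_forall fun x =>
      ⟨max (h₁ x).natDegree (h₂ x).natDegree, le_max_left _ _, le_max_right _ _⟩)
  refine ⟨d, fun τ hτ => ⟨?_, ?_⟩⟩
  · rw [Polynomial.natDegree_le_iff_coeff_eq_zero]
    intro k hk
    exact hd (fun s₂ => (h₁ s₂).coeff k) (hrat.holo₁ k)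
      (fun x hx _ => Polynomial.coeff_eq_zero_of_natDegree_lt (hx.1.trans_lt hk)) τ hτ
  · rw [Polynomial.natDegree_le_iff_coeff_eq_zero]
    intro k hk
    exact hd (fun s₂ => (h₂ s₂).coeff k) (hrat.holo₂ k)
      (fun x hx _ => Polynomial.coeff_eq_zero_of_natDegree_lt (hx.2.trans_lt hk)) τ hτ

/-! ### Regularity of `ξ ↦ p(ξ, s - ξ)` -/

section

variable {p : ℂ → ℂ[X]} {d : ℕ}

theorem antidiag_eq_sum (hd : ∀ τ : ℂ, 0 < τ.re → (p τ).natDegree ≤ d) {s ξ : ℂ}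
    (h : ξ.re < s.re) :
    antidiag p s ξ = ∑ k ∈ Finset.range (d + 1), (p (s - ξ)).coeff k * ξ ^ k := by
  rw [antidiag, Polynomial.eval_eq_sum_range' (n := d + 1)]
  exact Nat.lt_succ_iff.2 (hd _ (by simpa using h))

theorem analyticOnNhd_antidiag
    (hp : ∀ k : ℕ, DifferentiableOn ℂ (fun s₂ => (p s₂).coeff k) {s₂ : ℂ | 0 < s₂.re})
    (hd : ∀ τ : ℂ, 0 < τ.re → (p τ).natDegree ≤ d) (s : ℂ) :
    AnalyticOnNhd ℂ (antidiag p s) {ξ | ξ.re < s.re} := by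
  have ho : IsOpen {ξ : ℂ | ξ.re < s.re} := isOpen_lt Complex.continuous_re continuous_const
  refine DifferentiableOn.analyticOnNhd ?_ ho
  have h1 : DifferentiableOn ℂ
      (fun ξ => ∑ k ∈ Finset.range (d + 1), (p (s - ξ)).coeff k * ξ ^ k) {ξ | ξ.re < s.re} := by
    refine DifferentiableOn.fun_sum fun k _ => DifferentiableOn.mul ?_ (by fun_prop)
    exact (hp k).comp (f := fun ξ => s - ξ) (by fun_prop) fun ξ hξ => by
      have : ξ.re < s.re := hξ
      simpa using this
  exact h1.congr fun ξ hξ => antidiag_eq_sum hd hξ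

theorem tendsto_antidiag
    (hp : ∀ k : ℕ, DifferentiableOn ℂ (fun s₂ => (p s₂).coeff k) {s₂ : ℂ | 0 < s₂.re})
    (hd : ∀ τ : ℂ, 0 < τ.re → (p τ).natDegree ≤ d) {ι : Type*} {l : Filter ι} {s : ι → ℂ}
    {s₀ ξ : ℂ} (hs : Filter.Tendsto s l (nhds s₀)) (hξ : ξ.re < s₀.re) :
    Filter.Tendsto (fun i => antidiag p (s i) ξ) l (nhds (antidiag p s₀ ξ)) := by
  have ho : IsOpen {s : ℂ | ξ.re < s.re} := isOpen_lt continuous_const Complex.continuous_re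
  have ho' : IsOpen {s : ℂ | 0 < s.re} := isOpen_lt continuous_const Complex.continuous_re
  rw [antidiag_eq_sum hd hξ]
  have h1 : Filter.Tendsto (fun i => ∑ k ∈ Finset.range (d + 1), (p (s i - ξ)).coeff k * ξ ^ k) l
      (nhds (∑ k ∈ Finset.range (d + 1), (p (s₀ - ξ)).coeff k * ξ ^ k)) := by
    refine tendsto_finsetSum _ fun k _ => Filter.Tendsto.mul_const _ ?_
    have h2 : (s₀ - ξ) ∈ {s : ℂ | 0 < s.re} := by
      simpa using hξ
    exact (((hp k).continuousOn _ h2).continuousAt (ho'.mem_nhds h2)).tendsto.comp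
      (hs.sub_const ξ)
  refine h1.congr' ?_
  filter_upwards [hs.eventually (ho.mem_nhds hξ)] with i hi
  exact (antidiag_eq_sum hd hi).symm

end


/-! ### Rationality of the upward part for almost every real `s` in `[1, 2]` -/

theorem log_one_add_norm_le (τ : ℂ) : Real.log (1 + ‖τ‖) ≤ 2 * √(1 + ‖τ‖) := by
  refine (log_one_add_le_two_mul_sqrt (norm_nonneg τ)).trans ?_
  gcongr
  linarith

theorem one_le_sqrt_one_add_norm (τ : ℂ) : 1 ≤ √(1 + ‖τ‖) := by
  rw [Real.one_le_sqrt]; linarith [norm_nonneg τ]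

theorem exists_posLog_eval_le (q : ℂ[X]) (x : ℂ) :
    ∃ C : ℝ, 0 ≤ C ∧ ∀ τ : ℂ, Real.posLog ‖q.eval (x - τ)‖ ≤ C * √(1 + ‖τ‖) := by
  obtain ⟨C, hC, h⟩ := exists_norm_eval_le q
  set n := q.natDegree
  refine ⟨Real.posLog (C * (1 + ‖x‖) ^ n) + n * 2, by
    have := Real.posLog_nonneg (x := C * (1 + ‖x‖) ^ n); positivity, fun τ => ?_⟩
  have h1 : ‖q.eval (x - τ)‖ ≤ (C * (1 + ‖x‖) ^ n) * (1 + ‖τ‖) ^ n := by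
    refine (h _).trans ?_
    rw [mul_assoc, ← mul_pow]
    have h2 := norm_sub_le x τ
    have h3 : 1 + ‖x - τ‖ ≤ (1 + ‖x‖) * (1 + ‖τ‖) := by
      nlinarith [norm_nonneg x, norm_nonneg τ, mul_nonneg (norm_nonneg x) (norm_nonneg τ)]
    gcongr
  have h4 := (Real.posLog_le_posLog (norm_nonneg _) h1).trans Real.posLog_mul
  rw [Real.posLog_pow, Real.posLog_eq_log (x := 1 + ‖τ‖) (by
    rw [abs_of_nonneg (by positivity)]; linarith [norm_nonneg τ])] at h4
  have h5 := log_one_add_norm_le τ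
  have h6 : (n : ℝ) * Real.log (1 + ‖τ‖) ≤ n * (2 * √(1 + ‖τ‖)) := by gcongr
  have h7 : Real.posLog (C * (1 + ‖x‖) ^ n) ≤ Real.posLog (C * (1 + ‖x‖) ^ n) * √(1 + ‖τ‖) :=
    le_mul_of_one_le_right Real.posLog_nonneg (one_le_sqrt_one_add_norm τ)
  linarith

/-- The weight `11/4` is chosen between `5/2` and `3`: minus the `1/2` of the square root it still
exceeds the dimension two, while `11/4 - 2` is below one, as Phragmén–Lindelöf demands. -/
theorem lintegral_sqrt_mul_rpow_ne_top (C : ℝ) (hC : 0 ≤ C) :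
    ∫⁻ τ : ℂ, ENNReal.ofReal (C * √(1 + ‖τ‖)) * ENNReal.ofReal ((1 + ‖τ‖) ^ (-(11 / 4) : ℝ)) ≠ ⊤ := by
  have h1 : ∀ τ : ℂ, ENNReal.ofReal (C * √(1 + ‖τ‖)) *
      ENNReal.ofReal ((1 + ‖τ‖) ^ (-(11 / 4) : ℝ)) =
      ENNReal.ofReal C * ENNReal.ofReal ((1 + ‖τ‖) ^ (-(9 / 4) : ℝ)) := by
    intro τ
    have h0 : (0 : ℝ) < 1 + ‖τ‖ := by positivity
    rw [ENNReal.ofReal_mul hC, mul_assoc, ← ENNReal.ofReal_mul (by positivity), Real.sqrt_eq_rpow,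
      ← Real.rpow_add h0]
    norm_num
  simp_rw [h1]
  rw [lintegral_const_mul' _ _ ENNReal.ofReal_ne_top]
  refine ENNReal.mul_ne_top ENNReal.ofReal_ne_top (finite_integral_one_add_norm ?_).ne
  rw [Complex.finrank_real_complex]
  norm_num

section

variable {Ω : Type*} [MeasurableSpace Ω] {μ : Measure Ω} {B A : ℕ → Ω → ℝ}
  [IsProbabilityMeasure μ] {h₁ h₂ : ℂ → ℂ[X]}

/-- Nothing is known about the coefficients off the right half-plane; they are set to zero there so
that Fubini's theorem has measurable functions to work with. -/
theorem measurable_coeff_indicator {p : ℂ → ℂ[X]}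
    (hp : ∀ k : ℕ, DifferentiableOn ℂ (fun s₂ => (p s₂).coeff k) {s₂ : ℂ | 0 < s₂.re}) (k : ℕ) :
    Measurable ({s₂ : ℂ | 0 < s₂.re}.indicator fun s₂ => (p s₂).coeff k) := by
  classical
  have hm : MeasurableSet {s₂ : ℂ | 0 < s₂.re} :=
    measurableSet_lt measurable_const Complex.measurable_re
  rw [← Set.piecewise_eq_indicator]
  exact (hp k).continuousOn.measurable_piecewise continuousOn_const hm

/-- On almost every line the weighted area integral of `log⁺ |h₁ / h₂|` is finite. -/
theorem IsModel.ae_lintegral_posLog_lt_top (hM : IsModel μ B A)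
    (hrat : IsRationalInFirst (jointLST μ (B 0) (A 0)) h₁ h₂) :
    ∀ᵐ x : ℝ ∂(volume.restrict (Set.Icc (1 : ℝ) 2)),
      ∫⁻ τ in {τ : ℂ | 0 < τ.re}, ENNReal.ofReal
        (Real.posLog ‖(h₁ τ).eval ((x : ℂ) - τ) / (h₂ τ).eval ((x : ℂ) - τ)‖) *
          ENNReal.ofReal ((1 + ‖τ‖) ^ (-(11 / 4) : ℝ)) < ⊤ := by
  obtain ⟨d, hd⟩ := exists_degree_bound hrat
  obtain ⟨C, hC, hbound⟩ := exists_lintegral_posLog_ratio_le d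
  set V : Set ℂ := {τ : ℂ | 0 < τ.re} with hV
  have hVm : MeasurableSet V := measurableSet_lt measurable_const Complex.measurable_re
  set e : (ℂ → ℂ[X]) → ℝ × ℂ → ℂ := fun p y => ∑ k ∈ Finset.range (d + 1),
    V.indicator (fun τ => (p τ).coeff k) y.2 * ((y.1 : ℂ) - y.2) ^ k with he
  have hem : ∀ p : ℂ → ℂ[X], (∀ k : ℕ, DifferentiableOn ℂ (fun s₂ => (p s₂).coeff k) V) →
      Measurable (e p) := by
    intro p hp
    refine Finset.measurable_fun_sum _ fun k _ => ?_
    refine ((measurable_coeff_indicator hp k).comp measurable_snd).mul ?_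
    fun_prop
  have heq : ∀ p : ℂ → ℂ[X], (∀ τ : ℂ, 0 < τ.re → (p τ).natDegree ≤ d) → ∀ (x : ℝ) (τ : ℂ),
      τ ∈ V → (p τ).eval ((x : ℂ) - τ) = e p (x, τ) := by
    intro p hp x τ hτ
    simp only [he, Set.indicator_of_mem hτ]
    exact Polynomial.eval_eq_sum_range' (Nat.lt_succ_iff.2 (hp τ hτ)) _
  set F : ℝ → ℂ → ENNReal := fun x τ => ENNReal.ofReal (Real.posLog ‖e h₁ (x, τ) / e h₂ (x, τ)‖) *
    ENNReal.ofReal ((1 + ‖τ‖) ^ (-(11 / 4) : ℝ)) with hF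
  have hFm : Measurable (Function.uncurry F) := by
    have h1 : Measurable fun y : ℝ × ℂ => e h₁ y / e h₂ y :=
      (hem h₁ hrat.holo₁).div (hem h₂ hrat.holo₂)
    have h2 : Measurable fun y : ℝ × ℂ => Real.posLog ‖e h₁ y / e h₂ y‖ :=
      Real.continuous_posLog.measurable.comp h1.norm
    have h3 : Measurable fun y : ℝ × ℂ => (1 + ‖y.2‖) ^ (-(11 / 4) : ℝ) := by fun_prop
    exact h2.ennreal_ofReal.mul h3.ennreal_ofReal
  have hFeq : ∀ x : ℝ, ∫⁻ τ in V, ENNReal.ofReal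
        (Real.posLog ‖(h₁ τ).eval ((x : ℂ) - τ) / (h₂ τ).eval ((x : ℂ) - τ)‖) *
          ENNReal.ofReal ((1 + ‖τ‖) ^ (-(11 / 4) : ℝ)) = ∫⁻ τ in V, F x τ := by
    intro x
    refine setLIntegral_congr_fun hVm fun τ hτ => ?_
    simp only [hF]
    rw [← heq h₁ (fun τ hτ => (hd τ hτ).1) x τ hτ, ← heq h₂ (fun τ hτ => (hd τ hτ).2) x τ hτ]
  simp_rw [hFeq]
  refine ae_lt_top ?_ ?_
  · exact hFm.lintegral_prod_right'
  -- With the order exchanged, `τ` is fixed and the inner integral runs over `s = x`, where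
  -- numerator and denominator are genuine polynomials of degree at most `d`.
  · rw [lintegral_lintegral_swap hFm.aemeasurable]
    refine ne_top_of_le_ne_top (lintegral_sqrt_mul_rpow_ne_top C hC) ?_
    refine le_trans ?_ (setLIntegral_le_lintegral V _)
    refine setLIntegral_mono_ae' hVm (Filter.Eventually.of_forall fun τ hτ => ?_)
    simp only [hF]
    rw [lintegral_mul_const' _ _ ENNReal.ofReal_ne_top]
    refine mul_le_mul_left ?_ _
    have hτ' : 0 < τ.re := hτ
    refine le_trans (le_of_eq ?_) (hbound (h₁ τ) (h₂ τ) (hd τ hτ).1 (hd τ hτ).2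
      (fun k _ => hM.norm_eval_le hrat (by simp) hτ'.le) τ)
    refine lintegral_congr fun x => ?_
    rw [← heq h₁ (fun τ hτ => (hd τ hτ).1) x τ hτ, ← heq h₂ (fun τ hτ => (hd τ hτ).2) x τ hτ]

/-- After multiplication by the polynomial with the zeros of `h₂(ξ, s - ξ)` in the left half-plane,
the upward part of a step extends to an entire function. -/
theorem IsModel.exists_entire_extension (hM : IsModel μ B A)
    (hrat : IsRationalInFirst (jointLST μ (B 0) (A 0)) h₁ h₂) {s : ℂ} (hs : 0 < s.re)
    (hfin : {ξ : ℂ | ξ.re < 0 ∧ antidiag h₂ s ξ = 0}.Finite) :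
    ∃ q : ℂ[X], q ≠ 0 ∧ ∃ W : ℂ → ℂ, Differentiable ℂ W ∧
      (∀ ξ : ℂ, 0 < ξ.re → W ξ = q.eval ξ * stepUp μ B A s ξ) ∧
      ∀ ξ : ℂ, ξ.re < s.re → antidiag h₂ s ξ ≠ 0 →
        W ξ = q.eval ξ * (antidiag h₁ s ξ / antidiag h₂ s ξ - stepDown μ B A s ξ) := by
  obtain ⟨d, hd⟩ := exists_degree_bound hrat
  have hH₁ := analyticOnNhd_antidiag hrat.holo₁ (fun τ hτ => (hd τ hτ).1) s
  have hH₂ := analyticOnNhd_antidiag hrat.holo₂ (fun τ hτ => (hd τ hτ).2) s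
  set U : Set ℂ := {ξ : ℂ | ξ.re < s.re} with hU
  have hUo : IsOpen U := isOpen_lt Complex.continuous_re continuous_const
  have hne := order_ne_top_of_finite_zeros hs.le hH₂ hfin
  have hsub : {w : ℂ | w.re < 0} ⊆ U := fun w (hw : w.re < 0) => hw.trans hs
  obtain ⟨m, hm, hcount⟩ := exists_zero_multiset (hH₂.mono hsub) hfin
  set q : ℂ[X] := (m.map fun w => X - C w).prod with hq
  have hq0 : q ≠ 0 := (Polynomial.monic_multiset_prod_of_monic _ _
    fun w _ => Polynomial.monic_X_sub_C w).ne_zero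
  have hqroots : q.roots = m := Polynomial.roots_multiset_prod_X_sub_C m
  have hqan : AnalyticOnNhd ℂ (fun ξ => q.eval ξ) U := fun ξ _ => q.differentiable.analyticAt ξ
  have hqord : ∀ w, analyticOrderAt (fun ξ => q.eval ξ) w = m.count w := by
    intro w
    rw [analyticOrderAt_eval hq0, ← Polynomial.count_roots, hqroots]
  have hord : ∀ z ∈ U, analyticOrderAt (antidiag h₂ s) z ≤
      analyticOrderAt (fun ξ => q.eval ξ * antidiag h₁ s ξ) z := by
    intro z hz
    have hmul : analyticOrderAt (fun ξ => q.eval ξ * antidiag h₁ s ξ) z =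
        analyticOrderAt (fun ξ => q.eval ξ) z + analyticOrderAt (antidiag h₁ s) z :=
      analyticOrderAt_mul (hqan z hz) (hH₁ z hz)
    rw [hmul]
    rcases lt_or_ge z.re 0 with h0 | h0
    · rw [← hcount z h0, hqord]
      exact le_self_add
    -- Zeros of `h₂` with `Re z ≥ 0` are not recorded in `q`; there `|h₁| ≤ |h₂|` to the right of
    -- `z` shows that `h₁` cancels them.
    · refine le_trans (analyticOrderAt_le_of_norm_le (hH₁ z hz) (hH₂ z hz) ?_) le_add_self
      have hz' : z.re < s.re := hz
      have hlt : ∀ᶠ ε : ℝ in nhdsWithin 0 (Set.Ioi 0), ε < s.re - z.re :=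
        nhdsWithin_le_nhds (gt_mem_nhds (by linarith))
      filter_upwards [hlt, self_mem_nhdsWithin] with ε h1 h2
      have h3 : (0 : ℝ) < ε := h2
      refine hM.norm_eval_le hrat ?_ ?_ <;> simp <;> linarith
  obtain ⟨Q, hQ, hQmul⟩ := exists_analytic_quotient (hqan.mul hH₁) hH₂ hne hord
  have hdn := hM.differentiableOn_stepDown hs.le
  have hup := hM.differentiableOn_stepUp hs.le
  have hV : IsOpen {ξ : ℂ | 0 < ξ.re ∧ ξ.re < s.re} :=
    (isOpen_lt continuous_const Complex.continuous_re).inter hUo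
  -- The identity is first proved after multiplication by `h₂(ξ, s - ξ)`, which may have zeros in
  -- the strip.
  have hstrip : ∀ ξ ∈ {ξ : ℂ | 0 < ξ.re ∧ ξ.re < s.re},
      q.eval ξ * stepUp μ B A s ξ - (Q ξ - q.eval ξ * stepDown μ B A s ξ) = 0 := by
    refine eq_zero_of_mul_eq_zero hV ?_ (hH₂.mono fun ξ h => h.2) (fun z hz => hne z hz.2) ?_
    · have c1 := hup.continuousOn.mono (fun ξ (h : 0 < ξ.re ∧ ξ.re < s.re) => h.1)
      have c2 := hdn.continuousOn.mono (fun ξ (h : 0 < ξ.re ∧ ξ.re < s.re) => h.2)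
      have c3 := hQ.continuousOn.mono (fun ξ (h : 0 < ξ.re ∧ ξ.re < s.re) => h.2)
      have c4 : Continuous fun ξ => q.eval ξ := q.continuous
      exact (c4.continuousOn.mul c1).sub (c3.sub (c4.continuousOn.mul c2))
    · intro ξ hξ
      have e1 : antidiag h₁ s ξ = antidiag h₂ s ξ *
          (stepUp μ B A s ξ + stepDown μ B A s ξ) := by
        rw [← hM.jointLST_eq_add hξ.1.le hξ.2.le]
        exact hM.eval_eq_mul_jointLST hrat hξ.1.le (by simpa using hξ.2.le)
      have e2 : Q ξ * antidiag h₂ s ξ = q.eval ξ * antidiag h₁ s ξ := hQmul ξ hξ.2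
      rw [sub_mul, sub_mul, e2, e1]
      ring
  obtain ⟨W, hW, hWr, hWl⟩ := exists_entire_of_eqOn_strip hs
    (f := fun ξ => q.eval ξ * stepUp μ B A s ξ)
    (g := fun ξ => Q ξ - q.eval ξ * stepDown μ B A s ξ)
    (q.differentiable.differentiableOn.mul hup)
    (hQ.differentiableOn.sub (q.differentiable.differentiableOn.mul hdn))
    (fun ξ h1 h2 => sub_eq_zero.1 (hstrip ξ ⟨h1, h2⟩))
  refine ⟨q, hq0, W, hW, hWr, fun ξ hξ h0 => ?_⟩
  have e2 : Q ξ * antidiag h₂ s ξ = q.eval ξ * antidiag h₁ s ξ := hQmul ξ hξ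
  rw [hWl ξ hξ, mul_sub, ← mul_div_assoc, ← e2, mul_div_cancel_right₀ _ h0]

/-- For almost all real `s` in `[1, 2]` the upward part of a step is a rational function of `ξ`. -/
theorem IsModel.ae_stepUp_rational (hM : IsModel μ B A)
    (hrat : IsRationalInFirst (jointLST μ (B 0) (A 0)) h₁ h₂)
    (hfin : ∀ s : ℂ, 0 ≤ s.re → {ξ : ℂ | ξ.re < 0 ∧ antidiag h₂ s ξ = 0}.Finite) :
    ∀ᵐ x : ℝ ∂(volume.restrict (Set.Icc (1 : ℝ) 2)), ∃ q p : ℂ[X], q ≠ 0 ∧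
      ∀ ξ : ℂ, 0 < ξ.re → q.eval ξ * stepUp μ B A x ξ = p.eval ξ := by
  filter_upwards [hM.ae_lintegral_posLog_lt_top hrat, ae_restrict_mem measurableSet_Icc]
    with x hx hx12
  have hx0 : (0 : ℝ) < (x : ℂ).re := by
    rw [Complex.ofReal_re]; linarith [hx12.1]
  have hfinx := hfin x hx0.le
  obtain ⟨q, hq0, W, hW, hWr, hWl⟩ := hM.exists_entire_extension hrat hx0 hfinx
  obtain ⟨Cq, hCq, hqle⟩ := exists_norm_eval_le q
  obtain ⟨Cl, hCl, hqlog⟩ := exists_posLog_eval_le q x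
  have hright : ∀ ξ : ℂ, 0 ≤ ξ.re → ‖W ξ‖ ≤ ‖q.eval ξ‖ := by
    intro ξ hξ
    have hcl : closure {ξ : ℂ | 0 < ξ.re} = {ξ : ℂ | 0 ≤ ξ.re} :=
      Complex.closure_setOfPred_lt_re 0
    have hmem : ξ ∈ closure {ξ : ℂ | 0 < ξ.re} := by rw [hcl]; exact hξ
    refine le_on_closure (f := fun ξ => ‖W ξ‖) (g := fun ξ => ‖q.eval ξ‖) (fun ζ hζ => ?_)
      hW.continuous.norm.continuousOn q.continuous.norm.continuousOn hmem
    have hζ' : 0 < ζ.re := hζ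
    rw [hWr ζ hζ, norm_mul]
    exact mul_le_of_le_one_right (norm_nonneg _) (hM.norm_stepUp_le hx0.le hζ'.le)
  -- The substitution `τ = x - ξ` matches the variable in which the averaged estimate was obtained.
  set Φ : ℂ → ℂ := fun τ => W (x - τ) with hΦdef
  have hΦ : Differentiable ℂ Φ := hW.comp (by fun_prop)
  set V : Set ℂ := {τ : ℂ | 0 < τ.re} with hV
  have hVm : MeasurableSet V := measurableSet_lt measurable_const Complex.measurable_re
  set ψ : ℂ → ENNReal := fun τ => ENNReal.ofReal
        (Real.posLog ‖(h₁ τ).eval ((x : ℂ) - τ) / (h₂ τ).eval ((x : ℂ) - τ)‖) *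
          ENNReal.ofReal ((1 + ‖τ‖) ^ (-(11 / 4) : ℝ)) with hψ
  have hnull : ∀ᵐ τ : ℂ, τ ∉ (fun ξ : ℂ => (x : ℂ) - ξ) ''
      {ξ : ℂ | ξ.re < 0 ∧ antidiag h₂ x ξ = 0} := by
    rw [ae_iff]
    simp only [not_not]
    exact (hfinx.image _).measure_zero _
  have hpt : ∀ᵐ τ : ℂ, ENNReal.ofReal (Real.posLog ‖Φ τ‖ * (1 + ‖τ‖) ^ (-(11 / 4) : ℝ)) ≤
      ENNReal.ofReal ((Cl + Real.log 2) * √(1 + ‖τ‖)) *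
        ENNReal.ofReal ((1 + ‖τ‖) ^ (-(11 / 4) : ℝ)) + V.indicator ψ τ := by
    filter_upwards [hnull] with τ hτ
    have hlog2 : 0 ≤ Real.log 2 := Real.log_nonneg (by norm_num)
    have hs1 := one_le_sqrt_one_add_norm τ
    rw [ENNReal.ofReal_mul Real.posLog_nonneg]
    -- For `Re ξ ≥ 0` the function is bounded by `q` alone. For `Re ξ < 0` it is `q` times `h₁ / h₂`
    -- minus a term of modulus at most one.
    rcases le_or_gt 0 ((x : ℂ) - τ).re with h0 | h0
    · refine le_add_right (mul_le_mul_left (ENNReal.ofReal_le_ofReal ?_) _)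
      refine (Real.posLog_le_posLog (norm_nonneg _) (hright _ h0)).trans ((hqlog τ).trans ?_)
      rw [add_mul]
      have : 0 ≤ Real.log 2 * √(1 + ‖τ‖) := by positivity
      linarith
    · have hτV : τ ∈ V := by
        simp only [Complex.sub_re] at h0
        exact hx0.trans (by linarith)
      have hx1 : ((x : ℂ) - τ).re < (x : ℂ).re := h0.trans hx0
      have hne : antidiag h₂ x ((x : ℂ) - τ) ≠ 0 := fun h =>
        hτ ⟨(x : ℂ) - τ, ⟨h0, h⟩, by simp⟩
      rw [Set.indicator_of_mem hτV]
      simp only [hψ]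
      rw [← add_mul, ← ENNReal.ofReal_add (by positivity) Real.posLog_nonneg]
      refine mul_le_mul_left (ENNReal.ofReal_le_ofReal ?_) _
      have e1 := hWl _ hx1 hne
      simp only [antidiag, sub_sub_cancel] at e1
      set g := (h₁ τ).eval ((x : ℂ) - τ) / (h₂ τ).eval ((x : ℂ) - τ) with hg
      have h5 : ‖Φ τ‖ ≤ ‖q.eval ((x : ℂ) - τ)‖ * (‖g‖ + 1) := by
        simp only [hΦdef]
        rw [e1, norm_mul]
        refine mul_le_mul_of_nonneg_left ((norm_sub_le _ _).trans ?_) (norm_nonneg _)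
        exact add_le_add le_rfl (hM.norm_stepDown_le hx0.le hx1.le)
      have h6 : Real.posLog ‖Φ τ‖ ≤ Real.posLog ‖q.eval ((x : ℂ) - τ)‖ + Real.posLog (‖g‖ + 1) :=
        (Real.posLog_le_posLog (norm_nonneg _) h5).trans Real.posLog_mul
      have h7 : Real.posLog (‖g‖ + 1) ≤ Real.log 2 + Real.posLog ‖g‖ + Real.posLog 1 :=
        Real.posLog_add
      rw [Real.posLog_one] at h7
      have h8 : Real.log 2 ≤ Real.log 2 * √(1 + ‖τ‖) := le_mul_of_one_le_right hlog2 hs1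
      have h9 := hqlog τ
      rw [add_mul]
      linarith
  have hint : ∫⁻ τ, ENNReal.ofReal (Real.posLog ‖Φ τ‖ * (1 + ‖τ‖) ^ (-(11 / 4) : ℝ)) ≠ ⊤ := by
    refine ne_top_of_le_ne_top ?_ (lintegral_mono_ae hpt)
    rw [lintegral_add_left (by fun_prop), lintegral_indicator hVm]
    exact ENNReal.add_ne_top.2 ⟨lintegral_sqrt_mul_rpow_ne_top _
      (add_nonneg hCl (Real.log_nonneg (by norm_num))), hx.ne⟩
  obtain ⟨C, hC, hgrow⟩ := exists_posLog_growth hΦ (by norm_num) hint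
  have hgrowW : ∀ ξ, Real.posLog ‖W ξ‖ ≤ C * (1 + ‖(x : ℂ)‖) ^ (11 / 4 - 2 : ℝ) *
      (1 + ‖ξ‖) ^ (11 / 4 - 2 : ℝ) := by
    intro ξ
    have h1 := hgrow (x - ξ)
    simp only [hΦdef, sub_sub_cancel] at h1
    refine h1.trans ?_
    rw [mul_assoc, ← Real.mul_rpow (by positivity) (by positivity)]
    refine mul_le_mul_of_nonneg_left (Real.rpow_le_rpow (by positivity) ?_ (by norm_num)) hC
    nlinarith [norm_sub_le (x : ℂ) ξ, mul_nonneg (norm_nonneg (x : ℂ)) (norm_nonneg ξ)]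
  obtain ⟨C'', hC''⟩ := exists_growth_of_posLog_growth hW (m := q.natDegree) (C := Cq)
    (by norm_num) (by positivity) (fun z hz => (hright z hz).trans (hqle z)) hgrowW
  obtain ⟨p, -, hp⟩ := exists_polynomial_of_growth hW hC''
  exact ⟨q, p, hq0, fun ξ hξ => by rw [← hWr ξ hξ, hp]⟩

end


/-! ### The Wiener–Hopf factors -/

section

variable {Ω : Type*} [MeasurableSpace Ω] (μ : Measure Ω) (B A : ℕ → Ω → ℝ)

/-- The factor `1 - E[z^N exp(-s a_N - ξ S_N)]` of the strict descending ladder epoch `N`. -/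
def descFactor (z s ξ : ℂ) : ℂ := 1 - expoSeries μ B A (leave B A (Set.Ici 0)) z s ξ

/-- The factor `1 - E[z^M exp(-s a_M - ξ S_M)]` of the weak ascending ladder epoch `M`. -/
def ascFactor (z s ξ : ℂ) : ℂ := 1 - expoSeries μ B A (leave B A (Set.Iio 0)) z s ξ

/-- The series `∑ z^n E[exp(-s a_n - ξ S_n); n < N]`, the inverse of the ascending factor. -/
def ascSeries (z s ξ : ℂ) : ℂ := expoSeries μ B A (stay B A (Set.Ici 0)) z s ξ

/-- The series `∑ z^n E[exp(-s a_n - ξ S_n); n < M]`, the inverse of the descending factor. -/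
def descSeries (z s ξ : ℂ) : ℂ := expoSeries μ B A (stay B A (Set.Iio 0)) z s ξ

end

section

variable {Ω : Type*} {B A : ℕ → Ω → ℝ}

theorem walk_neg_of_leave {n : ℕ} {ω : Ω} (h : ω ∈ leave B A (Set.Ici 0) n) :
    walk B A n ω < 0 := by
  simpa using walk_notMem_of_leave h

theorem walk_nonneg_of_leave {n : ℕ} {ω : Ω} (h : ω ∈ leave B A (Set.Iio 0) n) :
    0 ≤ walk B A n ω := by
  simpa using walk_notMem_of_leave h

theorem walk_nonneg_of_stay {n : ℕ} {ω : Ω} (h : ω ∈ stay B A (Set.Ici 0) n) :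
    0 ≤ walk B A n ω := walk_mem_of_stay (C := Set.Ici 0) Set.self_mem_Ici h

theorem walk_nonpos_of_stay {n : ℕ} {ω : Ω} (h : ω ∈ stay B A (Set.Iio 0) n) :
    walk B A n ω ≤ 0 := by
  rcases Nat.eq_zero_or_pos n with rfl | hn
  · rw [walk_zero]
  · exact le_of_lt (h n hn le_rfl)

end

section

variable {Ω : Type*} [MeasurableSpace Ω] {μ : Measure Ω} {B A : ℕ → Ω → ℝ}

theorem IsModel.bdd_desc (hM : IsModel μ B A) {s ξ : ℂ} (hs : 0 ≤ s.re) (hξ : ξ.re ≤ s.re) (n : ℕ) :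
    IsBddOn μ B A n (leave B A (Set.Ici 0) n) s ξ :=
  hM.isBddOn_left (fun _ h => (walk_neg_of_leave h).le) hs hξ

theorem IsModel.bdd_asc (hM : IsModel μ B A) {s ξ : ℂ} (hs : 0 ≤ s.re) (hξ : 0 ≤ ξ.re) (n : ℕ) :
    IsBddOn μ B A n (leave B A (Set.Iio 0) n) s ξ :=
  hM.isBddOn_right (fun _ h => walk_nonneg_of_leave h) hs hξ

theorem IsModel.bdd_ascSeries (hM : IsModel μ B A) {s ξ : ℂ} (hs : 0 ≤ s.re) (hξ : 0 ≤ ξ.re)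
    (n : ℕ) : IsBddOn μ B A n (stay B A (Set.Ici 0) n) s ξ :=
  hM.isBddOn_right (fun _ h => walk_nonneg_of_stay h) hs hξ

theorem IsModel.bdd_descSeries (hM : IsModel μ B A) {s ξ : ℂ} (hs : 0 ≤ s.re) (hξ : ξ.re ≤ s.re)
    (n : ℕ) : IsBddOn μ B A n (stay B A (Set.Iio 0) n) s ξ :=
  hM.isBddOn_left (fun _ h => walk_nonpos_of_stay h) hs hξ

variable [IsProbabilityMeasure μ]

theorem IsModel.norm_leave_le (hM : IsModel μ B A) {C : Set ℝ} (hC : MeasurableSet C) {z s ξ : ℂ}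
    (hz : ‖z‖ ≤ 1) (hb : ∀ n, IsBddOn μ B A n (leave B A C n) s ξ) :
    ‖expoSeries μ B A (leave B A C) z s ξ‖ ≤ 1 := by
  have h1 := hM.summable_leave hC
  have h2 := hM.summable_pow_leave hC (norm_nonneg z) hz
  refine (norm_expoSeries_le h2 hb).trans (le_trans ?_ h1.2)
  exact h2.tsum_le_tsum
    (fun n => mul_le_of_le_one_left measureReal_nonneg (pow_le_one₀ (norm_nonneg z) hz)) h1.1

theorem IsModel.norm_descFactor_le (hM : IsModel μ B A) {z s ξ : ℂ}
    (hz : ‖z‖ ≤ 1) (hs : 0 ≤ s.re) (hξ : ξ.re ≤ s.re) : ‖descFactor μ B A z s ξ‖ ≤ 2 := by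
  have h := hM.norm_leave_le measurableSet_Ici hz (hM.bdd_desc hs hξ)
  refine (norm_sub_le _ _).trans ?_
  rw [norm_one]
  linarith

theorem IsModel.norm_ascFactor_le (hM : IsModel μ B A) {z s ξ : ℂ}
    (hz : ‖z‖ ≤ 1) (hs : 0 ≤ s.re) (hξ : 0 ≤ ξ.re) : ‖ascFactor μ B A z s ξ‖ ≤ 2 := by
  have h := hM.norm_leave_le measurableSet_Iio hz (hM.bdd_asc hs hξ)
  refine (norm_sub_le _ _).trans ?_
  rw [norm_one]
  linarith

theorem IsModel.differentiableOn_descFactor (hM : IsModel μ B A) {z s : ℂ} (hz : ‖z‖ ≤ 1)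
    (hs : 0 ≤ s.re) : DifferentiableOn ℂ (descFactor μ B A z s) {ξ | ξ.re < s.re} :=
  (hM.differentiableOn_expoSeries (fun n => hM.measurableSet_leave measurableSet_Ici n)
    (isOpen_lt Complex.continuous_re continuous_const)
    (hM.summable_pow_leave measurableSet_Ici (norm_nonneg z) hz)
    (fun _ hξ n => hM.bdd_desc hs (le_of_lt hξ) n)).const_sub 1

theorem IsModel.differentiableOn_ascFactor (hM : IsModel μ B A) {z s : ℂ} (hz : ‖z‖ ≤ 1)
    (hs : 0 ≤ s.re) : DifferentiableOn ℂ (ascFactor μ B A z s) {ξ | 0 < ξ.re} :=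
  (hM.differentiableOn_expoSeries (fun n => hM.measurableSet_leave measurableSet_Iio n)
    (isOpen_lt continuous_const Complex.continuous_re)
    (hM.summable_pow_leave measurableSet_Iio (norm_nonneg z) hz)
    (fun _ hξ n => hM.bdd_asc hs (le_of_lt hξ) n)).const_sub 1

theorem IsModel.differentiableOn_ascSeries (hM : IsModel μ B A) {z s : ℂ} (hz : ‖z‖ < 1)
    (hs : 0 ≤ s.re) : DifferentiableOn ℂ (ascSeries μ B A z s) {ξ | 0 < ξ.re} :=
  hM.differentiableOn_expoSeries (fun n => hM.measurableSet_stay measurableSet_Ici n)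
    (isOpen_lt continuous_const Complex.continuous_re) (summable_stay _ hz)
    (fun _ hξ n => hM.bdd_ascSeries hs (le_of_lt hξ) n)

theorem IsModel.differentiableOn_descSeries (hM : IsModel μ B A) {z s : ℂ} (hz : ‖z‖ < 1)
    (hs : 0 ≤ s.re) : DifferentiableOn ℂ (descSeries μ B A z s) {ξ | ξ.re < s.re} :=
  hM.differentiableOn_expoSeries (fun n => hM.measurableSet_stay measurableSet_Iio n)
    (isOpen_lt Complex.continuous_re continuous_const) (summable_stay _ hz)
    (fun _ hξ n => hM.bdd_descSeries hs (le_of_lt hξ) n)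

theorem tendsto_neg_natCast_mul {a : ℝ} (ha : a < 0) :
    Filter.Tendsto (fun k : ℕ => (-(k : ℂ)).re * a) Filter.atTop Filter.atTop := by
  have h : (fun k : ℕ => (-(k : ℂ)).re * a) = fun k : ℕ => (k : ℝ) * (-a) := by
    funext k
    simp
  rw [h]
  exact tendsto_natCast_atTop_atTop.atTop_mul_const (by linarith)

theorem neg_natCast_re_le (k : ℕ) : (-(k : ℂ)).re ≤ 0 := by simp

/-- Far to the left every exit term dies, because the walk is strictly negative at `N`. In the
companion limit for `descSeries` only the term `n = 0` survives, the walk being negative at all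
later times involved. -/
theorem IsModel.tendsto_descFactor (hM : IsModel μ B A) {z s : ℂ} (hz : ‖z‖ ≤ 1)
    (hs : 0 ≤ s.re) :
    Filter.Tendsto (fun k : ℕ => descFactor μ B A z s (-(k : ℂ))) Filter.atTop (nhds 1) := by
  have hb : ∀ᶠ k : ℕ in Filter.atTop, ∀ n,
      IsBddOn μ B A n (leave B A (Set.Ici 0) n) s (-(k : ℂ)) :=
    Filter.Eventually.of_forall fun k n => hM.bdd_desc hs ((neg_natCast_re_le k).trans hs) n
  have h := tendsto_expoSeries (z := fun _ : ℕ => z) (s := fun _ => s) (z₀ := z)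
    (c := fun _ => 0) tendsto_const_nhds (Filter.Eventually.of_forall fun _ => le_refl ‖z‖)
    (hM.summable_pow_leave measurableSet_Ici (norm_nonneg z) hz) hb fun n =>
    hM.tendsto_expoInt_zero (hM.measurableSet_leave measurableSet_Ici n) (hb.mono fun _ h => h n)
      (Filter.Eventually.of_forall fun ω hω => tendsto_neg_natCast_mul (walk_neg_of_leave hω))
  simp only [mul_zero, tsum_zero] at h
  simpa [descFactor] using h.const_sub 1

theorem IsModel.tendsto_descSeries (hM : IsModel μ B A) {z s : ℂ} (hz : ‖z‖ < 1)
    (hs : 0 ≤ s.re) :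
    Filter.Tendsto (fun k : ℕ => descSeries μ B A z s (-(k : ℂ))) Filter.atTop (nhds 1) := by
  have hb : ∀ᶠ k : ℕ in Filter.atTop, ∀ n,
      IsBddOn μ B A n (stay B A (Set.Iio 0) n) s (-(k : ℂ)) :=
    Filter.Eventually.of_forall fun k n => hM.bdd_descSeries hs ((neg_natCast_re_le k).trans hs) n
  have h := tendsto_expoSeries (z := fun _ : ℕ => z) (s := fun _ => s) (z₀ := z)
    (c := fun n => if n = 0 then 1 else 0) tendsto_const_nhds
    (Filter.Eventually.of_forall fun _ => le_refl ‖z‖)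
    (summable_stay _ hz) hb fun n => by
      split_ifs with hn
      · subst hn
        have h1 : ∀ ξ, expoInt μ B A 0 (stay B A (Set.Iio 0) 0) s ξ = 1 := by
          intro ξ
          simp [expoInt, stay_zero, expo, partialSum, walk]
        simp only [h1]
        exact tendsto_const_nhds
      · refine hM.tendsto_expoInt_zero (hM.measurableSet_stay measurableSet_Iio n)
          (hb.mono fun _ h => h n) (Filter.Eventually.of_forall fun ω hω => ?_)
        exact tendsto_neg_natCast_mul (hω n (Nat.pos_of_ne_zero hn) le_rfl)
  rw [tsum_eq_single 0 (fun n hn => by simp [hn])] at h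
  simpa [descSeries] using h

theorem IsModel.descFactor_eq (hM : IsModel μ B A) {z s ξ : ℂ} (hz : ‖z‖ < 1) (h0 : 0 ≤ ξ.re)
    (hξ : ξ.re ≤ s.re) : descFactor μ B A z s ξ =
      ascSeries μ B A z s ξ * (1 - z * jointLST μ (B 0) (A 0) ξ (s - ξ)) :=
  hM.one_sub_leave_eq measurableSet_Ici hz h0 hξ

theorem IsModel.ascFactor_eq (hM : IsModel μ B A) {z s ξ : ℂ} (hz : ‖z‖ < 1) (h0 : 0 ≤ ξ.re)
    (hξ : ξ.re ≤ s.re) : ascFactor μ B A z s ξ =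
      descSeries μ B A z s ξ * (1 - z * jointLST μ (B 0) (A 0) ξ (s - ξ)) :=
  hM.one_sub_leave_eq measurableSet_Iio hz h0 hξ

/-- On the strip both products equal `ascSeries * descSeries * (1 - z h)`. One is bounded and
holomorphic to the right and the other to the left, so they glue to a bounded entire function; this
is constant, and its limit along the negative integers is one. -/
theorem IsModel.descSeries_mul_descFactor (hM : IsModel μ B A) {z s : ℂ} (hz : ‖z‖ < 1)
    (hs : 0 < s.re) :
    (∀ ξ : ℂ, ξ.re < s.re → descSeries μ B A z s ξ * descFactor μ B A z s ξ = 1) ∧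
      ∀ ξ : ℂ, 0 ≤ ξ.re → ascFactor μ B A z s ξ * ascSeries μ B A z s ξ = 1 := by
  have hstrip : ∀ ξ : ℂ, 0 ≤ ξ.re → ξ.re ≤ s.re →
      ascFactor μ B A z s ξ * ascSeries μ B A z s ξ =
        descSeries μ B A z s ξ * descFactor μ B A z s ξ := by
    intro ξ h0 h1
    rw [hM.ascFactor_eq hz h0 h1, hM.descFactor_eq hz h0 h1]
    ring
  obtain ⟨W, hW, hWr, hWl⟩ := exists_entire_of_eqOn_strip hs
    ((hM.differentiableOn_ascFactor hz.le hs.le).mul (hM.differentiableOn_ascSeries hz hs.le))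
    ((hM.differentiableOn_descSeries hz hs.le).mul (hM.differentiableOn_descFactor hz.le hs.le))
    fun ξ h0 h1 => hstrip ξ h0.le h1.le
  simp only [Pi.mul_apply] at hWr hWl
  have hbdd : Bornology.IsBounded (Set.range W) := by
    refine (Metric.isBounded_iff_subset_closedBall 0).2
      ⟨max (2 * ∑' n, ‖z‖ ^ n * μ.real (stay B A (Set.Ici 0) n))
        ((∑' n, ‖z‖ ^ n * μ.real (stay B A (Set.Iio 0) n)) * 2), ?_⟩
    rintro _ ⟨ξ, rfl⟩
    rw [mem_closedBall_zero_iff]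
    rcases lt_or_ge 0 ξ.re with h0 | h0
    · refine le_trans ?_ (le_max_left _ _)
      rw [hWr ξ h0, norm_mul]
      exact mul_le_mul (hM.norm_ascFactor_le hz.le hs.le h0.le)
        (norm_expoSeries_le (summable_stay _ hz) (hM.bdd_ascSeries hs.le h0.le))
        (norm_nonneg _) (by norm_num)
    · refine le_trans ?_ (le_max_right _ _)
      rw [hWl ξ (h0.trans_lt hs), norm_mul]
      exact mul_le_mul
        (norm_expoSeries_le (summable_stay _ hz) (hM.bdd_descSeries hs.le (h0.trans hs.le)))
        (hM.norm_descFactor_le hz.le hs.le (h0.trans hs.le))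
        (norm_nonneg _) (tsum_nonneg fun n => by positivity)
  have hconst : ∀ ξ, W ξ = W 0 := fun ξ => hW.apply_eq_apply_of_bounded hbdd ξ 0
  have hlim : Filter.Tendsto (fun k : ℕ => W (-(k : ℂ))) Filter.atTop (nhds (1 * 1)) := by
    refine ((hM.tendsto_descSeries hz hs.le).mul (hM.tendsto_descFactor hz.le hs.le)).congr ?_
    intro k
    exact (hWl _ ((neg_natCast_re_le k).trans_lt hs)).symm
  have hW1 : W 0 = 1 := by
    rw [mul_one] at hlim
    refine tendsto_nhds_unique (tendsto_const_nhds (f := Filter.atTop (α := ℕ))) (hlim.congr ?_)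
    exact fun k => hconst _
  have hleft : ∀ ξ : ℂ, ξ.re < s.re →
      descSeries μ B A z s ξ * descFactor μ B A z s ξ = 1 := fun ξ hξ => by
    rw [← hWl ξ hξ, hconst, hW1]
  refine ⟨hleft, fun ξ hξ => ?_⟩
  rcases lt_or_ge 0 ξ.re with h0 | h0
  · rw [← hWr ξ h0, hconst, hW1]
  · rw [hstrip ξ hξ (h0.trans hs.le), hleft ξ (h0.trans_lt hs)]

/-- The descending factor has no zeros in the left half-plane. -/
theorem IsModel.descFactor_ne_zero (hM : IsModel μ B A) {z s ξ : ℂ} (hz : ‖z‖ ≤ 1)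
    (hs : 0 ≤ s.re) (hξ : ξ.re < 0) : descFactor μ B A z s ξ ≠ 0 := by
  set E := leave B A (Set.Ici 0) with hE
  have hEm : ∀ n, MeasurableSet (E n) := fun n => hM.measurableSet_leave measurableSet_Ici n
  set δ : ℝ := -ξ.re with hδ
  have hδ0 : 0 < δ := by linarith
  set u : ℕ → ℝ := fun n => ∫ ω in E n, Real.exp (δ * walk B A n ω) ∂μ with hu
  have hexpm : ∀ n, Measurable fun ω => Real.exp (δ * walk B A n ω) := fun n =>
    Real.measurable_exp.comp ((hM.measurable_walk n).const_mul δ)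
  have hexple : ∀ n, ∀ ω ∈ E n, Real.exp (δ * walk B A n ω) < 1 := fun n ω hω => by
    rw [Real.exp_lt_one_iff]
    exact mul_neg_of_pos_of_neg hδ0 (walk_neg_of_leave hω)
  have hint : ∀ n, IntegrableOn (fun ω => Real.exp (δ * walk B A n ω)) (E n) μ := fun n => by
    refine Integrable.of_bound (hexpm n).aestronglyMeasurable 1 ?_
    filter_upwards [ae_restrict_mem (hEm n)] with ω hω
    rw [Real.norm_eq_abs, abs_of_pos (Real.exp_pos _)]
    exact (hexple n ω hω).le
  have hu0 : ∀ n, 0 ≤ u n := fun n => integral_nonneg fun ω => (Real.exp_pos _).le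
  have hone : ∀ n, ∫ _ω in E n, (1 : ℝ) ∂μ = μ.real (E n) := fun n => by simp
  have hule : ∀ n, u n ≤ μ.real (E n) := fun n => by
    rw [← hone n]
    exact setIntegral_mono_on (hint n) (integrable_const 1).integrableOn (hEm n)
      fun ω hω => (hexple n ω hω).le
  -- Strictness comes from `S_n < 0` on the exit event: an exponential that is below one there has
  -- the same integral as one only if the event is null.
  have hult : ∀ n, μ.real (E n) ≠ 0 → u n < μ.real (E n) := fun n hn => by
    refine lt_of_le_of_ne (hule n) fun heq => hn ?_
    have h1 : ∫ ω in E n, (1 - Real.exp (δ * walk B A n ω)) ∂μ = 0 := by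
      rw [integral_sub (integrable_const 1) (hint n), hone]
      exact sub_eq_zero.2 heq.symm
    have h2 : (fun ω => 1 - Real.exp (δ * walk B A n ω)) =ᵐ[μ.restrict (E n)] 0 := by
      refine (integral_eq_zero_iff_of_nonneg_ae ?_ ((integrable_const 1).sub (hint n))).1 h1
      filter_upwards [ae_restrict_mem (hEm n)] with ω hω
      exact sub_nonneg.2 (hexple n ω hω).le
    have h3 : ∀ᵐ ω ∂(μ.restrict (E n)), False := by
      filter_upwards [h2, ae_restrict_mem (hEm n)] with ω h4 hω
      have := hexple n ω hω
      simp only [Pi.zero_apply] at h4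
      linarith
    rw [Filter.eventually_false_iff_eq_bot, ae_eq_bot, Measure.restrict_eq_zero] at h3
    simp [Measure.real, h3]
  have hsum := hM.summable_leave (C := Set.Ici 0) measurableSet_Ici
  have husum : Summable u := Summable.of_nonneg_of_le hu0 hule hsum.1
  have hlt : ∑' n, u n < 1 := by
    by_cases hall : ∀ n, μ.real (E n) = 0
    · have : ∀ n, u n = 0 := fun n => le_antisymm ((hule n).trans (hall n).le) (hu0 n)
      simp [this]
    · push Not at hall
      obtain ⟨n, hn⟩ := hall
      exact (Summable.tsum_lt_tsum (i := n) hule (hult n hn) husum hsum.1).trans_le hsum.2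
  have hnorm : ‖expoSeries μ B A E z s ξ‖ ≤ ∑' n, u n := by
    refine tsum_of_norm_bounded husum.hasSum fun n => ?_
    rw [norm_mul, norm_pow]
    refine (mul_le_of_le_one_left (norm_nonneg _) (pow_le_one₀ (norm_nonneg z) hz)).trans ?_
    refine (norm_integral_le_integral_norm _).trans ?_
    refine integral_mono_of_nonneg (Filter.Eventually.of_forall fun _ => norm_nonneg _) (hint n) ?_
    filter_upwards [ae_restrict_mem (hEm n), ae_restrict_of_ae hM.ae_partialSum_nonneg]
      with ω hω hps
    rw [norm_expo]
    apply Real.exp_le_exp.2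
    have := mul_nonneg hs (hps n).2
    rw [hδ]
    linarith
  intro h0
  have h1 : expoSeries μ B A E z s ξ = 1 := (sub_eq_zero.1 h0).symm
  rw [h1, norm_one] at hnorm
  linarith

/-! ### Limits of the factors in the parameters -/

variable {z s : ℂ} {zs ss : ℕ → ℂ}

theorem IsModel.tendsto_ascFactor_param (hM : IsModel μ B A) (hz : ∀ k, ‖zs k‖ ≤ 1)
    (hs : ∀ k, 0 ≤ (ss k).re) (hzt : Filter.Tendsto zs Filter.atTop (nhds z))
    (hst : Filter.Tendsto ss Filter.atTop (nhds s)) {ξs : ℕ → ℂ} {ξ : ℂ}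
    (hξt : Filter.Tendsto ξs Filter.atTop (nhds ξ)) (hξ : ∀ k, 0 ≤ (ξs k).re) :
    Filter.Tendsto (fun k => ascFactor μ B A (zs k) (ss k) (ξs k)) Filter.atTop
      (nhds (ascFactor μ B A z s ξ)) := by
  refine Filter.Tendsto.const_sub 1 ?_
  exact hM.tendsto_expoSeries_of_tendsto (ρ := 1)
    (fun n => hM.measurableSet_leave measurableSet_Iio n) hzt (Filter.Eventually.of_forall hz) hst
    hξt (hM.summable_pow_leave measurableSet_Iio zero_le_one le_rfl)
    (Filter.Eventually.of_forall fun k n => hM.bdd_asc (hs k) (hξ k) n)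

theorem IsModel.tendsto_descFactor_param (hM : IsModel μ B A) (hz : ∀ k, ‖zs k‖ ≤ 1)
    (hs : ∀ k, 0 ≤ (ss k).re) (hzt : Filter.Tendsto zs Filter.atTop (nhds z))
    (hst : Filter.Tendsto ss Filter.atTop (nhds s)) {ξs : ℕ → ℂ} {ξ : ℂ}
    (hξt : Filter.Tendsto ξs Filter.atTop (nhds ξ)) (hξ : ∀ k, (ξs k).re ≤ (ss k).re) :
    Filter.Tendsto (fun k => descFactor μ B A (zs k) (ss k) (ξs k)) Filter.atTop
      (nhds (descFactor μ B A z s ξ)) := by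
  refine Filter.Tendsto.const_sub 1 ?_
  exact hM.tendsto_expoSeries_of_tendsto (ρ := 1)
    (fun n => hM.measurableSet_leave measurableSet_Ici n) hzt (Filter.Eventually.of_forall hz) hst
    hξt (hM.summable_pow_leave measurableSet_Ici zero_le_one le_rfl)
    (Filter.Eventually.of_forall fun k n => hM.bdd_desc (hs k) (hξ k) n)

/-- Interior parameters converging to given boundary ones. -/
theorem exists_param_seq (hz : ‖z‖ ≤ 1) (hs : 0 ≤ s.re) : ∃ zs ss : ℕ → ℂ,
    (∀ k, ‖zs k‖ < 1 ∧ ‖zs k‖ ≤ ‖z‖) ∧ (∀ k, 0 < (ss k).re) ∧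
    Filter.Tendsto zs Filter.atTop (nhds z) ∧ Filter.Tendsto ss Filter.atTop (nhds s) := by
  have h1 : Filter.Tendsto (fun k : ℕ => 1 / ((k : ℝ) + 1)) Filter.atTop (nhds 0) :=
    tendsto_one_div_add_atTop_nhds_zero_nat
  have h1c : Filter.Tendsto (fun k : ℕ => ((1 / ((k : ℝ) + 1) : ℝ) : ℂ)) Filter.atTop
      (nhds ((0 : ℝ) : ℂ)) := (Complex.continuous_ofReal.tendsto 0).comp h1
  have hpos : ∀ k : ℕ, 0 < 1 / ((k : ℝ) + 1) := fun k => by positivity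
  have hle : ∀ k : ℕ, 1 / ((k : ℝ) + 1) ≤ 1 := fun k => by
    rw [div_le_one (by positivity)]
    linarith [Nat.cast_nonneg (α := ℝ) k]
  refine ⟨fun k => ((1 - 1 / ((k : ℝ) + 1) : ℝ) : ℂ) * z,
    fun k => s + ((1 / ((k : ℝ) + 1) : ℝ) : ℂ), fun k => ?_, fun k => ?_, ?_, ?_⟩
  · have h2 : ‖((1 - 1 / ((k : ℝ) + 1) : ℝ) : ℂ) * z‖ = (1 - 1 / ((k : ℝ) + 1)) * ‖z‖ := by
      rw [norm_mul, Complex.norm_real, Real.norm_eq_abs, abs_of_nonneg (by linarith [hle k])]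
    rw [h2]
    have h3 := hpos k
    have h4 := hle k
    have h5 := norm_nonneg z
    constructor <;> nlinarith
  · rw [Complex.add_re, Complex.ofReal_re]
    linarith [hpos k]
  · have h6 : Filter.Tendsto (fun k : ℕ => ((1 - 1 / ((k : ℝ) + 1) : ℝ) : ℂ) * z) Filter.atTop
        (nhds (((1 - 0 : ℝ) : ℂ) * z)) :=
      ((Complex.continuous_ofReal.tendsto _).comp (h1.const_sub 1)).mul_const z
    simpa using h6
  · simpa using h1c.const_add s

/-- The ascending factor does not vanish if the expected number of steps, discounted by `|z|`, is
finite. -/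
theorem IsModel.ascFactor_ne_zero (hM : IsModel μ B A) (hz : ‖z‖ ≤ 1) (hs : 0 ≤ s.re)
    (hsum : Summable fun n => ‖z‖ ^ n * μ.real (stay B A (Set.Ici 0) n)) {ξ : ℂ}
    (hξ : 0 ≤ ξ.re) : ascFactor μ B A z s ξ ≠ 0 := by
  obtain ⟨zs, ss, hzs, hss, hzt, hst⟩ := exists_param_seq hz hs
  set κ := ∑' n, ‖z‖ ^ n * μ.real (stay B A (Set.Ici 0) n) with hκ
  -- At interior parameters `ascSeries` is an exact inverse of norm at most `κ`. The resulting lower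
  -- bound for the factor survives the passage to the boundary, where no inverse is available yet.
  have hlow : ∀ k, 1 ≤ ‖ascFactor μ B A (zs k) (ss k) ξ‖ * κ := by
    intro k
    have h1 := (hM.descSeries_mul_descFactor (hzs k).1 (hss k)).2 ξ hξ
    have h2 : ‖ascSeries μ B A (zs k) (ss k) ξ‖ ≤ κ := by
      refine (norm_expoSeries_le (summable_stay _ (hzs k).1)
        (hM.bdd_ascSeries (hss k).le hξ)).trans ?_
      refine (summable_stay _ (hzs k).1).tsum_le_tsum (fun n => ?_) hsum
      exact mul_le_mul_of_nonneg_right (pow_le_pow_left₀ (norm_nonneg _) (hzs k).2 n)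
        measureReal_nonneg
    calc (1 : ℝ) = ‖ascFactor μ B A (zs k) (ss k) ξ * ascSeries μ B A (zs k) (ss k) ξ‖ := by
          rw [h1, norm_one]
      _ ≤ _ := by
          rw [norm_mul]
          exact mul_le_mul_of_nonneg_left h2 (norm_nonneg _)
  have hlim := ((hM.tendsto_ascFactor_param (fun k => (hzs k).1.le) (fun k => (hss k).le) hzt hst
    (tendsto_const_nhds (x := ξ)) (fun _ => hξ)).norm).mul_const κ
  have h3 := ge_of_tendsto' hlim hlow
  intro h0
  rw [h0, norm_zero, zero_mul] at h3
  linarith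

/-- The Wiener–Hopf factorization at `ξ = s`. -/
theorem IsModel.descFactor_mul_ascFactor (hM : IsModel μ B A) (hz : ‖z‖ ≤ 1) (hs : 0 ≤ s.re) :
    descFactor μ B A z s s * ascFactor μ B A z s s = 1 - z * jointLST μ (B 0) (A 0) s 0 := by
  obtain ⟨zs, ss, hzs, hss, hzt, hst⟩ := exists_param_seq hz hs
  have hlim := (hM.tendsto_descFactor_param (fun k => (hzs k).1.le) (fun k => (hss k).le) hzt hst
    hst (fun _ => le_rfl)).mul (hM.tendsto_ascFactor_param (fun k => (hzs k).1.le)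
    (fun k => (hss k).le) hzt hst hst (fun k => (hss k).le))
  have hJ : ∀ w, jointLST μ (B 0) (A 0) w 0 = expoInt μ B A 1 Set.univ w w := by
    intro w
    rw [← jointLST_eq_expoInt, sub_self]
  have hJlim : Filter.Tendsto (fun k => 1 - zs k * jointLST μ (B 0) (A 0) (ss k) 0) Filter.atTop
      (nhds (1 - z * jointLST μ (B 0) (A 0) s 0)) := by
    simp only [hJ]
    refine Filter.Tendsto.const_sub 1 (hzt.mul ?_)
    exact hM.tendsto_expoInt_of_tendsto MeasurableSet.univ
      (Filter.Eventually.of_forall fun k => hM.isBddOn_strip (hss k).le le_rfl) hst hst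
  refine tendsto_nhds_unique hlim (hJlim.congr fun k => ?_)
  have h1 := hM.descFactor_eq (hzs k).1 (hss k).le (le_refl (ss k).re)
  have h2 := (hM.descSeries_mul_descFactor (hzs k).1 (hss k)).2 (ss k) (hss k).le
  rw [sub_self] at h1
  rw [h1]
  linear_combination (-(1 - zs k * jointLST μ (B 0) (A 0) (ss k) 0)) * h2

end


/-! ### Polynomials of bounded degree as vectors -/

/-- The polynomial of degree at most `m` with given coefficients. -/
def ofVec {m : ℕ} (c : Fin (m + 1) → ℂ) : ℂ[X] := ∑ k : Fin (m + 1), C (c k) * X ^ (k : ℕ)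

theorem eval_ofVec {m : ℕ} (c : Fin (m + 1) → ℂ) (ξ : ℂ) :
    (ofVec c).eval ξ = ∑ k : Fin (m + 1), c k * ξ ^ (k : ℕ) := by
  simp [ofVec, Polynomial.eval_finsetSum]

theorem natDegree_ofVec_le {m : ℕ} (c : Fin (m + 1) → ℂ) : (ofVec c).natDegree ≤ m :=
  Polynomial.natDegree_sum_le_of_forall_le _ _ fun k _ =>
    (Polynomial.natDegree_C_mul_X_pow_le _ _).trans (Nat.lt_succ_iff.1 k.2)

theorem coeff_ofVec {m : ℕ} (c : Fin (m + 1) → ℂ) (k : Fin (m + 1)) :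
    (ofVec c).coeff k = c k := by
  rw [ofVec, Polynomial.finsetSum_coeff, Finset.sum_eq_single k]
  · simp
  · intro j _ hj
    rw [Polynomial.coeff_C_mul_X_pow, if_neg]
    exact fun h => hj (Fin.ext h.symm)
  · simp

theorem exists_ofVec_eq {m : ℕ} {p : ℂ[X]} (hp : p.natDegree ≤ m) :
    ∃ c : Fin (m + 1) → ℂ, ofVec c = p := by
  refine ⟨fun k => p.coeff k, ?_⟩
  rw [ofVec, Fin.sum_univ_eq_sum_range (fun k => C (p.coeff k) * X ^ k) (m + 1)]
  exact (Polynomial.as_sum_range_C_mul_X_pow' _ (Nat.lt_succ_iff.2 hp)).symm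

theorem tendsto_eval_ofVec {m : ℕ} {cs : ℕ → Fin (m + 1) → ℂ} {c : Fin (m + 1) → ℂ}
    (h : Filter.Tendsto cs Filter.atTop (nhds c)) (ξ : ℂ) :
    Filter.Tendsto (fun k => (ofVec (cs k)).eval ξ) Filter.atTop (nhds ((ofVec c).eval ξ)) := by
  simp only [eval_ofVec]
  exact tendsto_finsetSum _ fun j _ => ((tendsto_pi_nhds.1 h j).mul_const _)

theorem eq_zero_of_eval_eq_zero_right {p : ℂ[X]} (h : ∀ ξ : ℂ, 0 < ξ.re → p.eval ξ = 0) :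
    p = 0 := by
  have hinj : Function.Injective fun k : ℕ => ((k : ℂ) + 1) := by
    intro a b hab
    simpa using hab
  refine Polynomial.eq_zero_of_infinite_isRoot p
    (Set.infinite_of_injective_forall_mem hinj fun k => h _ ?_)
  simp only [Complex.add_re, Complex.natCast_re, Complex.one_re]
  linarith [Nat.cast_nonneg (α := ℝ) k]

section

variable {Ω : Type*} [MeasurableSpace Ω] {μ : Measure Ω} {B A : ℕ → Ω → ℝ}
  [IsProbabilityMeasure μ] {h₁ h₂ : ℂ → ℂ[X]}

/-- The upward part of a step is a rational function of `ξ`, of bounded degree. -/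
theorem IsModel.exists_stepUp_rational (hM : IsModel μ B A)
    (hrat : IsRationalInFirst (jointLST μ (B 0) (A 0)) h₁ h₂)
    (hfin : ∀ s : ℂ, 0 ≤ s.re → {ξ : ℂ | ξ.re < 0 ∧ antidiag h₂ s ξ = 0}.Finite) :
    ∃ m : ℕ, ∀ s : ℂ, 0 < s.re → ∃ q p : ℂ[X], q ≠ 0 ∧ q.natDegree ≤ m ∧ p.natDegree ≤ m ∧
      ∀ ξ : ℂ, 0 < ξ.re → q.eval ξ * stepUp μ B A s ξ = p.eval ξ := by
  -- A linear relation among the entries `ξ^k * stepUp` and `ξ^k`, valid for all `ξ`, is a pair of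
  -- polynomials of degree at most `m` expressing `stepUp` as a quotient.
  let φ : ∀ m : ℕ, ℂ → {ξ : ℂ // 0 < ξ.re} → Fin (m + 1) ⊕ Fin (m + 1) → ℂ := fun m s ξ =>
    Sum.elim (fun k => (ξ : ℂ) ^ (k : ℕ) * stepUp μ B A s ξ) (fun k => (ξ : ℂ) ^ (k : ℕ))
  have hφ : ∀ m s ξ (c : Fin (m + 1) ⊕ Fin (m + 1) → ℂ), ∑ j, φ m s ξ j * c j =
      (ofVec fun k => c (Sum.inl k)).eval (ξ : ℂ) * stepUp μ B A s ξ +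
        (ofVec fun k => c (Sum.inr k)).eval (ξ : ℂ) := by
    intro m s ξ c
    rw [Fintype.sum_sum_type, eval_ofVec, eval_ofVec, Finset.sum_mul]
    congr 1
    · refine Finset.sum_congr rfl fun k _ => ?_
      simp only [φ, Sum.elim_inl]
      ring
    · refine Finset.sum_congr rfl fun k _ => ?_
      simp only [φ, Sum.elim_inr]
      ring
  obtain ⟨m, hm⟩ := exists_determining_set
    (fun m => {x : ℝ | ∃ c : Fin (m + 1) ⊕ Fin (m + 1) → ℂ, c ≠ 0 ∧
      ∀ ξ, ∑ j, φ m x ξ j * c j = 0}) (by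
    filter_upwards [hM.ae_stepUp_rational hrat hfin] with x ⟨q, p, hq, hqp⟩
    refine ⟨max q.natDegree p.natDegree, ?_⟩
    obtain ⟨c, hc⟩ := exists_ofVec_eq (le_max_left q.natDegree p.natDegree)
    obtain ⟨d, hd⟩ := exists_ofVec_eq (p := -p) (m := max q.natDegree p.natDegree)
      (by rw [Polynomial.natDegree_neg]; exact le_max_right _ _)
    refine ⟨Sum.elim c d, fun h0 => hq ?_, fun ξ => ?_⟩
    · have : c = 0 := by
        funext k
        exact congrFun h0 (Sum.inl k)
      rw [← hc, this]
      simp [ofVec]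
    · rw [hφ]
      simp only [Sum.elim_inl, Sum.elim_inr]
      rw [hc, hd, hqp _ ξ.2, Polynomial.eval_neg, add_neg_cancel])
  refine ⟨m, fun s hs => ?_⟩
  -- For fixed points `ξ` each minor is holomorphic in `s` and vanishes on the determining set,
  -- hence for all `Re s > 0`.
  obtain ⟨c, hc, h⟩ := exists_ne_zero_of_det_eq_zero (φ m s) fun t => by
    refine hm (fun s => Matrix.det (fun i j => φ m s (t i) j)) ?_
      (fun x hx _ => det_eq_zero_of_exists _ hx t) s hs
    refine DifferentiableOn.congr ?_ fun s _ => Matrix.det_apply _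
    refine DifferentiableOn.fun_sum fun σ _ => DifferentiableOn.const_smul ?_ _
    refine DifferentiableOn.fun_finsetProd fun i _ => ?_
    rcases i with k | k
    · exact (hM.differentiableOn_expoInt_param (hM.measurableSet_up 1)
        (isOpen_lt continuous_const Complex.continuous_re)
        fun s hs => hM.isBddOn_up (le_of_lt hs) (t _).2.le).const_mul _
    · exact differentiableOn_const _
  set q := ofVec fun k => c (Sum.inl k) with hq
  set p := ofVec fun k => c (Sum.inr k) with hp
  have hqp : ∀ ξ : ℂ, 0 < ξ.re → q.eval ξ * stepUp μ B A s ξ = (-p).eval ξ := by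
    intro ξ hξ
    have h1 := h ⟨ξ, hξ⟩
    rw [hφ] at h1
    rw [Polynomial.eval_neg]
    exact eq_neg_of_add_eq_zero_left h1
  refine ⟨q, -p, fun h0 => hc ?_, natDegree_ofVec_le _, ?_, hqp⟩
  · have h2 : p = 0 := by
      refine eq_zero_of_eval_eq_zero_right fun ξ hξ => ?_
      have h3 := hqp ξ hξ
      rw [h0, Polynomial.eval_zero, zero_mul, Polynomial.eval_neg] at h3
      exact neg_eq_zero.1 h3.symm
    funext j
    rcases j with k | k
    · rw [← coeff_ofVec (fun k => c (Sum.inl k)) k, ← hq, h0, Polynomial.coeff_zero]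
      rfl
    · rw [← coeff_ofVec (fun k => c (Sum.inr k)) k, ← hp, h2, Polynomial.coeff_zero]
      rfl
  · rw [Polynomial.natDegree_neg]
    exact natDegree_ofVec_le _

/-! ### The polynomial identities -/

theorem IsModel.continuousOn_stepUp (hM : IsModel μ B A) {s : ℂ} (hs : 0 ≤ s.re) :
    ContinuousOn (stepUp μ B A s) {ξ | 0 ≤ ξ.re} := fun ξ _ =>
  hM.tendsto_expoInt_of_tendsto (s := fun _ => s) (ξ := id) (hM.measurableSet_up 1)
    (by filter_upwards [self_mem_nhdsWithin] with w hw using hM.isBddOn_up hs hw)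
    tendsto_const_nhds (Filter.tendsto_id.mono_left nhdsWithin_le_nhds)

theorem IsModel.continuousOn_ascFactor (hM : IsModel μ B A) {z s : ℂ} (hz : ‖z‖ ≤ 1)
    (hs : 0 ≤ s.re) : ContinuousOn (ascFactor μ B A z s) {ξ | 0 ≤ ξ.re} := fun ξ _ =>
  (hM.tendsto_expoSeries_of_tendsto (z := fun _ => z) (s := fun _ => s) (ξ := id)
    (fun n => hM.measurableSet_leave measurableSet_Iio n) tendsto_const_nhds
    (Filter.Eventually.of_forall fun _ => le_refl ‖z‖) tendsto_const_nhds
    (Filter.tendsto_id.mono_left nhdsWithin_le_nhds)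
    (hM.summable_pow_leave measurableSet_Iio (norm_nonneg z) hz)
    (by filter_upwards [self_mem_nhdsWithin] with w hw using hM.bdd_asc hs hw)).const_sub 1

theorem eqOn_closed_right {F G : ℂ → ℂ} (hF : ContinuousOn F {ξ | 0 ≤ ξ.re})
    (hG : ContinuousOn G {ξ | 0 ≤ ξ.re}) (h : ∀ ξ : ℂ, 0 < ξ.re → F ξ = G ξ) {ξ : ℂ}
    (hξ : 0 ≤ ξ.re) : F ξ = G ξ := by
  refine Set.EqOn.of_subset_closure (s := {ξ : ℂ | 0 < ξ.re}) (t := {ξ : ℂ | 0 ≤ ξ.re})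
    (fun ξ hξ => h ξ hξ) hF hG (fun ξ hξ => show 0 ≤ ξ.re from le_of_lt hξ) ?_ hξ
  rw [Complex.closure_setOfPred_lt_re]

end

section

variable {Ω : Type*} [MeasurableSpace Ω]

/-- Polynomials `q`, `p`, `w` with `p / q` the upward part of a step and `w / q` the ascending
Wiener–Hopf factor. -/
structure IsTriple (μ : Measure Ω) (B A : ℕ → Ω → ℝ) (h₁ h₂ : ℂ → ℂ[X]) (z s : ℂ)
    (q p w : ℂ[X]) : Prop where
  up : ∀ ξ : ℂ, 0 < ξ.re → q.eval ξ * stepUp μ B A s ξ = p.eval ξ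
  asc : ∀ ξ : ℂ, 0 < ξ.re → q.eval ξ * ascFactor μ B A z s ξ = w.eval ξ
  desc : ∀ ξ : ℂ, ξ.re < 0 → q.eval ξ - z * (p.eval ξ + q.eval ξ * stepDown μ B A s ξ) =
    w.eval ξ * descFactor μ B A z s ξ
  rat : ∀ ξ : ℂ, ξ.re < 0 → q.eval ξ * antidiag h₁ s ξ =
    antidiag h₂ s ξ * (p.eval ξ + q.eval ξ * stepDown μ B A s ξ)

variable {μ : Measure Ω} {B A : ℕ → Ω → ℝ} [IsProbabilityMeasure μ] {h₁ h₂ : ℂ → ℂ[X]}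

/-- On the strip `v = p + q * stepDown` equals `q h`, so `q U` coincides with `descSeries * (q - z
v)`, which continues it to the left. Both have growth of degree at most `m`, and the common
extension is the polynomial `w`. The relation with `D` follows since `descSeries` inverts `D`; the
one with `h₁`, `h₂` follows by the identity theorem from the strip. -/
theorem IsModel.exists_isTriple_interior (hM : IsModel μ B A)
    (hrat : IsRationalInFirst (jointLST μ (B 0) (A 0)) h₁ h₂) {m : ℕ} {z s : ℂ} (hz : ‖z‖ < 1)
    (hs : 0 < s.re) {q p : ℂ[X]} (hqm : q.natDegree ≤ m) (hpm : p.natDegree ≤ m)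
    (hqp : ∀ ξ : ℂ, 0 < ξ.re → q.eval ξ * stepUp μ B A s ξ = p.eval ξ) :
    ∃ w : ℂ[X], w.natDegree ≤ m ∧ IsTriple μ B A h₁ h₂ z s q p w := by
  have hup : ∀ ξ : ℂ, 0 ≤ ξ.re → q.eval ξ * stepUp μ B A s ξ = p.eval ξ := fun ξ hξ =>
    eqOn_closed_right (F := fun ξ => q.eval ξ * stepUp μ B A s ξ)
      (q.continuous.continuousOn.mul (hM.continuousOn_stepUp hs.le)) p.continuous.continuousOn
      hqp hξ
  set v : ℂ → ℂ := fun ξ => p.eval ξ + q.eval ξ * stepDown μ B A s ξ with hv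
  have hvd : DifferentiableOn ℂ v {ξ | ξ.re < s.re} :=
    p.differentiable.differentiableOn.add
      (q.differentiable.differentiableOn.mul (hM.differentiableOn_stepDown hs.le))
  have hstrip : ∀ ξ : ℂ, 0 ≤ ξ.re → ξ.re ≤ s.re →
      v ξ = q.eval ξ * jointLST μ (B 0) (A 0) ξ (s - ξ) := by
    intro ξ h0 h1
    rw [hM.jointLST_eq_add h0 h1, mul_add, hup ξ h0]
  obtain ⟨W, hW, hWr, hWl⟩ := exists_entire_of_eqOn_strip hs
    (f := fun ξ => q.eval ξ * ascFactor μ B A z s ξ)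
    (g := fun ξ => descSeries μ B A z s ξ * (q.eval ξ - z * v ξ))
    (q.differentiable.differentiableOn.mul (hM.differentiableOn_ascFactor hz.le hs.le))
    ((hM.differentiableOn_descSeries hz hs.le).mul
      (q.differentiable.differentiableOn.sub (hvd.const_mul z)))
    fun ξ h0 h1 => by
      rw [hstrip ξ h0.le h1.le, hM.ascFactor_eq hz h0.le h1.le]
      ring
  obtain ⟨Cq, hCq0, hCq⟩ := exists_norm_eval_le q
  obtain ⟨Cp, hCp0, hCp⟩ := exists_norm_eval_le p
  have hpow : ∀ (ξ : ℂ) {k : ℕ}, k ≤ m → (1 + ‖ξ‖) ^ k ≤ (1 + ‖ξ‖) ^ m := fun ξ k hk =>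
    pow_le_pow_right₀ (by linarith [norm_nonneg ξ]) hk
  have hq' : ∀ ξ, ‖q.eval ξ‖ ≤ Cq * (1 + ‖ξ‖) ^ m := fun ξ =>
    (hCq ξ).trans (mul_le_mul_of_nonneg_left (hpow ξ hqm) hCq0)
  have hp' : ∀ ξ, ‖p.eval ξ‖ ≤ Cp * (1 + ‖ξ‖) ^ m := fun ξ =>
    (hCp ξ).trans (mul_le_mul_of_nonneg_left (hpow ξ hpm) hCp0)
  set κ := ∑' n, ‖z‖ ^ n * μ.real (stay B A (Set.Iio 0) n) with hκ
  have hκ0 : 0 ≤ κ := tsum_nonneg fun n => by positivity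
  obtain ⟨w, hwm, hw⟩ := exists_polynomial_of_growth hW (m := m)
    (C := Cq * 2 + κ * (Cq + (Cp + Cq))) fun ξ => by
    have hR : 0 ≤ (1 + ‖ξ‖) ^ m := by positivity
    rcases lt_or_ge 0 ξ.re with h0 | h0
    · rw [hWr ξ h0, norm_mul]
      have h1 := mul_le_mul (hq' ξ) (hM.norm_ascFactor_le hz.le hs.le h0.le) (norm_nonneg _)
        (by positivity)
      refine h1.trans ?_
      have : 0 ≤ κ * (Cq + (Cp + Cq)) * (1 + ‖ξ‖) ^ m := by positivity
      linarith
    · have hle : ξ.re ≤ s.re := h0.trans hs.le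
      rw [hWl ξ (h0.trans_lt hs), norm_mul]
      have h1 : ‖v ξ‖ ≤ (Cp + Cq) * (1 + ‖ξ‖) ^ m := by
        refine (norm_add_le _ _).trans ?_
        rw [norm_mul]
        have h2 := mul_le_mul (hq' ξ) (hM.norm_stepDown_le hs.le hle) (norm_nonneg _)
          (by positivity)
        linarith [hp' ξ]
      have h3 : ‖q.eval ξ - z * v ξ‖ ≤ (Cq + (Cp + Cq)) * (1 + ‖ξ‖) ^ m := by
        refine (norm_sub_le _ _).trans ?_
        rw [norm_mul]
        have := mul_le_of_le_one_left (norm_nonneg (v ξ)) hz.le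
        linarith [hq' ξ]
      have h4 := mul_le_mul
        (norm_expoSeries_le (summable_stay _ hz) (hM.bdd_descSeries hs.le hle)) h3
        (norm_nonneg _) hκ0
      refine h4.trans ?_
      have : 0 ≤ Cq * 2 * (1 + ‖ξ‖) ^ m := by positivity
      linarith
  refine ⟨w, hwm, hqp, fun ξ hξ => by rw [← hw, hWr ξ hξ], fun ξ hξ => ?_, fun ξ hξ => ?_⟩
  · have h1 := (hM.descSeries_mul_descFactor hz hs).1 ξ (hξ.trans hs)
    rw [← hw, hWl ξ (hξ.trans hs)]
    linear_combination (-(q.eval ξ - z * v ξ)) * h1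
  · obtain ⟨d, hd⟩ := exists_degree_bound hrat
    have ho : IsOpen {ξ : ℂ | ξ.re < s.re} := isOpen_lt Complex.continuous_re continuous_const
    have ha1 := analyticOnNhd_antidiag hrat.holo₁ (fun τ hτ => (hd τ hτ).1) s
    have ha2 := analyticOnNhd_antidiag hrat.holo₂ (fun τ hτ => (hd τ hτ).2) s
    have hl : AnalyticOnNhd ℂ (fun ξ => q.eval ξ * antidiag h₁ s ξ) {ξ | ξ.re < s.re} :=
      (q.differentiable.differentiableOn.analyticOnNhd ho).mul ha1
    have hr : AnalyticOnNhd ℂ (fun ξ => antidiag h₂ s ξ * v ξ) {ξ | ξ.re < s.re} :=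
      ha2.mul (hvd.analyticOnNhd ho)
    have hz0 : (s / 2).re = s.re / 2 := by simp
    refine hl.eqOn_of_preconnected_of_eventuallyEq hr
      (convex_halfSpace_re_lt _).isPreconnected (z₀ := s / 2)
      (show (s / 2).re < s.re by rw [hz0]; linarith) ?_ (hξ.trans hs)
    have hS : {ξ : ℂ | 0 < ξ.re} ∩ {ξ : ℂ | ξ.re < s.re} ∈ nhds (s / 2) :=
      ((isOpen_lt continuous_const Complex.continuous_re).inter ho).mem_nhds
        ⟨show 0 < (s / 2).re by rw [hz0]; linarith, show (s / 2).re < s.re by rw [hz0]; linarith⟩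
    filter_upwards [hS] with w hw
    have hw0 : 0 < w.re := hw.1
    have hw1 : w.re < s.re := hw.2
    have h2 := hM.eval_eq_mul_jointLST hrat hw0.le (s₂ := s - w) (by simpa using hw1.le)
    rw [hstrip w hw0.le hw1.le]
    change q.eval w * (h₁ (s - w)).eval w = (h₂ (s - w)).eval w * _
    rw [h2]
    ring

/-- The identities persist for parameters on the boundary. -/
theorem IsModel.exists_isTriple (hM : IsModel μ B A)
    (hrat : IsRationalInFirst (jointLST μ (B 0) (A 0)) h₁ h₂)
    (hfin : ∀ s : ℂ, 0 ≤ s.re → {ξ : ℂ | ξ.re < 0 ∧ antidiag h₂ s ξ = 0}.Finite) {z s : ℂ}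
    (hz : ‖z‖ ≤ 1) (hs : 0 ≤ s.re) :
    ∃ q p w : ℂ[X], q ≠ 0 ∧ IsTriple μ B A h₁ h₂ z s q p w := by
  obtain ⟨m, hm⟩ := hM.exists_stepUp_rational hrat hfin
  obtain ⟨d, hd⟩ := exists_degree_bound hrat
  obtain ⟨zs, ss, hzs, hss, hzt, hst⟩ := exists_param_seq hz hs
  -- All four identities are homogeneous in `(q, p, w)`, so the joint coefficient vector can be
  -- normalized and a convergent subsequence extracted.
  have hex : ∀ k, ∃ c : (Fin (m + 1) → ℂ) × (Fin (m + 1) → ℂ) × (Fin (m + 1) → ℂ), ‖c‖ = 1 ∧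
      IsTriple μ B A h₁ h₂ (zs k) (ss k) (ofVec c.1) (ofVec c.2.1) (ofVec c.2.2) := by
    intro k
    obtain ⟨q, p, hq0, hqm, hpm, hqp⟩ := hm (ss k) (hss k)
    obtain ⟨w, hwm, ht⟩ := hM.exists_isTriple_interior hrat (hzs k).1 (hss k) hqm hpm hqp
    obtain ⟨cq, rfl⟩ := exists_ofVec_eq hqm
    obtain ⟨cp, rfl⟩ := exists_ofVec_eq hpm
    obtain ⟨cw, rfl⟩ := exists_ofVec_eq hwm
    have hc0 : ‖(cq, cp, cw)‖ ≠ 0 := by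
      rw [norm_ne_zero_iff]
      intro h0
      have h1 : cq = 0 := congrArg Prod.fst h0
      exact hq0 (by simp [h1, ofVec])
    obtain ⟨r, hr⟩ : ∃ r : ℂ, r = ((‖(cq, cp, cw)‖⁻¹ : ℝ) : ℂ) := ⟨_, rfl⟩
    have hsm : ∀ (a : Fin (m + 1) → ℂ) (ξ : ℂ), (ofVec (r • a)).eval ξ = r * (ofVec a).eval ξ := by
      intro a ξ
      simp only [eval_ofVec, Pi.smul_apply, smul_eq_mul, Finset.mul_sum]
      exact Finset.sum_congr rfl fun _ _ => by ring
    refine ⟨r • (cq, cp, cw), ?_, ⟨fun ξ hξ => ?_, fun ξ hξ => ?_, fun ξ hξ => ?_,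
      fun ξ hξ => ?_⟩⟩
    · rw [norm_smul, hr, Complex.norm_real, norm_inv, norm_norm, inv_mul_cancel₀ hc0]
    · simp only [Prod.smul_mk, hsm]
      linear_combination r * ht.up ξ hξ
    · simp only [Prod.smul_mk, hsm]
      linear_combination r * ht.asc ξ hξ
    · simp only [Prod.smul_mk, hsm]
      linear_combination r * ht.desc ξ hξ
    · simp only [Prod.smul_mk, hsm]
      linear_combination r * ht.rat ξ hξ
  choose c hc1 hct using hex
  obtain ⟨a, ha, θ, hθ, hlim⟩ := (isCompact_sphere
    (0 : (Fin (m + 1) → ℂ) × (Fin (m + 1) → ℂ) × (Fin (m + 1) → ℂ)) 1).tendsto_subseq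
    (x := c) fun k => by rw [mem_sphere_zero_iff_norm]; exact hc1 k
  have hθt := hθ.tendsto_atTop
  have hz' := hzt.comp hθt
  have hs' := hst.comp hθt
  have h1 := tendsto_eval_ofVec (hlim.fst_nhds)
  have h2 := tendsto_eval_ofVec (hlim.snd_nhds.fst_nhds)
  have h3 := tendsto_eval_ofVec (hlim.snd_nhds.snd_nhds)
  have hupl : ∀ ξ : ℂ, 0 < ξ.re → Filter.Tendsto (fun k => stepUp μ B A ((ss ∘ θ) k) ξ)
      Filter.atTop (nhds (stepUp μ B A s ξ)) := fun ξ hξ =>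
    hM.tendsto_expoInt_of_tendsto (hM.measurableSet_up 1)
      (Filter.Eventually.of_forall fun k => hM.isBddOn_up (hss (θ k)).le hξ.le) hs'
      tendsto_const_nhds
  have hdol : ∀ ξ : ℂ, ξ.re < 0 → Filter.Tendsto (fun k => stepDown μ B A ((ss ∘ θ) k) ξ)
      Filter.atTop (nhds (stepDown μ B A s ξ)) := fun ξ hξ =>
    hM.tendsto_expoInt_of_tendsto (hM.measurableSet_down 1)
      (Filter.Eventually.of_forall fun k =>
        hM.isBddOn_down (hss (θ k)).le (hξ.le.trans (hss (θ k)).le)) hs'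
      tendsto_const_nhds
  have hT : IsTriple μ B A h₁ h₂ z s (ofVec a.1) (ofVec a.2.1) (ofVec a.2.2) := by
    refine ⟨fun ξ hξ => ?_, fun ξ hξ => ?_, fun ξ hξ => ?_, fun ξ hξ => ?_⟩
    · exact tendsto_nhds_unique ((h1 ξ).mul (hupl ξ hξ))
        ((h2 ξ).congr fun k => ((hct (θ k)).up ξ hξ).symm)
    · exact tendsto_nhds_unique ((h1 ξ).mul (hM.tendsto_ascFactor_param
        (fun k => (hzs (θ k)).1.le) (fun k => (hss (θ k)).le) hz' hs' tendsto_const_nhds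
        fun _ => hξ.le)) ((h3 ξ).congr fun k => ((hct (θ k)).asc ξ hξ).symm)
    · exact tendsto_nhds_unique
        ((h1 ξ).sub (hz'.mul ((h2 ξ).add ((h1 ξ).mul (hdol ξ hξ)))))
        (((h3 ξ).mul (hM.tendsto_descFactor_param (fun k => (hzs (θ k)).1.le)
          (fun k => (hss (θ k)).le) hz' hs' tendsto_const_nhds
          fun k => hξ.le.trans (hss (θ k)).le)).congr fun k => ((hct (θ k)).desc ξ hξ).symm)
    · exact tendsto_nhds_unique
        ((h1 ξ).mul (tendsto_antidiag hrat.holo₁ (fun τ hτ => (hd τ hτ).1) hs' (hξ.trans_le hs)))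
        (((tendsto_antidiag hrat.holo₂ (fun τ hτ => (hd τ hτ).2) hs' (hξ.trans_le hs)).mul
          ((h2 ξ).add ((h1 ξ).mul (hdol ξ hξ)))).congr
            fun k => ((hct (θ k)).rat ξ hξ).symm)
  -- The limit vector has norm one. If its `q` vanished, then so would `p` and `w`, which are
  -- multiples of `q` on the right.
  refine ⟨_, _, _, fun h0 => ?_, hT⟩
  have hzero : ∀ b : Fin (m + 1) → ℂ, ofVec b = 0 → b = 0 := fun b hb => by
    funext k
    rw [← coeff_ofVec b k, hb, Polynomial.coeff_zero]
    rfl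
  have hp0 : ofVec a.2.1 = 0 := eq_zero_of_eval_eq_zero_right fun ξ hξ => by
    rw [← hT.up ξ hξ, h0, Polynomial.eval_zero, zero_mul]
  have hw0 : ofVec a.2.2 = 0 := eq_zero_of_eval_eq_zero_right fun ξ hξ => by
    rw [← hT.asc ξ hξ, h0, Polynomial.eval_zero, zero_mul]
  have ha0 : a = 0 := Prod.ext (hzero _ h0) (Prod.ext (hzero _ hp0) (hzero _ hw0))
  rw [ha0] at ha
  simp at ha

end


/-! ### Reduction to coprime polynomials -/

section

variable {Ω : Type*} [MeasurableSpace Ω] {μ : Measure Ω} {B A : ℕ → Ω → ℝ}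
  [IsProbabilityMeasure μ] {h₁ h₂ : ℂ → ℂ[X]} {z s : ℂ} {q p w : ℂ[X]}

theorem IsTriple.up_closed (hM : IsModel μ B A) (hs : 0 ≤ s.re)
    (h : IsTriple μ B A h₁ h₂ z s q p w) {ξ : ℂ} (hξ : 0 ≤ ξ.re) :
    q.eval ξ * stepUp μ B A s ξ = p.eval ξ :=
  eqOn_closed_right (F := fun ξ => q.eval ξ * stepUp μ B A s ξ)
    (q.continuous.continuousOn.mul (hM.continuousOn_stepUp hs)) p.continuous.continuousOn
    h.up hξ

theorem IsTriple.asc_closed (hM : IsModel μ B A) (hz : ‖z‖ ≤ 1) (hs : 0 ≤ s.re)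
    (h : IsTriple μ B A h₁ h₂ z s q p w) {ξ : ℂ} (hξ : 0 ≤ ξ.re) :
    q.eval ξ * ascFactor μ B A z s ξ = w.eval ξ :=
  eqOn_closed_right (F := fun ξ => q.eval ξ * ascFactor μ B A z s ξ)
    (q.continuous.continuousOn.mul (hM.continuousOn_ascFactor hz hs)) w.continuous.continuousOn
    h.asc hξ

/-- Each identity relates continuous functions on an open half-plane, so the factor `ξ - α` can be
divided out, at `ξ = α` by continuity. -/
theorem IsTriple.cancel (hM : IsModel μ B A)
    (hrat : IsRationalInFirst (jointLST μ (B 0) (A 0)) h₁ h₂) (hz : ‖z‖ ≤ 1) (hs : 0 ≤ s.re)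
    (α : ℂ) (h : IsTriple μ B A h₁ h₂ z s ((X - C α) * q) ((X - C α) * p) ((X - C α) * w)) :
    IsTriple μ B A h₁ h₂ z s q p w := by
  obtain ⟨d, hd⟩ := exists_degree_bound hrat
  have hor : IsOpen {ξ : ℂ | 0 < ξ.re} := isOpen_lt continuous_const Complex.continuous_re
  have hol : IsOpen {ξ : ℂ | ξ.re < 0} := isOpen_lt Complex.continuous_re continuous_const
  have hsub : {ξ : ℂ | ξ.re < 0} ⊆ {ξ | ξ.re < s.re} := fun ξ hξ => lt_of_lt_of_le hξ hs
  have key : ∀ {U : Set ℂ} (F : ℂ → ℂ), IsOpen U → ContinuousOn F U →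
      (∀ ξ ∈ U, F ξ * (X - C α).eval ξ = 0) → ∀ ξ ∈ U, F ξ = 0 := fun F hU hF h0 =>
    eq_zero_of_mul_eq_zero hU hF
      (fun ξ _ => (X - C α).differentiable.analyticAt ξ) (fun ξ _ => by
        rw [analyticOrderAt_eval (Polynomial.X_sub_C_ne_zero α)]
        exact ENat.natCast_ne_top _) h0
  have hup := (hM.continuousOn_stepUp hs).mono fun ξ (hξ : 0 < ξ.re) => hξ.le
  have hasc := (hM.continuousOn_ascFactor hz hs).mono fun ξ (hξ : 0 < ξ.re) => hξ.le
  have hdown := (hM.differentiableOn_stepDown hs).continuousOn.mono hsub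
  have hdesc := (hM.differentiableOn_descFactor hz hs).continuousOn.mono hsub
  have hH₁ := (analyticOnNhd_antidiag hrat.holo₁ (fun τ hτ => (hd τ hτ).1) s).continuousOn.mono hsub
  have hH₂ := (analyticOnNhd_antidiag hrat.holo₂ (fun τ hτ => (hd τ hτ).2) s).continuousOn.mono hsub
  have hcq : ∀ U, ContinuousOn (fun ξ => q.eval ξ) U := fun U => q.continuous.continuousOn
  have hcp : ∀ U, ContinuousOn (fun ξ => p.eval ξ) U := fun U => p.continuous.continuousOn
  have hcw : ∀ U, ContinuousOn (fun ξ => w.eval ξ) U := fun U => w.continuous.continuousOn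
  refine ⟨fun ξ hξ => ?_, fun ξ hξ => ?_, fun ξ hξ => ?_, fun ξ hξ => ?_⟩
  · refine sub_eq_zero.1 (key (fun ξ => q.eval ξ * stepUp μ B A s ξ - p.eval ξ) hor
      (((hcq _).mul hup).sub (hcp _)) (fun ξ hξ => ?_) ξ hξ)
    have h1 := h.up ξ hξ
    rw [Polynomial.eval_mul, Polynomial.eval_mul] at h1
    linear_combination h1
  · refine sub_eq_zero.1 (key (fun ξ => q.eval ξ * ascFactor μ B A z s ξ - w.eval ξ) hor
      (((hcq _).mul hasc).sub (hcw _)) (fun ξ hξ => ?_) ξ hξ)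
    have h1 := h.asc ξ hξ
    rw [Polynomial.eval_mul, Polynomial.eval_mul] at h1
    linear_combination h1
  · refine sub_eq_zero.1 (key (fun ξ => q.eval ξ - z * (p.eval ξ + q.eval ξ * stepDown μ B A s ξ) -
      w.eval ξ * descFactor μ B A z s ξ) hol
      (((hcq _).sub (continuousOn_const.mul ((hcp _).add ((hcq _).mul hdown)))).sub
        ((hcw _).mul hdesc)) (fun ξ hξ => ?_) ξ hξ)
    have h1 := h.desc ξ hξ
    rw [Polynomial.eval_mul, Polynomial.eval_mul, Polynomial.eval_mul] at h1
    linear_combination h1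
  · refine sub_eq_zero.1 (key (fun ξ => q.eval ξ * antidiag h₁ s ξ -
      antidiag h₂ s ξ * (p.eval ξ + q.eval ξ * stepDown μ B A s ξ)) hol
      (((hcq _).mul hH₁).sub (hH₂.mul ((hcp _).add ((hcq _).mul hdown))))
        (fun ξ hξ => ?_) ξ hξ)
    have h1 := h.rat ξ hξ
    rw [Polynomial.eval_mul, Polynomial.eval_mul] at h1
    linear_combination h1

/-- To the left, `w D` vanishes at a common root while `D` does not. To the right, `w` is `q` times
the finite value of `U`. -/
theorem IsTriple.isRoot (hM : IsModel μ B A) (hz : ‖z‖ ≤ 1) (hs : 0 ≤ s.re)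
    (h : IsTriple μ B A h₁ h₂ z s q p w) {α : ℂ} (hq : q.IsRoot α) (hp : p.IsRoot α) :
    w.IsRoot α := by
  rw [Polynomial.IsRoot] at hq hp ⊢
  rcases lt_or_ge α.re 0 with h0 | h0
  · have h1 := h.desc α h0
    rw [hq, hp, zero_mul, add_zero, mul_zero, sub_zero] at h1
    exact (mul_eq_zero.1 h1.symm).resolve_right (hM.descFactor_ne_zero hz hs h0)
  · rw [← h.asc_closed hM hz hs h0, hq, zero_mul]

/-- Common roots of `q` and `p` are removed one at a time; being roots of `w` too, they divide the
whole triple. -/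
theorem IsTriple.exists_coprime (hM : IsModel μ B A)
    (hrat : IsRationalInFirst (jointLST μ (B 0) (A 0)) h₁ h₂) (hz : ‖z‖ ≤ 1) (hs : 0 ≤ s.re)
    (h : IsTriple μ B A h₁ h₂ z s q p w) (hq0 : q ≠ 0) :
    ∃ q p w : ℂ[X], q ≠ 0 ∧ IsTriple μ B A h₁ h₂ z s q p w ∧
      ∀ α, q.IsRoot α → ¬ p.IsRoot α := by
  induction hn : q.natDegree using Nat.strong_induction_on generalizing q p w with
  | _ n ih =>
    by_cases hco : ∀ α, q.IsRoot α → ¬ p.IsRoot α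
    · exact ⟨q, p, w, hq0, h, hco⟩
    · push Not at hco
      obtain ⟨α, hqα, hpα⟩ := hco
      obtain ⟨q', rfl⟩ := Polynomial.dvd_iff_isRoot.2 hqα
      obtain ⟨w', rfl⟩ := Polynomial.dvd_iff_isRoot.2 (h.isRoot hM hz hs hqα hpα)
      obtain ⟨p', rfl⟩ := Polynomial.dvd_iff_isRoot.2 hpα
      have hq' : q' ≠ 0 := right_ne_zero_of_mul hq0
      refine ih q'.natDegree ?_ (h.cancel hM hrat hz hs α) hq' rfl
      rw [Polynomial.natDegree_mul (Polynomial.X_sub_C_ne_zero α) hq',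
        Polynomial.natDegree_X_sub_C] at hn
      omega

/-- The identity `q * stepUp = p` extends to the closed right half-plane, so a root of `q` there
would be shared with `p`. -/
theorem IsTriple.re_neg_of_isRoot (hM : IsModel μ B A) (hs : 0 ≤ s.re)
    (h : IsTriple μ B A h₁ h₂ z s q p w) (hco : ∀ α, q.IsRoot α → ¬ p.IsRoot α) {α : ℂ}
    (hα : q.IsRoot α) : α.re < 0 := by
  by_contra! h0
  refine hco α hα ?_
  rw [Polynomial.IsRoot] at hα ⊢
  rw [← h.up_closed hM hs h0, hα, zero_mul]

end

/-! ### Comparison of degrees -/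

theorem tendsto_eval_div_pow {p : ℂ[X]} {d : ℕ} (hp : p.natDegree ≤ d) {x : ℕ → ℂ}
    (hx0 : ∀ᶠ k in Filter.atTop, x k ≠ 0)
    (hx : Filter.Tendsto (fun k => (x k)⁻¹) Filter.atTop (nhds 0)) :
    Filter.Tendsto (fun k => p.eval (x k) / x k ^ d) Filter.atTop (nhds (p.coeff d)) := by
  have h1 : Filter.Tendsto (fun k => ∑ i ∈ Finset.range (d + 1), p.coeff i * (x k)⁻¹ ^ (d - i))
      Filter.atTop (nhds (∑ i ∈ Finset.range (d + 1), p.coeff i * (0 : ℂ) ^ (d - i))) :=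
    tendsto_finsetSum _ fun i _ => (hx.pow (d - i)).const_mul _
  have h2 : ∑ i ∈ Finset.range (d + 1), p.coeff i * (0 : ℂ) ^ (d - i) = p.coeff d := by
    rw [Finset.sum_range_succ, Finset.sum_eq_zero, Nat.sub_self, pow_zero, mul_one, zero_add]
    intro i hi
    have : d - i ≠ 0 := by
      have := Finset.mem_range.1 hi
      omega
    rw [zero_pow this, mul_zero]
  rw [h2] at h1
  refine h1.congr' ?_
  filter_upwards [hx0] with k hk
  rw [Polynomial.eval_eq_sum_range' (Nat.lt_succ_iff.2 hp), Finset.sum_div]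
  refine Finset.sum_congr rfl fun i hi => ?_
  have hi' : i ≤ d := Nat.lt_succ_iff.1 (Finset.mem_range.1 hi)
  rw [mul_div_assoc, inv_pow, ← Nat.sub_add_cancel hi', pow_add, Nat.add_sub_cancel]
  field_simp

section

variable {Ω : Type*} [MeasurableSpace Ω] {μ : Measure Ω} {B A : ℕ → Ω → ℝ}
  [IsProbabilityMeasure μ] {h₁ h₂ : ℂ → ℂ[X]} {z s : ℂ} {q p w : ℂ[X]}

/-- As `stepUp` tends to zero along the positive integers, `p` has no term in the top degree. Along
the negative integers `stepDown → 0` and `D → 1`, so `desc` equates the top coefficients of `q` and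
`w`. -/
theorem IsTriple.natDegree_eq (hM : IsModel μ B A) (hz : ‖z‖ ≤ 1) (hs : 0 ≤ s.re)
    (h : IsTriple μ B A h₁ h₂ z s q p w) (hq0 : q ≠ 0) :
    w.natDegree = q.natDegree ∧ w.leadingCoeff = q.leadingCoeff := by
  set d := max q.natDegree (max p.natDegree w.natDegree) with hd
  have hqd : q.natDegree ≤ d := le_max_left _ _
  have hpd : p.natDegree ≤ d := (le_max_left _ _).trans (le_max_right _ _)
  have hwd : w.natDegree ≤ d := (le_max_right _ _).trans (le_max_right _ _)
  have hinv : Filter.Tendsto (fun k : ℕ => ((k : ℂ))⁻¹) Filter.atTop (nhds 0) :=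
    tendsto_inv_atTop_nhds_zero_nat
  have hinv' : Filter.Tendsto (fun k : ℕ => (-(k : ℂ))⁻¹) Filter.atTop (nhds 0) := by
    simpa [inv_neg] using hinv.neg
  have hk0 : ∀ᶠ k : ℕ in Filter.atTop, (k : ℂ) ≠ 0 := by
    filter_upwards [Filter.eventually_gt_atTop 0] with k hk
    exact Nat.cast_ne_zero.2 hk.ne'
  have hk0' : ∀ᶠ k : ℕ in Filter.atTop, -(k : ℂ) ≠ 0 := hk0.mono fun k hk => neg_ne_zero.2 hk
  have hupl : Filter.Tendsto (fun k : ℕ => stepUp μ B A s (k : ℂ)) Filter.atTop (nhds 0) := by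
    refine hM.tendsto_expoInt_zero (hM.measurableSet_up 1)
      (Filter.Eventually.of_forall fun k => hM.isBddOn_up hs (by simp))
      (Filter.Eventually.of_forall fun ω hω => ?_)
    have hω' : 0 < walk B A 1 ω := hω
    simpa using tendsto_natCast_atTop_atTop.atTop_mul_const hω'
  have hdol : Filter.Tendsto (fun k : ℕ => stepDown μ B A s (-(k : ℂ))) Filter.atTop (nhds 0) :=
    hM.tendsto_expoInt_zero (hM.measurableSet_down 1)
      (Filter.Eventually.of_forall fun k => hM.isBddOn_down hs ((neg_natCast_re_le k).trans hs))
      (Filter.Eventually.of_forall fun ω hω => tendsto_neg_natCast_mul hω)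
  have hpcoeff : p.coeff d = 0 := by
    have h1 := (tendsto_eval_div_pow hqd hk0 hinv).mul hupl
    rw [mul_zero] at h1
    refine tendsto_nhds_unique (tendsto_eval_div_pow hpd hk0 hinv) (h1.congr' ?_)
    filter_upwards [Filter.eventually_gt_atTop 0] with k hk
    rw [← h.up k (by simpa using hk)]
    ring
  have hwcoeff : w.coeff d = q.coeff d := by
    have h1 := (tendsto_eval_div_pow hwd hk0' hinv').mul (hM.tendsto_descFactor hz hs)
    have h2 := (tendsto_eval_div_pow hqd hk0' hinv').sub
      (((tendsto_eval_div_pow hpd hk0' hinv').add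
        ((tendsto_eval_div_pow hqd hk0' hinv').mul hdol)).const_mul z)
    rw [hpcoeff, mul_zero, add_zero, mul_zero, sub_zero] at h2
    rw [mul_one] at h1
    refine tendsto_nhds_unique h1 (h2.congr' ?_)
    filter_upwards [Filter.eventually_gt_atTop 0] with k hk
    have h3 := h.desc (-(k : ℂ)) (by simpa using hk)
    linear_combination ((-(k : ℂ)) ^ d)⁻¹ * h3
  -- Otherwise none of the three polynomials reaches the degree `d`, their maximum, except when `d =
  -- 0`, and then `q = 0`.
  have hqne : q.coeff d ≠ 0 := by
    intro h0
    have hlt : ∀ {r : ℂ[X]}, r.natDegree ≤ d → r.coeff d = 0 → d = 0 ∨ r.natDegree < d := by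
      intro r hr hr0
      rcases hr.lt_or_eq with h4 | h4
      · exact Or.inr h4
      · rw [← h4, Polynomial.coeff_natDegree, Polynomial.leadingCoeff_eq_zero] at hr0
        left
        rw [← h4, hr0, Polynomial.natDegree_zero]
    have h5 := hlt hpd hpcoeff
    have h6 := hlt hwd (hwcoeff.trans h0)
    rcases hqd.lt_or_eq with h4 | h4
    · omega
    · rw [← h4, Polynomial.coeff_natDegree, Polynomial.leadingCoeff_eq_zero] at h0
      exact hq0 h0
  have hqe : q.natDegree = d := hqd.antisymm (Polynomial.le_natDegree_of_ne_zero hqne)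
  have hwe : w.natDegree = d :=
    hwd.antisymm (Polynomial.le_natDegree_of_ne_zero (hwcoeff ▸ hqne))
  refine ⟨hwe.trans hqe.symm, ?_⟩
  rw [Polynomial.leadingCoeff, Polynomial.leadingCoeff, hqe, hwe, hwcoeff]

/-! ### The zeros in the left half-plane -/

/-- Eliminating `stepDown` between `rat` and `desc` gives `q (h₂ - z h₁) = h₂ w D` with `D` free of
zeros; orders are then compared. Subtraction in `ℕ` is harmless by the first claim. -/
theorem IsTriple.analyticOrderAt_eq (hM : IsModel μ B A)
    (hrat : IsRationalInFirst (jointLST μ (B 0) (A 0)) h₁ h₂) (hz : ‖z‖ ≤ 1) (hs : 0 ≤ s.re)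
    (h : IsTriple μ B A h₁ h₂ z s q p w) (hq0 : q ≠ 0) (hw0 : w ≠ 0)
    (hco : ∀ α, q.IsRoot α → ¬ p.IsRoot α) {α : ℂ} (hα : α.re < 0) {b : ℕ}
    (hb : (b : ℕ∞) = analyticOrderAt (antidiag h₂ s) α) :
    q.rootMultiplicity α ≤ b ∧
      analyticOrderAt (fun ξ => antidiag h₂ s ξ - z * antidiag h₁ s ξ) α =
        ((b - q.rootMultiplicity α + w.rootMultiplicity α : ℕ) : ℕ∞) := by
  obtain ⟨d, hd⟩ := exists_degree_bound hrat
  have hos : IsOpen {ξ : ℂ | ξ.re < s.re} := isOpen_lt Complex.continuous_re continuous_const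
  have hol : IsOpen {ξ : ℂ | ξ.re < 0} := isOpen_lt Complex.continuous_re continuous_const
  have hαs : α ∈ {ξ : ℂ | ξ.re < s.re} := hα.trans_le hs
  have hnhds : {ξ : ℂ | ξ.re < 0} ∈ nhds α := hol.mem_nhds hα
  have aH₁ := analyticOnNhd_antidiag hrat.holo₁ (fun τ hτ => (hd τ hτ).1) s α hαs
  have aH₂ := analyticOnNhd_antidiag hrat.holo₂ (fun τ hτ => (hd τ hτ).2) s α hαs
  have aq : AnalyticAt ℂ (fun ξ => q.eval ξ) α := q.differentiable.analyticAt α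
  have ap : AnalyticAt ℂ (fun ξ => p.eval ξ) α := p.differentiable.analyticAt α
  have aw : AnalyticAt ℂ (fun ξ => w.eval ξ) α := w.differentiable.analyticAt α
  have aD := (hM.differentiableOn_descFactor hz hs).analyticOnNhd hos α hαs
  have av : AnalyticAt ℂ (fun ξ => p.eval ξ + q.eval ξ * stepDown μ B A s ξ) α :=
    ap.add (aq.mul ((hM.differentiableOn_stepDown hs).analyticOnNhd hos α hαs))
  have aF : AnalyticAt ℂ (fun ξ => antidiag h₂ s ξ - z * antidiag h₁ s ξ) α :=
    aH₂.sub (analyticAt_const.mul aH₁)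
  -- At a root of `q` the cofactor of `h₂` in `rat` takes the value of `p`, nonzero by coprimality,
  -- so `h₂` must absorb the whole root.
  have hle : q.rootMultiplicity α ≤ b := by
    by_cases hqα : q.IsRoot α
    · have hv : analyticOrderAt (fun ξ => p.eval ξ + q.eval ξ * stepDown μ B A s ξ) α = 0 := by
        refine av.analyticOrderAt_eq_zero.2 ?_
        rw [Polynomial.IsRoot.def.1 hqα, zero_mul, add_zero]
        exact hco α hqα
      have h1 := analyticOrderAt_mul aq aH₁
      have h2 := analyticOrderAt_mul aH₂ av
      have h3 : analyticOrderAt ((fun ξ => q.eval ξ) * antidiag h₁ s) α =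
          analyticOrderAt (antidiag h₂ s *
            fun ξ => p.eval ξ + q.eval ξ * stepDown μ B A s ξ) α :=
        analyticOrderAt_congr (by filter_upwards [hnhds] with ξ hξ using h.rat ξ hξ)
      rw [h1, h2, hv, add_zero, analyticOrderAt_eval hq0, ← hb] at h3
      exact_mod_cast (self_le_add_right _ _).trans h3.le
    · rw [Polynomial.rootMultiplicity_eq_zero hqα]
      exact Nat.zero_le b
  refine ⟨hle, ?_⟩
  have hD : analyticOrderAt (descFactor μ B A z s) α = 0 :=
    aD.analyticOrderAt_eq_zero.2 (hM.descFactor_ne_zero hz hs hα)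
  have h1 := analyticOrderAt_mul aq aF
  have h2 := analyticOrderAt_mul (aH₂.mul aw) aD
  have h3 : analyticOrderAt ((fun ξ => q.eval ξ) *
        fun ξ => antidiag h₂ s ξ - z * antidiag h₁ s ξ) α =
      analyticOrderAt ((antidiag h₂ s * fun ξ => w.eval ξ) * descFactor μ B A z s) α := by
    refine analyticOrderAt_congr ?_
    filter_upwards [hnhds] with ξ hξ
    simp only [Pi.mul_apply]
    linear_combination (-z) * h.rat ξ hξ + antidiag h₂ s ξ * h.desc ξ hξ
  rw [h1, h2, analyticOrderAt_mul aH₂ aw, hD, add_zero, analyticOrderAt_eval hq0,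
    analyticOrderAt_eval hw0, ← hb] at h3
  -- Finiteness of the order, needed to cancel in `ℕ∞`, comes from the product identity itself.
  have hfin : analyticOrderAt (fun ξ => antidiag h₂ s ξ - z * antidiag h₁ s ξ) α ≠ ⊤ := by
    intro htop
    rw [htop, add_top, ← Nat.cast_add] at h3
    exact ENat.natCast_ne_top _ h3.symm
  obtain ⟨c, hc⟩ := ENat.ne_top_iff_exists.1 hfin
  rw [← hc] at h3 ⊢
  norm_cast at h3 ⊢
  omega

theorem prod_map_sub_ne_zero {m : Multiset ℂ} (hm : ∀ w ∈ m, w.re < 0) (hs : 0 ≤ s.re) :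
    (m.map fun w => s - w).prod ≠ 0 := by
  refine Multiset.prod_ne_zero fun h0 => ?_
  obtain ⟨w, hw, h1⟩ := Multiset.mem_map.1 h0
  have := hm w hw
  rw [← sub_eq_zero.1 h1] at this
  linarith

/-- The zeros of `h₂ - z h₁` and the transform of the busy period, in terms of multisets of
zeros. -/
theorem IsModel.exists_zeros_busyTransform (hM : IsModel μ B A)
    (hrat : IsRationalInFirst (jointLST μ (B 0) (A 0)) h₁ h₂)
    (hfin : ∀ s : ℂ, 0 ≤ s.re → {ξ : ℂ | ξ.re < 0 ∧ antidiag h₂ s ξ = 0}.Finite)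
    (hz : ‖z‖ ≤ 1) (hs : 0 ≤ s.re)
    (hsum : Summable fun n => ‖z‖ ^ n * μ.real (stay B A (Set.Ici 0) n)) {m : Multiset ℂ}
    (hm : ∀ α ∈ m, α.re < 0)
    (hcount : ∀ α : ℂ, α.re < 0 → (m.count α : ℕ∞) = analyticOrderAt (antidiag h₂ s) α) :
    ∃ m' : Multiset ℂ, m'.card = m.card ∧ (∀ α ∈ m', α.re < 0) ∧
      (∀ α : ℂ, α.re < 0 → (m'.count α : ℕ∞) =
        analyticOrderAt (fun ξ => antidiag h₂ s ξ - z * antidiag h₁ s ξ) α) ∧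
      busyTransform μ B A z s = 1 - (1 - z * jointLST μ (B 0) (A 0) s 0) *
        ((m.map fun α => s - α).prod / (m'.map fun α => s - α).prod) := by
  classical
  obtain ⟨q₀, p₀, w₀, hq₀, hT₀⟩ := hM.exists_isTriple hrat hfin hz hs
  obtain ⟨q, p, w, hq0, hT, hco⟩ := hT₀.exists_coprime hM hrat hz hs hq₀
  obtain ⟨hdeg, hlead⟩ := hT.natDegree_eq hM hz hs hq0
  have hlc : q.leadingCoeff ≠ 0 := Polynomial.leadingCoeff_ne_zero.2 hq0
  have hw0 : w ≠ 0 := Polynomial.leadingCoeff_ne_zero.1 (hlead ▸ hlc)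
  have hqroot : ∀ α ∈ q.roots, α.re < 0 := fun α hα =>
    hT.re_neg_of_isRoot hM hs hco (Polynomial.isRoot_of_mem_roots hα)
  have hasc : ∀ {ξ : ℂ}, 0 ≤ ξ.re → ascFactor μ B A z s ξ ≠ 0 := fun hξ =>
    hM.ascFactor_ne_zero hz hs hsum hξ
  have hwroot : ∀ α ∈ w.roots, α.re < 0 := by
    intro α hα
    by_contra! h0
    have h1 := hT.asc_closed hM hz hs h0
    rw [Polynomial.IsRoot.def.1 (Polynomial.isRoot_of_mem_roots hα)] at h1
    have h2 : q.IsRoot α := (mul_eq_zero.1 h1).resolve_right (hasc h0)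
    exact absurd (hT.re_neg_of_isRoot hM hs hco h2) (not_lt.2 h0)
  have hord := fun {α : ℂ} (hα : α.re < 0) =>
    hT.analyticOrderAt_eq hM hrat hz hs hq0 hw0 hco hα (hcount α hα)
  have hle : q.roots ≤ m := by
    rw [Multiset.le_iff_count]
    intro α
    by_cases hα : α ∈ q.roots
    · rw [Polynomial.count_roots]
      exact (hord (hqroot α hα)).1
    · rw [Multiset.count_eq_zero_of_notMem hα]
      exact Nat.zero_le _
  -- `r` collects the left zeros of `h₂` that are not accounted for by `q`. They occur in both lists
  -- of zeros and cancel in the quotient of products.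
  obtain ⟨r, rfl⟩ := Multiset.le_iff_exists_add.1 hle
  have hr : ∀ α ∈ r, α.re < 0 := fun α hα => hm α (Multiset.mem_add.2 (Or.inr hα))
  have hqs : q.Splits := IsAlgClosed.splits q
  have hws : w.Splits := IsAlgClosed.splits w
  refine ⟨w.roots + r, ?_, ?_, fun α hα => ?_, ?_⟩
  · rw [Multiset.card_add, Multiset.card_add, ← hqs.natDegree_eq_card_roots,
      ← hws.natDegree_eq_card_roots, hdeg]
  · intro α hα
    rcases Multiset.mem_add.1 hα with h1 | h1
    · exact hwroot α h1
    · exact hr α h1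
  · rw [(hord hα).2, Multiset.count_add, Multiset.count_add, Polynomial.count_roots,
      Polynomial.count_roots]
    congr 1
    omega
  · have h1 := prod_map_sub_ne_zero hqroot hs
    have h2 := prod_map_sub_ne_zero hwroot hs
    have h3 := prod_map_sub_ne_zero hr hs
    have hU := hT.asc_closed hM hz hs hs
    have hUne := hasc hs
    rw [hqs.eval_eq_prod_roots, hws.eval_eq_prod_roots, hlead, mul_assoc] at hU
    have hU' := mul_left_cancel₀ hlc hU
    have hDU := hM.descFactor_mul_ascFactor hz hs
    rw [hM.busyTransform_eq hz hs, Multiset.map_add, Multiset.prod_add, Multiset.map_add,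
      Multiset.prod_add, mul_div_mul_right _ _ h3, ← hDU, ← hU', mul_assoc, mul_div_assoc',
      mul_comm (ascFactor μ B A z s s), div_self (mul_ne_zero h1 hUne), mul_one, descFactor]
    ring

end

/-! ### Listing the zeros -/

theorem exists_fin_map_eq {m : Multiset ℂ} {n : ℕ} (h : m.card = n) :
    ∃ ξ : Fin n → ℂ, (Finset.univ : Finset (Fin n)).val.map ξ = m := by
  subst h
  induction m using Quotient.inductionOn with
  | _ l => exact ⟨l.get, (Fin.univ_val_map l.get).trans (congrArg _ (List.ofFn_get l))⟩

theorem prod_eq_prod_map {n : ℕ} (ξ : Fin n → ℂ) (s : ℂ) :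
    ∏ i, (s - ξ i) =
      (((Finset.univ : Finset (Fin n)).val.map ξ).map fun w => s - w).prod := by
  rw [Multiset.map_map]
  rfl

theorem listsLeftZeros_of_map {f : ℂ → ℂ} {n : ℕ} {ξ : Fin n → ℂ} {m : Multiset ℂ}
    (hf : AnalyticOnNhd ℂ f {w : ℂ | w.re < 0})
    (hξ : (Finset.univ : Finset (Fin n)).val.map ξ = m) (hm : ∀ w ∈ m, w.re < 0)
    (hcount : ∀ w : ℂ, w.re < 0 → (m.count w : ℕ∞) = analyticOrderAt f w) :
    ListsLeftZeros f ξ := by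
  classical
  refine ⟨hf, fun i => hm _ ?_, fun w hw => ?_⟩
  · rw [← hξ]
    exact Multiset.mem_map_of_mem _ (Finset.mem_univ i)
  · rw [← hcount w hw, ← hξ, Multiset.count_map, Nat.card_eq_fintype_card, Fintype.card_subtype]
    congr 2
    simp only [Finset.filter, eq_comm]
    rfl

end BusyPeriod

end

/-! ### Both parts of the theorem -/

theorem mainTheorem6 {Ω : Type*} [MeasurableSpace Ω] (μ : Measure Ω) [IsProbabilityMeasure μ]
    (B A : ℕ → Ω → ℝ)
    (hBm : ∀ i, Measurable (B i)) (hAm : ∀ i, Measurable (A i))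
    (hindep : iIndepFun (fun (i : ℕ) (ω : Ω) => (B i ω, A i ω)) μ)
    (hident : ∀ i, IdentDistrib (fun ω => (B i ω, A i ω)) (fun ω => (B 0 ω, A 0 ω)) μ μ)
    (hB0 : ∀ᵐ ω ∂μ, 0 ≤ B 0 ω) (hA0 : ∀ᵐ ω ∂μ, 0 ≤ A 0 ω)
    (hne : ∀ᵐ ω ∂μ, B 0 ω ≠ A 0 ω)
    (h₁ h₂ : ℂ → Polynomial ℂ)
    (hrat : BusyPeriod.IsRationalInFirst (BusyPeriod.jointLST μ (B 0) (A 0)) h₁ h₂)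
    (hfin : ∀ s : ℂ, 0 ≤ s.re →
      {ξ : ℂ | ξ.re < 0 ∧ BusyPeriod.antidiag h₂ s ξ = 0}.Finite) :
    ∀ s : ℂ, 0 ≤ s.re →
      ∃ (n : ℕ) (ξ : Fin n → ℂ),
        BusyPeriod.ListsLeftZeros (BusyPeriod.antidiag h₂ s) ξ ∧
        (0 < s.re → ∀ z : ℂ, ‖z‖ < 1 →
          ∃ ζ : Fin n → ℂ,
            BusyPeriod.ListsLeftZeros
              (fun w => BusyPeriod.antidiag h₂ s w - z * BusyPeriod.antidiag h₁ s w) ζ ∧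
            BusyPeriod.busyTransform μ B A z s =
              1 - (1 - z * BusyPeriod.jointLST μ (B 0) (A 0) s 0) *
                ((∏ i, (s - ξ i)) / ∏ i, (s - ζ i))) ∧
        (∫⁻ ω, ENNReal.ofReal (B 0 ω) ∂μ < ∫⁻ ω, ENNReal.ofReal (A 0 ω) ∂μ →
          (∀ᵐ ω ∂μ, BusyPeriod.firstNegative B A ω ≠ ⊤) ∧
          ∃ ζ : Fin n → ℂ,
            BusyPeriod.ListsLeftZeros
              (fun w => BusyPeriod.antidiag h₂ s w - BusyPeriod.antidiag h₁ s w) ζ ∧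
            BusyPeriod.busyTransform μ B A 1 s =
              1 - (1 - BusyPeriod.jointLST μ (B 0) (A 0) s 0) *
                ((∏ i, (s - ξ i)) / ∏ i, (s - ζ i))) := by
  intro s hs
  have hM : BusyPeriod.IsModel μ B A := ⟨hBm, hAm, hindep, hident, hB0, hA0, hne⟩
  obtain ⟨d, hd⟩ := BusyPeriod.exists_degree_bound hrat
  have hsub : {ξ : ℂ | ξ.re < 0} ⊆ {ξ | ξ.re < s.re} := fun ξ hξ => lt_of_lt_of_le hξ hs
  have a₁ := (BusyPeriod.analyticOnNhd_antidiag hrat.holo₁ (fun τ hτ => (hd τ hτ).1) s).mono hsub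
  have a₂ := (BusyPeriod.analyticOnNhd_antidiag hrat.holo₂ (fun τ hτ => (hd τ hτ).2) s).mono hsub
  obtain ⟨m, hm, hcount⟩ := BusyPeriod.exists_zero_multiset a₂ (hfin s hs)
  obtain ⟨ξ, hξ⟩ := BusyPeriod.exists_fin_map_eq (rfl : m.card = m.card)
  -- The two parts differ only in why the survival series converges: geometrically for `|z| < 1`, by
  -- negative drift for `z = 1`.
  have key : ∀ z : ℂ, ‖z‖ ≤ 1 →
      (Summable fun n => ‖z‖ ^ n * μ.real (BusyPeriod.stay B A (Set.Ici 0) n)) →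
      ∃ ζ : Fin m.card → ℂ, BusyPeriod.ListsLeftZeros
        (fun w => BusyPeriod.antidiag h₂ s w - z * BusyPeriod.antidiag h₁ s w) ζ ∧
        BusyPeriod.busyTransform μ B A z s =
          1 - (1 - z * BusyPeriod.jointLST μ (B 0) (A 0) s 0) *
            ((∏ i, (s - ξ i)) / ∏ i, (s - ζ i)) := by
    intro z hz hsum
    obtain ⟨m', hcard, hm', hcount', hbusy⟩ :=
      hM.exists_zeros_busyTransform hrat hfin hz hs hsum hm hcount
    obtain ⟨ζ, hζ⟩ := BusyPeriod.exists_fin_map_eq hcard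
    refine ⟨ζ, BusyPeriod.listsLeftZeros_of_map (a₂.sub (analyticOnNhd_const.mul a₁)) hζ hm'
      hcount', ?_⟩
    rw [hbusy, BusyPeriod.prod_eq_prod_map ξ, BusyPeriod.prod_eq_prod_map ζ, hξ, hζ]
  refine ⟨m.card, ξ, BusyPeriod.listsLeftZeros_of_map a₂ hξ hm hcount,
    fun _ z hz => key z hz.le (BusyPeriod.summable_stay _ hz), fun hdrift => ?_⟩
  have hsum := hM.summable_stay_of_drift hdrift
  refine ⟨BusyPeriod.ae_firstNegative_ne_top hsum, ?_⟩
  simpa only [one_mul] using key 1 norm_one.le (by simpa using hsum)
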